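/- **Setting.** Let $\Omega\subset\mathbb R^d$ be a bounded Lipschitz domain, $Y=[0,1)^d$, and let $\omega\subset Y$ be open and simply connected, with connected Lipschitz boundary and $\mathrm{dist}(\omega,\partial Y)>0$. Let $A=(a_{ij})$ be a real symmetric, $\mathbb Z^d$-periodic, Hölder continuous matrix field on $\mathbb R^d$ with $\nu|\xi|^2\le a_{ij}(y)\xi_i\xi_j\le\nu^{-1}|\xi|^2$, where $\nu>0$. Let $0<\varepsilon<1$, $0<\delta<\infty$, $\kappa=\delta^{-1}\varepsilon^2$, and let $\Lambda_\delta$ be $\delta$ on $\omega$ and $1$ on $Y\setminus\overline\omega$. * Homogenized operator: $\widehat{\mathcal L}_\delta=-\mathrm{div}(\widehat A_\delta\nabla)$ on $\Omega$ with Dirichlet condition, where $(\widehat A_\delta)_{ij}=\int_Y\Lambda_\delta\,(a_{ij}+a_{ik}\partial_{y_k}\chi_j)\,dy$ and $\chi_j$ is the $Y$-periodic mean-zero weak solution of $\mathrm{div}\big(\Lambda_\delta A\nabla(\chi_j+y_j)\big)=0$. Let $0<\theta_1\le\theta_2\le\cdots$ be its eigenvalues, counted with multiplicity. * Inclusion: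 for $f\in L^2(Y)$ let $\mathcal L_\omega^{-1}f$ be the weak solution of $-\mathrm{div}(A\nabla u)=f$ in $\omega$, $u\in H^1_0(\omega)$, extended by $0$ to $Y$. Let $\beta_1>\beta_2>\cdots$ be the distinct eigenvalues of $\mathcal L_\omega^{-1}$ on $L^2(\omega)$ that have an eigenfunction of nonzero mean, and put $(\kappa\beta_0)^{-1}:=0$. * Let $\gamma_\kappa(r)=-\int_Y(\kappa\mathcal L_\omega^{-1}-r)^{-1}[1]\,dy$ (extended continuously to those $r$ for which $r/\kappa$ is an eigenvalue of $\mathcal L_\omega^{-1}$ with mean-zero eigenfunctions only) and $\beta_\kappa(\lambda)=\gamma_\kappa(\lambda^{-1})$. * Perturbation: let $\mathcal P_\varepsilon$ replace a function, extended by $0$ outside $\Omega$, by its average on each cell $\varepsilon(n+Y)$, $n\in\mathbb Z^d$, and on $L^2(\Omega)$ let $$B_{\varepsilon,\delta,r}=\big(1-r^{-1}\gamma_\kappa(r)^{-1}\big)\,\mathbb 1_\Omega(\mathcal P_\varepsilon-\mathrm{Id})\,\widehat{\mathcal L}_\delta^{-1}.$$ Let $\theta_j^\varepsilon(r)$ denote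 the $j$-th eigenvalue of $(\widehat{\mathcal L}_\delta^{-1}+B_{\varepsilon,\delta,r})^{-1}$, that is, the inverse of the $j$-th largest eigenvalue (with multiplicity) of $\widehat{\mathcal L}_\delta^{-1}+B_{\varepsilon,\delta,r}$, if this exists and is nonzero. **Theorem.** There is a constant $C>0$, depending only on $\Omega$, $\omega$ and $\nu$ (not on the rest of $A$, nor on $\varepsilon,\delta,i,j$), such that for all $A,\varepsilon,\delta$ as above and all $i\ge0$, $j\ge1$ the following holds. Let $I_i=\big((\kappa\beta_i)^{-1},(\kappa\beta_{i+1})^{-1}\big)$. 1. The equation $\beta_\kappa(\lambda)=\theta_j$ has exactly one solution $\lambda_{i,j}$ in $I_i$. 2. The equation $\beta_\kappa(\lambda)=\theta_j^\varepsilon(\lambda^{-1})$ has at most one solution in $I_i$; when it exists, denote it by $\lambda^\varepsilon_{i,j}$. 3. If $\varepsilon<C/\theta_j$ and $\lambda^\varepsilon_{i,j}$ exists, then $$|\lambda_{i,j}-\lambda_{i,j}^\varepsilon|\le C\,\varepsilon\,\theta_j\big(\theta_j+(\kappa\beta_{i+1})^{-1}\big).$$ -/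

import Mathlib

open MeasureTheory Set

noncomputable section

namespace HighContrast

/-- Euclidean space `ℝ^d`. -/
abbrev E (d : ℕ) := EuclideanSpace ℝ (Fin d)

/-- Lattice vectors `n ∈ ℤ^d`, seen in `ℝ^d`. -/
def latticeVec {d : ℕ} (n : Fin d → ℤ) : E d := WithLp.toLp 2 (fun k => (n k : ℝ))

/-- The unit cell `Y = [0,1)^d`. -/
def unitCell (d : ℕ) : Set (E d) := {y | ∀ k, 0 ≤ y k ∧ y k < 1}

/-- The cell `ε (n + Y)`. -/
def cell {d : ℕ} (ε : ℝ) (n : Fin d → ℤ) : Set (E d) :=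
  {x | ∀ k, ε * n k ≤ x k ∧ x k < ε * (n k + 1)}

/-! ### Domains -/

/-- `U` has Lipschitz boundary: near each boundary point, in suitable orthonormal coordinates with
vertical direction `e`, the set `U` is the strict epigraph of a Lipschitz function of the
component orthogonal to `e`. -/
def HasLipschitzBoundary {d : ℕ} (U : Set (E d)) : Prop :=
  ∀ x ∈ frontier U, ∃ (r : ℝ) (e : E d) (K : NNReal) (g : E d → ℝ),
    0 < r ∧ ‖e‖ = 1 ∧ LipschitzWith K g ∧
      ∀ y ∈ Metric.ball x r, y ∈ U ↔ g (y - (inner ℝ e y) • e) < inner ℝ e y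

/-- Bounded Lipschitz domain. -/
structure IsBoundedLipschitzDomain {d : ℕ} (U : Set (E d)) : Prop where
  isOpen : IsOpen U
  isConnected : IsConnected U
  isBounded : Bornology.IsBounded U
  lipschitz : HasLipschitzBoundary U

/-- The model inclusion `ω ⊂ Y`: open, simply connected, with connected Lipschitz boundary and at
positive distance from `∂Y`. -/
structure IsModelInclusion {d : ℕ} (ω : Set (E d)) : Prop where
  isOpen : IsOpen ω
  subset_cell : ω ⊆ unitCell d
  simplyConnected : SimplyConnectedSpace ω
  connected_boundary : IsConnected (frontier ω)
  lipschitz : HasLipschitzBoundary ω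
  dist_pos : ∃ r : ℝ, 0 < r ∧ ∀ x ∈ ω, ∀ y ∈ frontier (unitCell d), r ≤ dist x y

/-- Scalar coefficient matrix `A`: uniformly elliptic with constant `ν`, `ℤ^d`-periodic, Hölder
continuous and symmetric. -/
structure IsCoefficient {d : ℕ} (ν : ℝ) (A : E d → Matrix (Fin d) (Fin d) ℝ) : Prop where
  elliptic_lower : ∀ (y ξ : E d), ν * ‖ξ‖ ^ 2 ≤ ∑ i, ∑ k, A y i k * ξ i * ξ k
  elliptic_upper : ∀ (y ξ : E d), ∑ i, ∑ k, A y i k * ξ i * ξ k ≤ ν⁻¹ * ‖ξ‖ ^ 2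
  periodic : ∀ (y : E d) (n : Fin d → ℤ), A (y + latticeVec n) = A y
  holder : ∃ (τ s : ℝ), 0 < τ ∧ 0 < s ∧ s < 1 ∧
    ∀ (y w : E d) (i k : Fin d), |A y i k - A w i k| ≤ τ * ‖y - w‖ ^ s
  symmetric : ∀ (y : E d) (i k : Fin d), A y i k = A y k i

/-! ### Sobolev spaces and Dirichlet problems -/

/-- `H₀¹(U)`, every function being extended by zero to `ℝ^d`: pairs `(u, ∇u)` in the closure of
`{(φ, ∇φ) : φ ∈ C_c^∞(U)}` in `L²(ℝ^d) × L²(ℝ^d; ℝ^d)`. -/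
def H10 {d : ℕ} (U : Set (E d)) :
    Set (Lp ℝ 2 (volume : Measure (E d)) × Lp (E d) 2 (volume : Measure (E d))) :=
  closure {p | ∃ φ : E d → ℝ, ContDiff ℝ (⊤ : ℕ∞) φ ∧ HasCompactSupport φ ∧ tsupport φ ⊆ U ∧
    (p.1 : E d → ℝ) =ᵐ[volume] φ ∧ (p.2 : E d → E d) =ᵐ[volume] gradient φ}

/-- `u` (extended by zero outside `U`) is the weak solution in `H₀¹(U)` of
`-div (a ∇u) = f` in `U`, `u = 0` on `∂U`; i.e. `u = (-div a∇)⁻¹ f` for the Dirichlet operator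
on `U`. -/
def IsDirichletSolution {d : ℕ} (U : Set (E d)) (a : E d → Matrix (Fin d) (Fin d) ℝ)
    (f : E d → ℝ) (u : Lp ℝ 2 (volume : Measure (E d))) : Prop :=
  ∃ Du : Lp (E d) 2 (volume : Measure (E d)), (u, Du) ∈ H10 U ∧
    ∀ p ∈ H10 U,
      ∫ x in U, ∑ i, ∑ k, a x i k * Du x k * p.2 x i = ∫ x in U, f x * p.1 x

/-- `χ ∈ H¹_per(Y)` with weak gradient `G`, both extended periodically to `ℝ^d`. -/
structure IsPeriodicH1 {d : ℕ} (χ : E d → ℝ) (G : E d → E d) : Prop where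
  periodic : ∀ (y : E d) (n : Fin d → ℤ), χ (y + latticeVec n) = χ y
  periodic_grad : ∀ (y : E d) (n : Fin d → ℤ), G (y + latticeVec n) = G y
  memLp : MemLp χ 2 (volume.restrict (unitCell d))
  memLp_grad : MemLp G 2 (volume.restrict (unitCell d))
  weak_grad : ∀ φ : E d → ℝ, ContDiff ℝ (⊤ : ℕ∞) φ → HasCompactSupport φ →
    ∫ x, χ x • gradient φ x = - ∫ x, φ x • G x

/-! ### The homogenized coefficients -/

open Classical in
/-- The contrast `Λ_δ` on the unit cell: `δ` in the inclusion and `1` in the matrix (the value on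
the null set `∂ω` is irrelevant). -/
def contrast {d : ℕ} (ω : Set (E d)) (δ : ℝ) (y : E d) : ℝ := if y ∈ ω then δ else 1

/-- `χ`, with gradient `G`, is the solution of the `j`-th cell problem: `χ` is `Y`-periodic with
mean zero and `-div (Λ_δ A (∇χ + e_j)) = 0` weakly on the torus. -/
structure IsCorrector {d : ℕ} (ω : Set (E d)) (A : E d → Matrix (Fin d) (Fin d) ℝ) (δ : ℝ)
    (j : Fin d) (χ : E d → ℝ) (G : E d → E d) : Prop where
  memH1 : IsPeriodicH1 χ G
  mean_zero : ∫ y in unitCell d, χ y = 0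
  weak_eq : ∀ (η : E d → ℝ) (H : E d → E d), IsPeriodicH1 η H →
    ∫ y in unitCell d, contrast ω δ y *
      ∑ i, ∑ k, A y i k * (G y k + if k = j then 1 else 0) * H y i = 0

/-- The homogenized matrix `â_ij = ∫_Y Λ_δ (a_ij + a_ik ∂_k χ_j)`, where `G j = ∇χ_j`. -/
def homogenizedMatrix {d : ℕ} (ω : Set (E d)) (A : E d → Matrix (Fin d) (Fin d) ℝ) (δ : ℝ)
    (G : Fin d → E d → E d) : Matrix (Fin d) (Fin d) ℝ :=
  fun i j => ∫ y in unitCell d, contrast ω δ y * (A y i j + ∑ k, A y i k * G j y k)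

/-! ### Eigenvalues counted with multiplicity -/

/-- Given the eigenspaces `Eig s`, `t` is the `j`-th smallest eigenvalue (`j ≥ 1`), counted with
multiplicity: fewer than `j` independent eigenvectors have eigenvalue `< t`, and at least `j` have
eigenvalue `≤ t`. -/
def IsNthSmallestEigenvalue {V : Type*} [AddCommGroup V] [Module ℝ V] (Eig : ℝ → Set V)
    (j : ℕ) (t : ℝ) : Prop :=
  Module.rank ℝ (Submodule.span ℝ {u | ∃ s, s < t ∧ u ∈ Eig s}) < (j : Cardinal) ∧
  (j : Cardinal) ≤ Module.rank ℝ (Submodule.span ℝ {u | ∃ s, s ≤ t ∧ u ∈ Eig s})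

/-- The same for the `j`-th largest eigenvalue. -/
def IsNthLargestEigenvalue {V : Type*} [AddCommGroup V] [Module ℝ V] (Eig : ℝ → Set V)
    (j : ℕ) (t : ℝ) : Prop :=
  Module.rank ℝ (Submodule.span ℝ {u | ∃ s, t < s ∧ u ∈ Eig s}) < (j : Cardinal) ∧
  (j : Cardinal) ≤ Module.rank ℝ (Submodule.span ℝ {u | ∃ s, t ≤ s ∧ u ∈ Eig s})

/-- Eigenspace of the Dirichlet operator `-div (Â ∇)` on `Ω` for the value `s`. -/
def homogenizedEigenspace {d : ℕ} (Ω : Set (E d)) (Ahat : Matrix (Fin d) (Fin d) ℝ) (s : ℝ) :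
    Set (Lp ℝ 2 (volume : Measure (E d))) :=
  {u | IsDirichletSolution Ω (fun _ => Ahat) (fun x => s * u x) u}

/-! ### The inclusion: Bloch eigenvalues and the function `β_κ` -/

/-- The eigenvalues `b` of `L_ω⁻¹` having an eigenfunction `ψ ∈ L²(ω)` with nonzero mean. -/
def meanEigenvalues {d : ℕ} (ω : Set (E d)) (A : E d → Matrix (Fin d) (Fin d) ℝ) : Set ℝ :=
  {b | ∃ (ψ : Lp ℝ 2 (volume.restrict ω)) (w : Lp ℝ 2 (volume : Measure (E d))),
    IsDirichletSolution ω A ψ w ∧ (∀ᵐ y ∂(volume.restrict ω), w y = b * ψ y) ∧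
      ∫ y in ω, ψ y ≠ 0}

/-- `β_1 > β_2 > ⋯` is the decreasing enumeration of `meanEigenvalues` (`β 0` plays no role). -/
def IsMeanEigenvalueSequence {d : ℕ} (ω : Set (E d)) (A : E d → Matrix (Fin d) (Fin d) ℝ)
    (β : ℕ → ℝ) : Prop :=
  StrictAntiOn β (Ici 1) ∧ β '' Ici 1 = meanEigenvalues ω A

/-- `(κ β_i)⁻¹`, with the convention that it is `0` for `i = 0`. -/
def pole (κ : ℝ) (β : ℕ → ℝ) (i : ℕ) : ℝ := if i = 0 then 0 else (κ * β i)⁻¹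

/-- `b = -(κ L_ω⁻¹ - r)⁻¹[1]` in `L²(Y)`, where `L_ω⁻¹ b = w` is extended by zero to `Y \ ω`. -/
def IsResolventOfOne {d : ℕ} (ω : Set (E d)) (A : E d → Matrix (Fin d) (Fin d) ℝ) (κ r : ℝ)
    (b : Lp ℝ 2 (volume.restrict (unitCell d))) : Prop :=
  ∃ w : Lp ℝ 2 (volume : Measure (E d)), IsDirichletSolution ω A b w ∧
    ∀ᵐ y ∂(volume.restrict (unitCell d)), κ * w y - r * b y = -1

open Classical in
/-- `γ_κ(r) = -∫_Y (κ L_ω⁻¹ - r)⁻¹[1]`. If `r / κ` is an eigenvalue of `L_ω⁻¹` all of whose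
eigenfunctions have mean zero, the equation is still solvable and all its solutions have the
same integral, so that this is the continuous extension; at the poles `r = κ β_i` there is no
solution and the value is meaningless. -/
def gammaK {d : ℕ} (ω : Set (E d)) (A : E d → Matrix (Fin d) (Fin d) ℝ) (κ r : ℝ) : ℝ :=
  if h : ∃ b, IsResolventOfOne ω A κ r b then ∫ y in unitCell d, h.choose y else 0

/-- `β_κ(l) = γ_κ(l⁻¹)`. -/
def betaK {d : ℕ} (ω : Set (E d)) (A : E d → Matrix (Fin d) (Fin d) ℝ) (κ l : ℝ) : ℝ :=
  gammaK ω A κ l⁻¹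

/-! ### The perturbed operator -/

/-- The projection `P_ε` applied to a function of `x` only: the average over the cell
`ε (n + Y)` containing `x`. -/
def cellAverage {d : ℕ} (ε : ℝ) (v : E d → ℝ) (x : E d) : ℝ :=
  (ε ^ d)⁻¹ * ∫ z in cell ε (fun k => ⌊x k / ε⌋), v z

/-- Eigenspace in `L²(Ω)`, for the value `s`, of `L̂⁻¹ + B_{ε,δ,r}`, where
`B_{ε,δ,r} = (1 - r⁻¹ γ_κ(r)⁻¹) 1_Ω (P_ε - Id) L̂⁻¹` and `L̂⁻¹ f = v` is extended by zero. -/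
def perturbedEigenspace {d : ℕ} (Ω ω : Set (E d)) (A : E d → Matrix (Fin d) (Fin d) ℝ)
    (Ahat : Matrix (Fin d) (Fin d) ℝ) (κ ε r s : ℝ) : Set (Lp ℝ 2 (volume.restrict Ω)) :=
  {f | ∃ v : Lp ℝ 2 (volume : Measure (E d)), IsDirichletSolution Ω (fun _ => Ahat) f v ∧
    ∀ᵐ x ∂(volume.restrict Ω),
      v x + (1 - r⁻¹ * (gammaK ω A κ r)⁻¹) * (cellAverage ε v x - v x) = s * f x}

/-- `t` is the `j`-th eigenvalue of `(L̂⁻¹ + B_{ε,δ,r})⁻¹`: `t⁻¹` is the `j`-th largest eigenvalue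
of `L̂⁻¹ + B_{ε,δ,r}`. -/
def IsPerturbedEigenvalue {d : ℕ} (Ω ω : Set (E d)) (A : E d → Matrix (Fin d) (Fin d) ℝ)
    (Ahat : Matrix (Fin d) (Fin d) ℝ) (κ ε r : ℝ) (j : ℕ) (t : ℝ) : Prop :=
  t ≠ 0 ∧ IsNthLargestEigenvalue (perturbedEigenspace Ω ω A Ahat κ ε r) j t⁻¹

/-- `l` is a solution of `β_κ(l) = θ_j^ε` in `((κβ_i)⁻¹, (κβ_{i+1})⁻¹)`, where `θ_j^ε` is the `j`-th
eigenvalue of `(L̂⁻¹ + B_{ε,δ,r})⁻¹` at the spectral value `r = l⁻¹`. -/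
def IsPerturbedSolution {d : ℕ} (Ω ω : Set (E d)) (A : E d → Matrix (Fin d) (Fin d) ℝ)
    (Ahat : Matrix (Fin d) (Fin d) ℝ) (κ ε : ℝ) (β : ℕ → ℝ) (i j : ℕ) (l : ℝ) : Prop :=
  l ∈ Ioo (pole κ β i) (pole κ β (i + 1)) ∧
    ∃ θε : ℝ, IsPerturbedEigenvalue Ω ω A Ahat κ ε l⁻¹ j θε ∧ betaK ω A κ l = θε

/-- `l` is a solution of `β_κ(l) = θ` in `((κβ_i)⁻¹, (κβ_{i+1})⁻¹)`. -/
def IsLimitSolution {d : ℕ} (ω : Set (E d)) (A : E d → Matrix (Fin d) (Fin d) ℝ)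
    (κ : ℝ) (β : ℕ → ℝ) (i : ℕ) (θ l : ℝ) : Prop :=
  l ∈ Ioo (pole κ β i) (pole κ β (i + 1)) ∧ betaK ω A κ l = θ

end HighContrast

end

/-! Let `J` be the inclusion of the energy space `H`, that is H₀¹(Ω) with the inner product given by
the form of Â, into L²(Ω), and let `Q` be cell averaging on L²(Ω). Then L̂⁻¹ = J J†. With λ = r⁻¹
and a = λ / β_κ(λ), the perturbed operator is L̂⁻¹ + B = M J J†, where M = a + (1 - a) Q. It is not
symmetric on L²(Ω), but A B and B A share their nonzero eigenvalues, so it can be replaced by the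
compact symmetric operator J† M J on `H` (`rank_eigenSpan_sandwich`). Counting eigenvalues then
amounts to comparing the forms a N + (1 - a) q, where N = ‖J w‖², q = ⟨Q J w, J w⟩ and 0 ≤ q ≤ N,
through the variational principle `le_rank_eigenSpan`.

Limit equation. Let x_λ solve x - λ κ L_ω⁻¹ x = 1 on ω. Then β_κ(λ) = λ |Y \ ω| + λ ⟨1, x_λ⟩, and a
resolvent identity gives β_κ(m) - β_κ(l) = (m - l) (|Y \ ω| + ⟨x_l, x_m⟩). Between consecutive poles
the factors 1 - l b and 1 - m b have the same sign for every eigenvalue b of κ L_ω⁻¹ that is seen by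
the constant 1. Hence ⟨x_l, x_m⟩ ≥ 0 and β_κ increases with slope at least |Y \ ω|. The same product
blows up at the poles, so every positive value is taken (`exists_zhikov`,
`IsEnergyEmbedding.betaK_between_poles`).

Uniqueness for the perturbed equation. A solution λ with t = β_κ(λ) must have t > 0: for t < 0 the
operator M is negative on the kernel of the finite rank operator Q, which produces infinitely many
eigenvalues in (t⁻¹, 0). For t > 0 the condition says that the j-th eigenvalue of t J† M J is 1. Its
form λ (N - q) + t q increases strictly in λ and t together, and t increases with λ, so two
solutions cannot coexist (`le_rank_eigenSpan_sandwich_mixOp`).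

Error estimate. The forms of J† J and J† M J differ by (1 - a) (N - q), and Poincaré's inequality on
cells gives N - q ≤ C₁ ε² ‖w‖². So |θ⁻¹ - t⁻¹| ≤ |1 - λ/t| C₁ ε² (`abs_inv_sub_inv_le`). Elementary
algebra turns this into a bound for |θ - t|, and the slope bound for β_κ turns that into a bound for
the distance of the solutions (`abs_sub_le_of_eigenvalues`).

The constant depends on Â only through a lower ellipticity bound that is uniform in δ. It comes from
the matrix phase alone: a layer along each face of the cell avoids ω, and there periodic gradients
average to zero along lines (`IsModelInclusion.exists_energy_lower_bound`). -/

noncomputable section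

namespace HighContrast

open scoped RealInnerProductSpace Topology ENNReal
open Filter

/-! ### Spectral subspaces of compact symmetric operators -/

section Spectral

variable {H : Type*} [NormedAddCommGroup H] [InnerProductSpace ℝ H]

/-- The span of all eigenvectors of `T` whose eigenvalue lies in `S`. -/
def eigenSpan {V : Type*} [AddCommGroup V] [Module ℝ V] (T : V →ₗ[ℝ] V) (S : Set ℝ) :
    Submodule ℝ V :=
  Submodule.span ℝ {u | ∃ s, s ∈ S ∧ T u = s • u}

/-- Grouping by eigenvalue leaves one vector per eigenvalue. The family is indexed by all reals,
with zero vectors allowed, so that no side condition is carried along. -/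
theorem exists_sum_of_mem_eigenSpan {V : Type*} [AddCommGroup V] [Module ℝ V] {T : V →ₗ[ℝ] V}
    {S : Set ℝ} {w : V} (hw : w ∈ eigenSpan T S) :
    ∃ (F : Finset ℝ) (v : ℝ → V), ↑F ⊆ S ∧ (∀ s, T (v s) = s • v s) ∧ w = ∑ s ∈ F, v s := by
  classical
  induction hw using Submodule.span_induction with
  | mem u hu =>
    obtain ⟨s, hs, hu⟩ := hu
    refine ⟨{s}, fun r => if r = s then u else 0, by simpa using hs, fun r => ?_, by simp⟩
    by_cases h : r = s <;> simp [h, hu]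
  | zero => exact ⟨∅, fun _ => 0, by simp, by simp, by simp⟩
  | add x y _ _ hx hy =>
    obtain ⟨F, v, hF, hv, rfl⟩ := hx
    obtain ⟨F', v', hF', hv', rfl⟩ := hy
    refine ⟨F ∪ F', fun s => (if s ∈ F then v s else 0) + if s ∈ F' then v' s else 0, ?_, ?_, ?_⟩
    · simpa using ⟨hF, hF'⟩
    · intro s
      by_cases h : s ∈ F <;> by_cases h' : s ∈ F' <;> simp [h, h', hv, hv']
    · rw [Finset.sum_add_distrib, Finset.sum_ite_mem, Finset.sum_ite_mem]
      simp
  | smul a x _ hx =>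
    obtain ⟨F, v, hF, hv, rfl⟩ := hx
    exact ⟨F, fun s => a • v s, hF, fun s => by rw [map_smul, hv, smul_comm], Finset.smul_sum⟩

theorem inner_eq_zero_of_eigen {T : H →ₗ[ℝ] H} (hT : T.IsSymmetric) {x y : H} {s t : ℝ}
    (hx : T x = s • x) (hy : T y = t • y) (hst : s ≠ t) : ⟪x, y⟫ = 0 := by
  have h := hT x y
  rw [hx, hy, real_inner_smul_left, real_inner_smul_right] at h
  have : (s - t) * ⟪x, y⟫ = 0 := by linarith
  exact (mul_eq_zero.mp this).resolve_left (sub_ne_zero.mpr hst)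

theorem inner_sum_eigen {T : H →ₗ[ℝ] H} (hT : T.IsSymmetric) {F : Finset ℝ} {v : ℝ → H}
    (hv : ∀ s, T (v s) = s • v s) (f g : ℝ → ℝ) :
    ⟪∑ s ∈ F, f s • v s, ∑ s ∈ F, g s • v s⟫ = ∑ s ∈ F, f s * g s * ‖v s‖ ^ 2 := by
  rw [sum_inner]
  refine Finset.sum_congr rfl fun s hs => ?_
  rw [inner_sum, Finset.sum_eq_single s]
  · rw [real_inner_smul_left, real_inner_smul_right, real_inner_self_eq_norm_sq]; ring
  · intro r _ hr
    rw [real_inner_smul_left, real_inner_smul_right, inner_eq_zero_of_eigen hT (hv s) (hv r) hr.symm]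
    ring
  · exact fun h => absurd hs h

/-- Eigenvectors for distinct eigenvalues are orthogonal, so Parseval applies, with `m s` the mass
at the eigenvalue `s`. The spectral inequalities below then become termwise comparisons of weighted
sums. -/
theorem exists_rayleigh_of_mem_eigenSpan {T : H →ₗ[ℝ] H} (hT : T.IsSymmetric) {S : Set ℝ} {w : H}
    (hw : w ∈ eigenSpan T S) :
    ∃ (F : Finset ℝ) (m : ℝ → ℝ), ↑F ⊆ S ∧ (∀ s, 0 ≤ m s) ∧ ⟪T w, w⟫ = ∑ s ∈ F, s * m s ∧
      ⟪T w, T w⟫ = ∑ s ∈ F, s ^ 2 * m s ∧ ‖w‖ ^ 2 = ∑ s ∈ F, m s := by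
  obtain ⟨F, v, hF, hv, rfl⟩ := exists_sum_of_mem_eigenSpan hw
  refine ⟨F, fun s => ‖v s‖ ^ 2, hF, fun s => by positivity, ?_, ?_, ?_⟩
  · have := inner_sum_eigen hT (F := F) hv (fun s => s) 1
    simpa [hv] using this
  · have := inner_sum_eigen hT (F := F) hv (fun s => s) (fun s => s)
    simpa [hv, sq] using this
  · have := inner_sum_eigen hT (F := F) hv 1 1
    rw [← real_inner_self_eq_norm_sq]
    simpa [hv] using this

theorem rayleigh_le_of_mem_eigenSpan {T : H →ₗ[ℝ] H} (hT : T.IsSymmetric) {S : Set ℝ} {t : ℝ}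
    (hS : ∀ s ∈ S, s ≤ t) {w : H} (hw : w ∈ eigenSpan T S) : ⟪T w, w⟫ ≤ t * ‖w‖ ^ 2 := by
  obtain ⟨F, m, hF, hm, h1, -, h2⟩ := exists_rayleigh_of_mem_eigenSpan hT hw
  rw [h1, h2, Finset.mul_sum]
  exact Finset.sum_le_sum fun s hs => mul_le_mul_of_nonneg_right (hS s (hF hs)) (hm s)

theorem le_rayleigh_of_mem_eigenSpan {T : H →ₗ[ℝ] H} (hT : T.IsSymmetric) {S : Set ℝ} {t : ℝ}
    (hS : ∀ s ∈ S, t ≤ s) {w : H} (hw : w ∈ eigenSpan T S) : t * ‖w‖ ^ 2 ≤ ⟪T w, w⟫ := by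
  obtain ⟨F, m, hF, hm, h1, -, h2⟩ := exists_rayleigh_of_mem_eigenSpan hT hw
  rw [h1, h2, Finset.mul_sum]
  exact Finset.sum_le_sum fun s hs => mul_le_mul_of_nonneg_right (hS s (hF hs)) (hm s)

theorem le_norm_apply_of_mem_eigenSpan {T : H →ₗ[ℝ] H} (hT : T.IsSymmetric) {S : Set ℝ} {t : ℝ}
    (ht : 0 ≤ t) (hS : ∀ s ∈ S, t ≤ |s|) {w : H} (hw : w ∈ eigenSpan T S) :
    t * ‖w‖ ≤ ‖T w‖ := by
  obtain ⟨F, m, hF, hm, -, h1, h2⟩ := exists_rayleigh_of_mem_eigenSpan hT hw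
  rw [real_inner_self_eq_norm_sq] at h1
  have : (t * ‖w‖) ^ 2 ≤ ‖T w‖ ^ 2 := by
    rw [mul_pow, h1, h2, Finset.mul_sum]
    refine Finset.sum_le_sum fun s hs => mul_le_mul_of_nonneg_right ?_ (hm s)
    rw [← sq_abs s]
    exact pow_le_pow_left₀ ht (hS s (hF hs)) 2
  exact le_of_sq_le_sq this (norm_nonneg _)

theorem apply_ne_zero_of_mem_eigenSpan {T : H →ₗ[ℝ] H} (hT : T.IsSymmetric) {S : Set ℝ}
    (hS : ∀ s ∈ S, s ≠ 0) {w : H} (hw : w ∈ eigenSpan T S) (h0 : T w = 0) : w = 0 := by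
  obtain ⟨F, m, hF, hm, -, h1, h2⟩ := exists_rayleigh_of_mem_eigenSpan hT hw
  rw [h0, inner_zero_left, eq_comm, Finset.sum_eq_zero_iff_of_nonneg
    fun s _ => mul_nonneg (sq_nonneg s) (hm s)] at h1
  have : ‖w‖ ^ 2 = 0 := by
    rw [h2]
    refine Finset.sum_eq_zero fun s hs => ?_
    exact (mul_eq_zero.mp (h1 s hs)).resolve_left (pow_ne_zero 2 (hS s (hF hs)))
  simpa using this

variable [CompleteSpace H]

theorem dense_eigenSpan_univ {T : H →L[ℝ] H} (hc : IsCompactOperator T)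
    (hT : (T : H →ₗ[ℝ] H).IsSymmetric) :
    (eigenSpan (T : H →ₗ[ℝ] H) univ)ᗮ = ⊥ := by
  rw [eq_bot_iff, ← ContinuousLinearMap.orthogonalComplement_iSup_eigenspaces_eq_bot hc hT]
  refine Submodule.orthogonal_le (iSup_le fun μ x hx => Submodule.subset_span ⟨μ, mem_univ _, ?_⟩)
  exact Module.End.mem_eigenspace_iff.mp hx

/-- On the orthogonal complement of the eigenvectors with eigenvalue in `S`, a compact symmetric
operator is the closure of its action on the remaining eigenvectors. -/
theorem mem_closure_eigenSpan_compl {T : H →L[ℝ] H} (hc : IsCompactOperator T)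
    (hT : (T : H →ₗ[ℝ] H).IsSymmetric) {S : Set ℝ} {w : H}
    (hw : w ∈ (eigenSpan (T : H →ₗ[ℝ] H) S)ᗮ) :
    w ∈ closure (eigenSpan (T : H →ₗ[ℝ] H) Sᶜ : Set H) := by
  set A := eigenSpan (T : H →ₗ[ℝ] H) Sᶜ
  set B := eigenSpan (T : H →ₗ[ℝ] H) S
  have hAB : ∀ a ∈ A, ∀ b ∈ B, ⟪b, a⟫ = 0 := by
    intro a ha b hb
    have hA : A ≤ Bᗮ := by
      refine Submodule.span_le.mpr ?_
      rintro a ⟨s, hs, ha⟩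
      rw [SetLike.mem_coe, Submodule.mem_orthogonal]
      intro b hb
      induction hb using Submodule.span_induction with
      | mem u hu =>
        obtain ⟨r, hr, hu⟩ := hu
        exact inner_eq_zero_of_eigen hT hu ha (by rintro rfl; exact hs hr)
      | zero => simp
      | add x y _ _ hx hy => rw [inner_add_left, hx, hy, add_zero]
      | smul c x _ hx => rw [real_inner_smul_left, hx, mul_zero]
    exact (Submodule.mem_orthogonal _ _).mp (hA ha) b hb
  have hle : A.topologicalClosure ≤ Bᗮ := by
    refine Submodule.topologicalClosure_minimal _ (fun a ha => ?_) (Submodule.isClosed_orthogonal _)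
    exact (Submodule.mem_orthogonal _ _).mpr fun b hb => hAB a ha b hb
  have : CompleteSpace A.topologicalClosure :=
    (Submodule.isClosed_topologicalClosure A).completeSpace_coe
  obtain ⟨a, ha, z, hz, rfl⟩ := A.topologicalClosure.exists_add_mem_mem_orthogonal w
  have hz0 : z ∈ (eigenSpan (T : H →ₗ[ℝ] H) univ)ᗮ := by
    have hzA : z ∈ Aᗮ := by rwa [Submodule.orthogonal_closure] at hz
    have hzB : z ∈ Bᗮ := by
      have := Submodule.sub_mem _ hw (hle ha)
      simpa using this
    rw [Submodule.mem_orthogonal] at *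
    intro u hu
    induction hu using Submodule.span_induction with
    | mem u hu =>
      obtain ⟨r, hr, hu⟩ := hu
      by_cases h : r ∈ S
      · exact hzB u (Submodule.subset_span ⟨r, h, hu⟩)
      · exact hzA u (Submodule.subset_span ⟨r, h, hu⟩)
    | zero => simp
    | add x y _ _ hx hy => rw [inner_add_left, hx, hy, add_zero]
    | smul c x _ hx => rw [real_inner_smul_left, hx, mul_zero]
  rw [dense_eigenSpan_univ hc hT, Submodule.mem_bot] at hz0
  rw [hz0, add_zero]
  exact ha

/-- The bound is termwise on finite sums of the remaining eigenvectors. Those are dense in the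
orthogonal complement, and the condition is closed. -/
theorem rayleigh_le_of_orthogonal {T : H →L[ℝ] H} (hc : IsCompactOperator T)
    (hT : (T : H →ₗ[ℝ] H).IsSymmetric) {t : ℝ} {w : H}
    (hw : w ∈ (eigenSpan (T : H →ₗ[ℝ] H) (Ioi t))ᗮ) : ⟪T w, w⟫ ≤ t * ‖w‖ ^ 2 := by
  have hcl : IsClosed {w : H | ⟪T w, w⟫ ≤ t * ‖w‖ ^ 2} :=
    isClosed_le (by fun_prop) (by fun_prop)
  refine closure_minimal ?_ hcl (mem_closure_eigenSpan_compl hc hT hw)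
  intro x hx
  exact rayleigh_le_of_mem_eigenSpan hT (fun s hs => not_lt.mp hs) hx

theorem rayleigh_nonneg_of_orthogonal {T : H →L[ℝ] H} (hc : IsCompactOperator T)
    (hT : (T : H →ₗ[ℝ] H).IsSymmetric) {w : H}
    (hw : w ∈ (eigenSpan (T : H →ₗ[ℝ] H) (Iio 0))ᗮ) : 0 ≤ ⟪T w, w⟫ := by
  have hcl : IsClosed {w : H | 0 ≤ ⟪T w, w⟫} := isClosed_le (by fun_prop) (by fun_prop)
  refine closure_minimal ?_ hcl (mem_closure_eigenSpan_compl hc hT hw)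
  intro x hx
  simpa using le_rayleigh_of_mem_eigenSpan hT (t := 0) (fun s hs => not_lt.mp hs) hx

omit [CompleteSpace H] in
-- Dimension count: the orthogonal projection of `W` to `V` cannot be injective.
theorem exists_mem_orthogonal_of_rank_lt (V W : Submodule ℝ H) [FiniteDimensional ℝ V]
    (h : Module.rank ℝ V < Module.rank ℝ W) : ∃ w ∈ W, w ≠ 0 ∧ w ∈ Vᗮ := by
  let p : W →ₗ[ℝ] V := (V.orthogonalProjectionOnto : H →ₗ[ℝ] V) ∘ₗ W.subtype
  by_contra! hcon
  have hp : Function.Injective p := by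
    rw [← LinearMap.ker_eq_bot, LinearMap.ker_eq_bot']
    intro w hw
    by_contra hne
    refine hcon w w.2 (by simpa using hne) ?_
    rw [← Submodule.ker_orthogonalProjectionOnto]
    exact hw
  exact absurd (LinearMap.rank_le_of_injective p hp) (not_le.mpr h)

/-- The variational principle: a subspace of dimension at least `j` on which the Rayleigh quotient
exceeds `t` forces `j` independent eigenvectors with eigenvalue above `t`. -/
theorem le_rank_eigenSpan {T : H →L[ℝ] H} (hc : IsCompactOperator T)
    (hT : (T : H →ₗ[ℝ] H).IsSymmetric) {t : ℝ} {j : ℕ} (W : Submodule ℝ H)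
    (hj : (j : Cardinal) ≤ Module.rank ℝ W) (hW : ∀ w ∈ W, w ≠ 0 → t * ‖w‖ ^ 2 < ⟪T w, w⟫) :
    (j : Cardinal) ≤ Module.rank ℝ (eigenSpan (T : H →ₗ[ℝ] H) (Ioi t)) := by
  by_contra! hlt
  have : FiniteDimensional ℝ (eigenSpan (T : H →ₗ[ℝ] H) (Ioi t)) :=
    Module.rank_lt_aleph0_iff.mp (hlt.trans (Cardinal.natCast_lt_aleph0))
  obtain ⟨w, hwW, hw0, hw⟩ := exists_mem_orthogonal_of_rank_lt _ W (hlt.trans_le hj)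
  exact absurd (rayleigh_le_of_orthogonal hc hT hw) (not_le.mpr (hW w hwW hw0))

omit [CompleteSpace H] in
-- In infinite dimension Riesz's lemma yields a bounded sequence separated by 1. On this span `T`
-- expands norms by at least `-t`, so the images stay separated by `-t`, against compactness.
theorem finiteDimensional_eigenSpan_Iic {T : H →L[ℝ] H} (hc : IsCompactOperator T)
    (hT : (T : H →ₗ[ℝ] H).IsSymmetric) {t : ℝ} (ht : t < 0) :
    FiniteDimensional ℝ (eigenSpan (T : H →ₗ[ℝ] H) (Iic t)) := by
  by_contra hinf
  obtain ⟨R, f, -, hfR, hf⟩ := exists_seq_norm_le_one_le_norm_sub (𝕜 := ℝ) hinf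
  obtain ⟨K, hK, hKs⟩ := hc.image_closedBall_subset_compact R
  obtain ⟨a, -, φ, hφ, hlim⟩ := hK.tendsto_subseq (x := fun n => T (f n)) fun n =>
    hKs ⟨f n, by simpa using hfR n, rfl⟩
  obtain ⟨N, hN⟩ := (Metric.cauchySeq_iff.mp hlim.cauchySeq) (-t) (by linarith)
  have h1 := hN N le_rfl (N + 1) (Nat.le_succ N)
  have h2 := hf (hφ.injective.ne (Nat.succ_ne_self N).symm)
  have h3 := le_norm_apply_of_mem_eigenSpan hT (t := -t) (by linarith) (S := Iic t)
    (fun s hs => by rw [mem_Iic] at hs; rw [abs_of_neg (by linarith)]; linarith)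
    (f (φ N) - f (φ (N + 1))).2
  simp only [Function.comp, dist_eq_norm] at h1
  have h4 : ‖((f (φ N) - f (φ (N + 1)) : eigenSpan (T : H →ₗ[ℝ] H) (Iic t)) : H)‖ =
    ‖f (φ N) - f (φ (N + 1))‖ := rfl
  rw [h4] at h3
  simp only [Submodule.coe_sub, map_sub, ContinuousLinearMap.coe_coe] at h3
  nlinarith

end Spectral

/-! ### Eigenvalues of `M S` through the energy space -/

section Factor

variable {H L : Type*} [AddCommGroup H] [Module ℝ H] [AddCommGroup L] [Module ℝ L]

/-- `A B` and `B A` have the same eigenvectors for nonzero eigenvalues. -/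
theorem eigenSpan_comp_eq_map (A : H →ₗ[ℝ] L) (B : L →ₗ[ℝ] H) {S : Set ℝ} (hS : ∀ s ∈ S, s ≠ 0) :
    eigenSpan (A ∘ₗ B) S = (eigenSpan (B ∘ₗ A) S).map A := by
  refine le_antisymm (Submodule.span_le.mpr ?_) ?_
  · rintro f ⟨s, hs, hf⟩
    have hs0 := hS s hs
    refine ⟨s⁻¹ • B f, Submodule.smul_mem _ _ (Submodule.subset_span ⟨s, hs, ?_⟩), ?_⟩
    · have : B (A (B f)) = s • B f := by
        rw [← map_smul, ← hf]; rfl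
      simpa using this
    · rw [map_smul]
      have : A (B f) = s • f := hf
      rw [this, smul_smul, inv_mul_cancel₀ hs0, one_smul]
  · rw [Submodule.map_le_iff_le_comap]
    refine Submodule.span_le.mpr ?_
    rintro h ⟨s, hs, hh⟩
    refine Submodule.subset_span ⟨s, hs, ?_⟩
    have : B (A h) = s • h := hh
    simp [this]

end Factor

/-- `A` maps one span onto the other. It is injective there because the symmetric operator `B A` is,
all eigenvalues involved being nonzero. -/
theorem rank_eigenSpan_comp {H L : Type} [NormedAddCommGroup H] [InnerProductSpace ℝ H]
    [AddCommGroup L] [Module ℝ L] (A : H →ₗ[ℝ] L) (B : L →ₗ[ℝ] H)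
    (hBA : (B ∘ₗ A).IsSymmetric) {S : Set ℝ} (hS : ∀ s ∈ S, s ≠ 0) :
    Module.rank ℝ (eigenSpan (A ∘ₗ B) S) = Module.rank ℝ (eigenSpan (B ∘ₗ A) S) := by
  rw [eigenSpan_comp_eq_map A B hS]
  refine le_antisymm (rank_map_le _ _) ?_
  let p : eigenSpan (B ∘ₗ A) S →ₗ[ℝ] (eigenSpan (B ∘ₗ A) S).map A :=
    A.restrict fun x hx => Submodule.mem_map_of_mem hx
  refine LinearMap.rank_le_of_injective p ?_
  rw [← LinearMap.ker_eq_bot, LinearMap.ker_eq_bot']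
  intro w hw
  have h0 : A w = 0 := congrArg Subtype.val hw
  exact Subtype.ext (apply_ne_zero_of_mem_eigenSpan hBA hS w.2 (by simp [h0]))

/-! ### Symmetrization on the energy space -/

section Sandwich

variable {H L : Type} [NormedAddCommGroup H] [InnerProductSpace ℝ H] [CompleteSpace H]
  [NormedAddCommGroup L] [InnerProductSpace ℝ L] [CompleteSpace L]

/-- The operator `J† M J` on the energy space. -/
def sandwich (J : H →L[ℝ] L) (M : L →L[ℝ] L) : H →L[ℝ] H := J.adjoint ∘L M ∘L J

theorem inner_sandwich (J : H →L[ℝ] L) (M : L →L[ℝ] L) (v w : H) :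
    ⟪sandwich J M v, w⟫ = ⟪M (J v), J w⟫ := by
  simp [sandwich, ContinuousLinearMap.adjoint_inner_left]

theorem isCompactOperator_sandwich {J : H →L[ℝ] L} (hJ : IsCompactOperator J) (M : L →L[ℝ] L) :
    IsCompactOperator (sandwich J M) :=
  hJ.clm_comp (J.adjoint ∘L M)

theorem isSymmetric_sandwich (J : H →L[ℝ] L) {M : L →L[ℝ] L} (hM : (M : L →ₗ[ℝ] L).IsSymmetric) :
    (sandwich J M : H →ₗ[ℝ] H).IsSymmetric := fun v w => by
  have h1 := inner_sandwich J M v w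
  have h2 := inner_sandwich J M w v
  have h3 : ⟪M (J v), J w⟫ = ⟪J v, M (J w)⟫ := hM (J v) (J w)
  rw [ContinuousLinearMap.coe_coe, h1, h3, real_inner_comm, ← h2, real_inner_comm]

/-- This exchanges the nonsymmetric operator `M J J†` on L² for the symmetric `J† M J`, to which the
variational principle applies. -/
theorem rank_eigenSpan_sandwich (J : H →L[ℝ] L) {M : L →L[ℝ] L}
    (hM : (M : L →ₗ[ℝ] L).IsSymmetric) {S : Set ℝ} (hS : ∀ s ∈ S, s ≠ 0) :
    Module.rank ℝ (eigenSpan (M ∘L J ∘L J.adjoint : L →L[ℝ] L).toLinearMap S) =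
      Module.rank ℝ (eigenSpan (sandwich J M : H →ₗ[ℝ] H) S) :=
  rank_eigenSpan_comp (M ∘L J).toLinearMap J.adjoint.toLinearMap (isSymmetric_sandwich J hM) hS

/-- The form in which the variational principle is used: the trial space for `K₂` is the span of
eigenvectors of `K₁` with eigenvalue at least `t₁`. -/
theorem le_rank_eigenSpan_of_forall {K₁ K₂ : H →L[ℝ] H} (h₁ : (K₁ : H →ₗ[ℝ] H).IsSymmetric)
    (hc : IsCompactOperator K₂) (h₂ : (K₂ : H →ₗ[ℝ] H).IsSymmetric) {t₁ t₂ : ℝ} {j : ℕ}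
    (hj : (j : Cardinal) ≤ Module.rank ℝ (eigenSpan (K₁ : H →ₗ[ℝ] H) (Ici t₁)))
    (h : ∀ w, w ≠ 0 → t₁ * ‖w‖ ^ 2 ≤ ⟪K₁ w, w⟫ → t₂ * ‖w‖ ^ 2 < ⟪K₂ w, w⟫) :
    (j : Cardinal) ≤ Module.rank ℝ (eigenSpan (K₂ : H →ₗ[ℝ] H) (Ioi t₂)) :=
  le_rank_eigenSpan hc h₂ _ hj fun w hw hw0 =>
    h w hw0 (le_rayleigh_of_mem_eigenSpan h₁ (fun _ hs => hs) hw)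

theorem eigenSpan_mono {V : Type*} [AddCommGroup V] [Module ℝ V] (T : V →ₗ[ℝ] V) {S S' : Set ℝ}
    (h : S ⊆ S') : eigenSpan T S ≤ eigenSpan T S' :=
  Submodule.span_mono fun _ ⟨s, hs, hu⟩ => ⟨s, h hs, hu⟩

theorem eigenSpan_union {V : Type*} [AddCommGroup V] [Module ℝ V] (T : V →ₗ[ℝ] V) (S S' : Set ℝ) :
    eigenSpan T (S ∪ S') = eigenSpan T S ⊔ eigenSpan T S' := by
  rw [eigenSpan, eigenSpan, eigenSpan, ← Submodule.span_union]
  congr 1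
  ext u
  simp only [mem_ofPred_eq, mem_union]
  constructor
  · rintro ⟨s, h | h, hu⟩
    exacts [Or.inl ⟨s, h, hu⟩, Or.inr ⟨s, h, hu⟩]
  · rintro (⟨s, h, hu⟩ | ⟨s, h, hu⟩)
    exacts [⟨s, Or.inl h, hu⟩, ⟨s, Or.inr h, hu⟩]

/-- If `M` is negative up to a finite rank operator, then `M J J†` has infinitely many independent
eigenvectors with negative eigenvalue above any `t < 0`. -/
theorem not_finiteDimensional_eigenSpan_of_neg {J : H →L[ℝ] L} (hJ : IsCompactOperator J)
    (hH : ¬ FiniteDimensional ℝ (LinearMap.range J.toLinearMap)) {M Q : L →L[ℝ] L}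
    (hM : (M : L →ₗ[ℝ] L).IsSymmetric) (hQ : FiniteDimensional ℝ (LinearMap.range Q.toLinearMap))
    {a : ℝ} (ha : a < 0) (hMQ : ∀ f, Q f = 0 → M f = a • f) {t : ℝ} (ht : t < 0) :
    ¬ FiniteDimensional ℝ
      (eigenSpan (M ∘L J ∘L J.adjoint : L →L[ℝ] L).toLinearMap (Ioi t)) := by
  intro hfin
  have hc := isCompactOperator_sandwich hJ M
  have hs := isSymmetric_sandwich J hM
  have h1 : FiniteDimensional ℝ (eigenSpan (sandwich J M : H →ₗ[ℝ] H) (Ioo t 0)) := by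
    have : FiniteDimensional ℝ
        (eigenSpan (M ∘L J ∘L J.adjoint : L →L[ℝ] L).toLinearMap (Ioo t 0)) :=
      Submodule.finiteDimensional_of_le (eigenSpan_mono _ Ioo_subset_Ioi_self)
    refine Module.rank_lt_aleph0_iff.mp ?_
    rw [← rank_eigenSpan_sandwich J hM fun s hs => hs.2.ne]
    exact Module.rank_lt_aleph0_iff.mpr this
  have h2 := finiteDimensional_eigenSpan_Iic hc hs ht
  have h3 : FiniteDimensional ℝ (eigenSpan (sandwich J M : H →ₗ[ℝ] H) (Iio 0)) := by
    rw [← Iic_union_Ioo_eq_Iio ht, eigenSpan_union]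
    infer_instance
  -- The kernel of `p` consists of the `w` orthogonal to all negative eigenvectors and with `Q (J w)
  -- = 0`. It has finite codimension while `J` has infinite rank, so some such `w` has `J w ≠ 0`.
  -- The form at `w` is then both nonnegative and equal to `a ‖J w‖² < 0`.
  let p : H →ₗ[ℝ] eigenSpan (sandwich J M : H →ₗ[ℝ] H) (Iio 0) × LinearMap.range Q.toLinearMap :=
    ((eigenSpan (sandwich J M : H →ₗ[ℝ] H) (Iio 0)).orthogonalProjectionOnto.toLinearMap).prod
      (Q.toLinearMap.rangeRestrict ∘ₗ J.toLinearMap)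
  have hp : ¬ LinearMap.ker p ≤ LinearMap.ker J.toLinearMap := by
    intro hle
    have h4 : FiniteDimensional ℝ (H ⧸ LinearMap.ker p) :=
      p.quotKerEquivRange.symm.finiteDimensional
    have h5 : FiniteDimensional ℝ (H ⧸ LinearMap.ker J.toLinearMap) :=
      Module.Finite.of_surjective (Submodule.factor hle) (Submodule.factor_surjective hle)
    exact hH J.toLinearMap.quotKerEquivRange.finiteDimensional
  obtain ⟨w, hw, hw0⟩ := SetLike.not_le_iff_exists.mp hp
  have hw1 : w ∈ (eigenSpan (sandwich J M : H →ₗ[ℝ] H) (Iio 0))ᗮ := by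
    rw [← Submodule.ker_orthogonalProjectionOnto]
    exact congrArg Prod.fst hw
  have hw2 : Q (J w) = 0 := congrArg (fun x => (x.2 : L)) hw
  have h4 := rayleigh_nonneg_of_orthogonal hc hs hw1
  rw [inner_sandwich, hMQ _ hw2, real_inner_smul_left, real_inner_self_eq_norm_sq] at h4
  have h5 : 0 < ‖J w‖ := norm_pos_iff.mpr hw0
  nlinarith [pow_pos h5 2]

end Sandwich

/-! ### Zhikov's function for a compact symmetric operator -/

section Zhikov

variable {X : Type*} [NormedAddCommGroup X] [InnerProductSpace ℝ X]

/-- A resolvent identity: pairing each equation with the other solution and using symmetry makes the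
terms in `⟪x, y⟫` combine. It is the source of both the monotonicity and the blow-up at the poles.
-/
theorem zhikov_sub {T : X →L[ℝ] X} (hT : (T : X →ₗ[ℝ] X).IsSymmetric) {u x y : X} {l m : ℝ}
    (hx : x - l • T x = u) (hy : y - m • T y = u) :
    m * ⟪u, y⟫ - l * ⟪u, x⟫ = (m - l) * ⟪x, y⟫ := by
  have h1 : ⟪u, y⟫ = ⟪x, y⟫ - l * ⟪T x, y⟫ := by
    rw [← hx, inner_sub_left, real_inner_smul_left]
  have h2 : ⟪u, x⟫ = ⟪x, y⟫ - m * ⟪T x, y⟫ := by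
    have h3 : ⟪T x, y⟫ = ⟪x, T y⟫ := hT x y
    rw [← hy, inner_sub_left, real_inner_smul_left, h3, real_inner_comm x y,
      real_inner_comm x (T y)]
  rw [h1, h2]; ring

variable [CompleteSpace X]

/-- The resolvent-type inverse `(1 - l T)⁻¹`. -/
def resolv (T : X →L[ℝ] X) (l : ℝ) : X →L[ℝ] X := Ring.inverse (1 - l • T)

/-- Fredholm alternative: for `l ≠ 0`, either `l⁻¹` is an eigenvalue or it lies in the resolvent
set. -/
theorem isUnit_one_sub_smul {T : X →L[ℝ] X} (hc : IsCompactOperator T) {l : ℝ}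
    (h : ∀ e b, T e = b • e → e ≠ 0 → 1 - l * b ≠ 0) : IsUnit (1 - l • T) := by
  rcases eq_or_ne l 0 with rfl | hl
  · simp
  have h1 := hc.hasEigenvalue_or_mem_resolventSet (inv_ne_zero hl)
  rcases h1 with h1 | h1
  · obtain ⟨e, he⟩ := h1.exists_hasEigenvector
    exact absurd (by rw [mul_inv_cancel₀ hl, sub_self]) (h e l⁻¹ he.apply_eq_smul he.2)
  · rw [spectrum.mem_resolventSet_iff] at h1
    have h2 := h1.smul (Units.mk0 l hl)
    convert h2 using 1
    rw [Units.smul_mk0, smul_sub, Algebra.algebraMap_eq_smul_one, smul_smul, mul_inv_cancel₀ hl,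
      one_smul]

omit [CompleteSpace X] in
theorem resolv_spec {T : X →L[ℝ] X} {l : ℝ} (h : IsUnit (1 - l • T)) (v : X) :
    resolv T l v - l • T (resolv T l v) = v := by
  have := congrArg (fun S : X →L[ℝ] X => S v) (Ring.mul_inverse_cancel _ h)
  simpa [resolv] using this

omit [CompleteSpace X] in
theorem resolv_eigen {T : X →L[ℝ] X} {l : ℝ} (h : IsUnit (1 - l • T)) {e : X} {b : ℝ}
    (he : T e = b • e) (hb : e ≠ 0 → 1 - l * b ≠ 0) : resolv T l e = (1 - l * b)⁻¹ • e := by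
  rcases eq_or_ne e 0 with rfl | h0
  · simp
  have := congrArg (fun S : X →L[ℝ] X => S e) (Ring.inverse_mul_cancel _ h)
  have h2 : (1 - l • T) e = (1 - l * b) • e := by
    simp [he, sub_smul, mul_smul]
  simp only [mul_apply_eq_comp, h2, map_smul, one_apply_eq_self] at this
  rw [resolv, ← this, smul_smul, inv_mul_cancel₀ (hb h0), one_smul, this]

theorem continuousAt_resolv {T : X →L[ℝ] X} {l : ℝ} (h : IsUnit (1 - l • T)) :
    ContinuousAt (resolv T) l := by
  have h1 : ContinuousAt (fun l : ℝ => 1 - l • T) l := by fun_prop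
  obtain ⟨U, hU⟩ := h
  have h2 := NormedRing.inverse_continuousAt U
  rw [hU] at h2
  exact ContinuousAt.comp (f := fun l : ℝ => 1 - l • T) h2 h1

/-- On a finite sum of eigenvectors `v s` the product equals `∑ ‖v s‖² / ((1 - l s) (1 - m s))`.
Such sums are dense and the condition is closed. -/
theorem inner_resolv_nonneg {T : X →L[ℝ] X} (hc : IsCompactOperator T)
    (hT : (T : X →ₗ[ℝ] X).IsSymmetric) {l m : ℝ}
    (h : ∀ e b, T e = b • e → e ≠ 0 → 0 < (1 - l * b) * (1 - m * b)) (v : X) :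
    0 ≤ ⟪resolv T l v, resolv T m v⟫ := by
  have hl : ∀ e b, T e = b • e → e ≠ 0 → 1 - l * b ≠ 0 := fun e b he h0 =>
    left_ne_zero_of_mul (h e b he h0).ne'
  have hm : ∀ e b, T e = b • e → e ≠ 0 → 1 - m * b ≠ 0 := fun e b he h0 =>
    right_ne_zero_of_mul (h e b he h0).ne'
  have hcl : IsClosed {v : X | 0 ≤ ⟪resolv T l v, resolv T m v⟫} :=
    isClosed_le (by fun_prop) (by fun_prop)
  have hv : v ∈ closure (eigenSpan (T : X →ₗ[ℝ] X) univ : Set X) := by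
    have := (Submodule.topologicalClosure_eq_top_iff).mpr (dense_eigenSpan_univ hc hT)
    rw [← Submodule.topologicalClosure_coe, this]
    trivial
  refine closure_minimal ?_ hcl hv
  intro w hw
  obtain ⟨F, v, -, hv, rfl⟩ := exists_sum_of_mem_eigenSpan hw
  have e1 : ∀ (l : ℝ), (∀ e b, T e = b • e → e ≠ 0 → 1 - l * b ≠ 0) →
      resolv T l (∑ s ∈ F, v s) = ∑ s ∈ F, (1 - l * s)⁻¹ • v s := by
    intro l hl
    rw [map_sum]
    exact Finset.sum_congr rfl fun s _ =>
      resolv_eigen (isUnit_one_sub_smul hc hl) (hv s) (hl (v s) s (hv s))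
  rw [mem_ofPred_eq, e1 l hl, e1 m hm, inner_sum_eigen hT hv]
  refine Finset.sum_nonneg fun s _ => ?_
  rcases eq_or_ne (v s) 0 with h0 | h0
  · simp [h0]
  · have := h (v s) s (hv s) h0
    rw [← mul_inv]
    positivity

/-- The component of `v` along `e` contributes exactly the left side. The resolvents keep the
remainder orthogonal to `e`, so there are no cross terms and the remainder contributes a nonnegative
amount. -/
theorem le_inner_resolv {T : X →L[ℝ] X} (hc : IsCompactOperator T)
    (hT : (T : X →ₗ[ℝ] X).IsSymmetric) {l m : ℝ}
    (h : ∀ e b, T e = b • e → e ≠ 0 → 0 < (1 - l * b) * (1 - m * b)) (v : X) {e : X} {b : ℝ}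
    (he : T e = b • e) (he1 : ‖e‖ = 1) :
    ⟪v, e⟫ ^ 2 / ((1 - l * b) * (1 - m * b)) ≤ ⟪resolv T l v, resolv T m v⟫ := by
  have h0 : e ≠ 0 := by rintro rfl; simp at he1
  have hl : ∀ e b, T e = b • e → e ≠ 0 → 1 - l * b ≠ 0 := fun e b he h0 =>
    left_ne_zero_of_mul (h e b he h0).ne'
  have hm : ∀ e b, T e = b • e → e ≠ 0 → 1 - m * b ≠ 0 := fun e b he h0 =>
    right_ne_zero_of_mul (h e b he h0).ne'
  have key : ∀ (l : ℝ), (∀ e b, T e = b • e → e ≠ 0 → 1 - l * b ≠ 0) → ∀ w, ⟪e, w⟫ = 0 →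
      ⟪e, resolv T l w⟫ = 0 := by
    intro l hl w hw
    have h1 := resolv_spec (isUnit_one_sub_smul hc hl) w
    have h2 : ⟪e, T (resolv T l w)⟫ = b * ⟪e, resolv T l w⟫ := by
      have : ⟪T e, resolv T l w⟫ = ⟪e, T (resolv T l w)⟫ := hT _ _
      rw [← this, he, real_inner_smul_left]
    have h3 : (1 - l * b) * ⟪e, resolv T l w⟫ = 0 := by
      rw [← hw, ← h1, inner_sub_right, real_inner_smul_right, h1, h2]; ring
    exact (mul_eq_zero.mp h3).resolve_left (hl e b he h0)
  set c := ⟪v, e⟫ with hcdef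
  set w := v - c • e with hw
  have hwe : ⟪e, w⟫ = 0 := by
    rw [hw, inner_sub_right, real_inner_smul_right, real_inner_self_eq_norm_sq, he1,
      real_inner_comm, ← hcdef]; ring
  have hv : v = c • e + w := by rw [hw]; abel
  have hres : ∀ l : ℝ, (∀ e b, T e = b • e → e ≠ 0 → 1 - l * b ≠ 0) →
      resolv T l v = (c * (1 - l * b)⁻¹) • e + resolv T l w := by
    intro l hl
    conv_lhs => rw [hv]
    rw [map_add, map_smul, resolv_eigen (isUnit_one_sub_smul hc hl) he (hl e b he), smul_smul]
  have h4 := inner_resolv_nonneg hc hT h w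
  rw [hres l hl, hres m hm, inner_add_left, inner_add_right, inner_add_right, real_inner_smul_left,
    real_inner_smul_left, real_inner_smul_right, real_inner_smul_right,
    real_inner_self_eq_norm_sq, he1, key m hm w hwe, real_inner_comm e (resolv T l w),
    key l hl w hwe, div_eq_mul_inv, mul_inv]
  nlinarith

/-- Monotonicity of Zhikov's function between poles, and surjectivity onto `(0, ∞)`, when every
eigenvector of `T` sees `u`. -/
theorem exists_zhikov_of_cyclic {T : X →L[ℝ] X} (hc : IsCompactOperator T)
    (hT : (T : X →ₗ[ℝ] X).IsSymmetric) (u : X) {p q v : ℝ} (hp : 0 ≤ p) (hpq : p < q)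
    (hv : 0 < v)
    (h : ∀ e b, T e = b • e → e ≠ 0 →
      ∀ l ∈ Ioo p q, ∀ m ∈ Ioo p q, 0 < (1 - l * b) * (1 - m * b))
    (hq : ∃ e, T e = q⁻¹ • e ∧ ⟪u, e⟫ ≠ 0) (hp' : p = 0 ∨ ∃ e, T e = p⁻¹ • e ∧ ⟪u, e⟫ ≠ 0) :
    (∀ l ∈ Ioo p q, resolv T l u - l • T (resolv T l u) = u) ∧
    (∀ l ∈ Ioo p q, ∀ m ∈ Ioo p q, l ≤ m → v * (m - l) ≤
      (m * v + m * ⟪u, resolv T m u⟫) - (l * v + l * ⟪u, resolv T l u⟫)) ∧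
    ∀ θ > 0, ∃ l ∈ Ioo p q, l * v + l * ⟪u, resolv T l u⟫ = θ := by
  have hU : ∀ l ∈ Ioo p q, IsUnit (1 - l • T) := fun l hl =>
    isUnit_one_sub_smul hc fun e b he h0 => left_ne_zero_of_mul (h e b he h0 l hl l hl).ne'
  have hspec : ∀ l ∈ Ioo p q, resolv T l u - l • T (resolv T l u) = u := fun l hl =>
    resolv_spec (hU l hl) u
  set F : ℝ → ℝ := fun l => l * v + l * ⟪u, resolv T l u⟫ with hF
  have hsub : ∀ l ∈ Ioo p q, ∀ m ∈ Ioo p q,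
      F m - F l = (m - l) * (v + ⟪resolv T l u, resolv T m u⟫) := by
    intro l hl m hm
    have := zhikov_sub hT (hspec l hl) (hspec m hm)
    simp only [hF]
    linarith
  have hcont : ∀ l, IsUnit (1 - l • T) → ContinuousAt F l := by
    intro l hl
    have h1 : ContinuousAt (fun l => resolv T l u) l := (continuousAt_resolv hl).clm_apply
      continuousAt_const
    exact (continuousAt_id.mul continuousAt_const).add
      (continuousAt_id.mul (continuousAt_const.inner h1))
  -- Applied to an eigenvector at an endpoint of the interval, this bound makes the difference
  -- quotient of `F` blow up there: to `+∞` at `q`, and `F` falls to `-∞` at `p` when `p > 0`.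
  have hlow : ∀ (e : X) (b : ℝ), T e = b • e → ⟪u, e⟫ ≠ 0 → ∃ c > 0, ∀ l ∈ Ioo p q, ∀ m ∈ Ioo p q,
      c / ((1 - l * b) * (1 - m * b)) ≤ ⟪resolv T l u, resolv T m u⟫ := by
    intro e b he hue
    have h0 : e ≠ 0 := by rintro rfl; simp at hue
    have hn : 0 < ‖e‖ := norm_pos_iff.mpr h0
    refine ⟨⟪u, ‖e‖⁻¹ • e⟫ ^ 2, ?_, fun l hl m hm => ?_⟩
    · rw [real_inner_smul_right]
      have : ‖e‖⁻¹ * ⟪u, e⟫ ≠ 0 := mul_ne_zero (inv_ne_zero hn.ne') hue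
      positivity
    · refine le_inner_resolv hc hT (fun e b he h0 => h e b he h0 l hl m hm) u ?_ ?_
      · rw [map_smul, he, smul_comm]
      · rw [norm_smul, norm_inv, norm_norm, inv_mul_cancel₀ hn.ne']
  have hq0 : 0 < q := hp.trans_lt hpq
  set l₀ := (p + q) / 2 with hl₀
  have hl₀I : l₀ ∈ Ioo p q := ⟨by linarith, by linarith⟩
  refine ⟨hspec, ?_, ?_⟩
  · intro l hl m hm hlm
    have h1 := inner_resolv_nonneg hc hT (fun e b he h0 => h e b he h0 l hl m hm) u
    have h2 := hsub l hl m hm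
    have h3 : 0 ≤ (m - l) * ⟪resolv T l u, resolv T m u⟫ := mul_nonneg (sub_nonneg.mpr hlm) h1
    change v * (m - l) ≤ F m - F l
    rw [h2]
    linarith
  · intro θ hθ
    have hup : ∃ l ∈ Ioo p q, θ < F l := by
      obtain ⟨e, he, hue⟩ := hq
      obtain ⟨c, hc0, hce⟩ := hlow e _ he hue
      have hd : 0 < 1 - l₀ * q⁻¹ := by
        rw [sub_pos, ← div_eq_mul_inv, div_lt_one hq0]; exact hl₀I.2
      have t1 : Tendsto (fun l : ℝ => 1 - l * q⁻¹) (𝓝[<] q) (𝓝[>] 0) := by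
        refine tendsto_nhdsWithin_iff.mpr ⟨?_, ?_⟩
        · have : Tendsto (fun l : ℝ => 1 - l * q⁻¹) (𝓝 q) (𝓝 (1 - q * q⁻¹)) :=
            Continuous.tendsto (by fun_prop) q
          rw [mul_inv_cancel₀ hq0.ne', sub_self] at this
          exact this.mono_left nhdsWithin_le_nhds
        · filter_upwards [self_mem_nhdsWithin] with l hl
          rw [mem_Ioi, sub_pos, ← div_eq_mul_inv, div_lt_one hq0]; exact hl
      have t2 : Tendsto (fun l : ℝ => (l - l₀) * (c / (1 - l₀ * q⁻¹))) (𝓝[<] q)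
          (𝓝 ((q - l₀) * (c / (1 - l₀ * q⁻¹)))) :=
        (Continuous.tendsto (by fun_prop) q).mono_left nhdsWithin_le_nhds
      have t3 := t2.pos_mul_atTop (mul_pos (sub_pos.mpr hl₀I.2) (by positivity))
        (tendsto_inv_nhdsGT_zero.comp t1)
      have t4 := t3.eventually (eventually_gt_atTop (θ - F l₀))
      have t5 : ∀ᶠ l in 𝓝[<] q, l ∈ Ioo l₀ q := Ioo_mem_nhdsLT hl₀I.2
      obtain ⟨l, h4, h5⟩ := (t4.and t5).exists
      have hlI : l ∈ Ioo p q := ⟨hl₀I.1.trans h5.1, h5.2⟩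
      refine ⟨l, hlI, ?_⟩
      have h6 := hsub l₀ hl₀I l hlI
      have h7 := hce l₀ hl₀I l hlI
      have h8 : (l - l₀) * (c / (1 - l₀ * q⁻¹)) * (1 - l * q⁻¹)⁻¹ =
          (l - l₀) * (c / ((1 - l₀ * q⁻¹) * (1 - l * q⁻¹))) := by
        rw [div_eq_mul_inv, div_eq_mul_inv, mul_inv]; ring
      have h9 : (l - l₀) * (c / ((1 - l₀ * q⁻¹) * (1 - l * q⁻¹))) ≤
          (l - l₀) * (v + ⟪resolv T l₀ u, resolv T l u⟫) :=
        mul_le_mul_of_nonneg_left (by linarith) (sub_nonneg.mpr h5.1.le)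
      simp only [Function.comp] at h4
      linarith
    have hdown : ∃ l ∈ Ioo p q, F l < θ := by
      rcases hp.eq_or_lt with rfl | hp0
      -- At `p = 0` there is no pole: `F` is continuous with `F 0 = 0 < θ`.
      · have h1 : ContinuousAt F 0 := hcont 0 (by simp)
        have h2 : ∀ᶠ l in 𝓝 (0 : ℝ), F l < θ := by
          refine h1.eventually_lt continuousAt_const ?_
          simpa [hF] using hθ
        have h3 : ∀ᶠ l in 𝓝[>] (0 : ℝ), l ∈ Ioo 0 q := Ioo_mem_nhdsGT hq0
        obtain ⟨l, h4, h5⟩ := ((h2.filter_mono nhdsWithin_le_nhds).and h3).exists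
        exact ⟨l, h5, h4⟩
      · obtain ⟨e, he, hue⟩ := hp'.resolve_left hp0.ne'
        obtain ⟨c, hc0, hce⟩ := hlow e _ he hue
        have hd : 0 < l₀ * p⁻¹ - 1 := by
          rw [sub_pos, ← div_eq_mul_inv, one_lt_div hp0]; exact hl₀I.1
        have t1 : Tendsto (fun l : ℝ => l * p⁻¹ - 1) (𝓝[>] p) (𝓝[>] 0) := by
          refine tendsto_nhdsWithin_iff.mpr ⟨?_, ?_⟩
          · have : Tendsto (fun l : ℝ => l * p⁻¹ - 1) (𝓝 p) (𝓝 (p * p⁻¹ - 1)) :=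
              Continuous.tendsto (by fun_prop) p
            rw [mul_inv_cancel₀ hp0.ne', sub_self] at this
            exact this.mono_left nhdsWithin_le_nhds
          · filter_upwards [self_mem_nhdsWithin] with l hl
            rw [mem_Ioi, sub_pos, ← div_eq_mul_inv, one_lt_div hp0]; exact hl
        have t2 : Tendsto (fun l : ℝ => (l₀ - l) * (c / (l₀ * p⁻¹ - 1))) (𝓝[>] p)
            (𝓝 ((l₀ - p) * (c / (l₀ * p⁻¹ - 1)))) :=
          (Continuous.tendsto (by fun_prop) p).mono_left nhdsWithin_le_nhds
        have t3 := t2.pos_mul_atTop (mul_pos (sub_pos.mpr hl₀I.1) (by positivity))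
          (tendsto_inv_nhdsGT_zero.comp t1)
        have t4 := t3.eventually (eventually_gt_atTop (F l₀ - θ))
        have t5 : ∀ᶠ l in 𝓝[>] p, l ∈ Ioo p l₀ := Ioo_mem_nhdsGT hl₀I.1
        obtain ⟨l, h4, h5⟩ := (t4.and t5).exists
        have hlI : l ∈ Ioo p q := ⟨h5.1, h5.2.trans hl₀I.2⟩
        refine ⟨l, hlI, ?_⟩
        have h6 := hsub l hlI l₀ hl₀I
        have h7 := hce l hlI l₀ hl₀I
        have h8 : (l₀ - l) * (c / (l₀ * p⁻¹ - 1)) * (l * p⁻¹ - 1)⁻¹ =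
            (l₀ - l) * (c / ((1 - l * p⁻¹) * (1 - l₀ * p⁻¹))) := by
          have : (1 - l * p⁻¹) * (1 - l₀ * p⁻¹) = (l₀ * p⁻¹ - 1) * (l * p⁻¹ - 1) := by ring
          rw [this, div_eq_mul_inv, div_eq_mul_inv, mul_inv]; ring
        have h9 : (l₀ - l) * (c / ((1 - l * p⁻¹) * (1 - l₀ * p⁻¹))) ≤
            (l₀ - l) * (v + ⟪resolv T l u, resolv T l₀ u⟫) :=
          mul_le_mul_of_nonneg_left (by linarith) (sub_nonneg.mpr h5.2.le)
        simp only [Function.comp] at h4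
        linarith
    obtain ⟨l, hl, hl'⟩ := hdown
    obtain ⟨m, hm, hm'⟩ := hup
    have hcon : ContinuousOn F (Ioo p q) := fun l hl => (hcont l (hU l hl)).continuousWithinAt
    obtain ⟨z, hz, hz'⟩ := isPreconnected_Ioo.intermediate_value hl hm hcon ⟨hl'.le, hm'.le⟩
    exact ⟨z, hz, hz'⟩

/-- Monotonicity of Zhikov's function between consecutive poles, and surjectivity onto `(0, ∞)`. -/
theorem exists_zhikov {T : X →L[ℝ] X} (hc : IsCompactOperator T)
    (hT : (T : X →ₗ[ℝ] X).IsSymmetric) (u : X) {p q v : ℝ} (hp : 0 ≤ p) (hpq : p < q)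
    (hv : 0 < v)
    (h : ∀ e b, T e = b • e → ⟪u, e⟫ ≠ 0 →
      ∀ l ∈ Ioo p q, ∀ m ∈ Ioo p q, 0 < (1 - l * b) * (1 - m * b))
    (hq : ∃ e, T e = q⁻¹ • e ∧ ⟪u, e⟫ ≠ 0) (hp' : p = 0 ∨ ∃ e, T e = p⁻¹ • e ∧ ⟪u, e⟫ ≠ 0) :
    ∃ x : ℝ → X, (∀ l ∈ Ioo p q, x l - l • T (x l) = u) ∧
    (∀ l ∈ Ioo p q, ∀ m ∈ Ioo p q, l ≤ m → v * (m - l) ≤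
      (m * v + m * ⟪u, x m⟫) - (l * v + l * ⟪u, x l⟫)) ∧
    ∀ θ > 0, ∃ l ∈ Ioo p q, l * v + l * ⟪u, x l⟫ = θ := by
  -- Eigenvectors orthogonal to `u` may have `1 - l T` singular inside the interval. They span `N`,
  -- whose orthogonal complement is `T`-invariant and contains `u`. An eigenvector in `Nᗮ` not seen
  -- by `u` would lie in `N ∩ Nᗮ = 0`, so the previous theorem applies on `Nᗮ`.
  set N : Submodule ℝ X := Submodule.span ℝ {e | (∃ s : ℝ, T e = s • e) ∧ ⟪u, e⟫ = 0} with hN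
  have hsym : ∀ x y, ⟪T x, y⟫ = ⟪x, T y⟫ := hT
  have huN : u ∈ Nᗮ := by
    rw [Submodule.mem_orthogonal']
    intro e he
    induction he using Submodule.span_induction with
    | mem e he => exact he.2
    | zero => simp
    | add x y _ _ hx hy => rw [inner_add_right, hx, hy, add_zero]
    | smul c x _ hx => rw [real_inner_smul_right, hx, mul_zero]
  have hNinv : ∀ x ∈ N, T x ∈ N := by
    intro x hx
    induction hx using Submodule.span_induction with
    | mem e he =>
      obtain ⟨⟨s, hs⟩, he'⟩ := he
      rw [hs]
      exact N.smul_mem _ (Submodule.subset_span ⟨⟨s, hs⟩, he'⟩)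
    | zero => simp
    | add x y _ _ hx hy => rw [map_add]; exact N.add_mem hx hy
    | smul c x _ hx => rw [map_smul]; exact N.smul_mem _ hx
  have hinv : ∀ W : Submodule ℝ X, (∀ x ∈ W, T x ∈ W) → ∀ x ∈ Wᗮ, T x ∈ Wᗮ := by
    intro W hW x hx
    rw [Submodule.mem_orthogonal] at *
    intro y hy
    rw [← hsym]
    exact hx _ (hW y hy)
  have hXinv := hinv N hNinv
  let S : Nᗮ →L[ℝ] Nᗮ := T.restrict hXinv
  have hSc : IsCompactOperator S := hc.restrict' hXinv
  have hSs : (S : Nᗮ →ₗ[ℝ] Nᗮ).IsSymmetric := hT.restrict_invariant hXinv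
  have hScoe : ∀ x : Nᗮ, ((S x : Nᗮ) : X) = T x := fun x => rfl
  -- Both `Nᗮ` and `Nᗮᗮ` are invariant, so the projection of an eigenvector to `Nᗮ` satisfies the
  -- same eigenvalue equation, and its product with `u` is unchanged.
  have hproj : ∀ (e : X) (b : ℝ), T e = b • e → ⟪u, e⟫ ≠ 0 →
      ∃ e' : Nᗮ, S e' = b • e' ∧ ⟪(⟨u, huN⟩ : Nᗮ), e'⟫ ≠ 0 := by
    intro e b he hue
    obtain ⟨y, hy, z, hz, rfl⟩ := Nᗮ.exists_add_mem_mem_orthogonal e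
    have h1 : T y - b • y ∈ Nᗮ := Submodule.sub_mem _ (hXinv y hy) (Submodule.smul_mem _ _ hy)
    have h2 : T y - b • y ∈ Nᗮᗮ := by
      have : T y - b • y = -(T z - b • z) := by
        rw [map_add, smul_add] at he
        rw [neg_sub, sub_eq_sub_iff_add_eq_add, he, add_comm]
      rw [this]
      exact Submodule.neg_mem _ (Submodule.sub_mem _ (hinv _ hXinv z hz)
        (Submodule.smul_mem _ _ hz))
    have h3 : T y - b • y = 0 := by
      have := Submodule.inner_right_of_mem_orthogonal h1 h2
      simpa using this
    refine ⟨⟨y, hy⟩, Subtype.ext ?_, ?_⟩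
    · exact sub_eq_zero.mp h3
    · rw [inner_add_right, (Submodule.mem_orthogonal _ z).mp hz u huN, add_zero] at hue
      exact hue
  have hall : ∀ (e : Nᗮ) (b : ℝ), S e = b • e → e ≠ 0 →
      ∀ l ∈ Ioo p q, ∀ m ∈ Ioo p q, 0 < (1 - l * b) * (1 - m * b) := by
    intro e b he h0
    have he' : T (e : X) = b • (e : X) := by rw [← hScoe, he]; rfl
    refine h e b he' fun hue => h0 ?_
    have h1 : (e : X) ∈ N := Submodule.subset_span ⟨⟨b, he'⟩, hue⟩
    have h2 := (Submodule.mem_orthogonal _ _).mp e.2 _ h1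
    simpa using h2
  obtain ⟨h1, h2, h3⟩ := exists_zhikov_of_cyclic hSc hSs ⟨u, huN⟩ hp hpq hv hall
    (by obtain ⟨e, he, hue⟩ := hq; exact hproj e _ he hue)
    (by
      rcases hp' with h | ⟨e, he, hue⟩
      exacts [Or.inl h, Or.inr (hproj e _ he hue)])
  exact ⟨fun l => (resolv S l ⟨u, huN⟩ : Nᗮ), fun l hl => congrArg Subtype.val (h1 l hl), h2, h3⟩

end Zhikov

/-! ### Translations, cells and test functions -/

/-- The variance as a double integral of differences. It turns averages over cells into
translations. -/
theorem integral_integral_sq_sub {α : Type*} [MeasurableSpace α] {μ : Measure α}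
    [IsFiniteMeasure μ] {f : α → ℝ} (hf : Integrable f μ) (hf2 : Integrable (fun x => f x ^ 2) μ) :
    ∫ x, ∫ y, (f x - f y) ^ 2 ∂μ ∂μ =
      2 * (μ.real univ * ∫ x, f x ^ 2 ∂μ - (∫ x, f x ∂μ) ^ 2) := by
  have h1 : ∀ x, ∫ y, (f x - f y) ^ 2 ∂μ =
      f x ^ 2 * μ.real univ - 2 * f x * ∫ y, f y ∂μ + ∫ y, f y ^ 2 ∂μ := by
    intro x
    have : ∀ y, (f x - f y) ^ 2 = f x ^ 2 - 2 * f x * f y + f y ^ 2 := fun y => by ring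
    simp_rw [this]
    have i0 : Integrable (fun _ : α => f x ^ 2) μ := integrable_const _
    have i1 : Integrable (fun y => 2 * f x * f y) μ := hf.const_mul _
    have i2 : Integrable (fun y => f x ^ 2 - 2 * f x * f y) μ := i0.sub i1
    rw [integral_add i2 hf2, integral_sub i0 i1, integral_const, integral_const_mul, smul_eq_mul]
    ring
  simp_rw [h1]
  have i1 : Integrable (fun x => f x ^ 2 * μ.real univ) μ := hf2.mul_const _
  have i2 : Integrable (fun x => 2 * f x * ∫ y, f y ∂μ) μ := (hf.const_mul 2).mul_const _
  have i3 : Integrable (fun x => f x ^ 2 * μ.real univ - 2 * f x * ∫ y, f y ∂μ) μ := i1.sub i2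
  rw [integral_add i3 (integrable_const _), integral_sub i1 i2, integral_const,
    integral_mul_const, integral_mul_const, integral_const_mul, smul_eq_mul]
  ring

theorem sq_integral_le {α : Type*} [MeasurableSpace α] {μ : Measure α}
    [IsFiniteMeasure μ] {f : α → ℝ} (hf : Integrable f μ) (hf2 : Integrable (fun x => f x ^ 2) μ) :
    (∫ x, f x ∂μ) ^ 2 ≤ μ.real univ * ∫ x, f x ^ 2 ∂μ := by
  have h := integral_integral_sq_sub hf hf2
  have : 0 ≤ ∫ x, ∫ y, (f x - f y) ^ 2 ∂μ ∂μ :=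
    integral_nonneg fun x => integral_nonneg fun y => sq_nonneg _
  linarith

variable {d : ℕ}

section TestFunction

variable {φ : E d → ℝ}

theorem continuous_gradient (hφ : ContDiff ℝ (⊤ : ℕ∞) φ) : Continuous (gradient φ) :=
  (InnerProductSpace.toDual ℝ (E d)).symm.continuous.comp (hφ.continuous_fderiv (by simp))

/-- The fundamental theorem of calculus along the segment, then Cauchy–Schwarz in `t` and in space.
-/
theorem sq_sub_le_integral_gradient (hφ : ContDiff ℝ (⊤ : ℕ∞) φ) (x h : E d) :
    (φ (x + h) - φ x) ^ 2 ≤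
      ∫ t in Icc (0 : ℝ) 1, ‖h‖ ^ 2 * ‖gradient φ (x + t • h)‖ ^ 2 := by
  have hc : Continuous fun t : ℝ => ⟪gradient φ (x + t • h), h⟫ :=
    ((continuous_gradient hφ).comp (by fun_prop)).inner continuous_const
  have h1 : φ (x + h) - φ x = ∫ t in Icc (0 : ℝ) 1, ⟪gradient φ (x + t • h), h⟫ := by
    have hd : ∀ t : ℝ, HasDerivAt (fun t : ℝ => φ (x + t • h)) ⟪gradient φ (x + t • h), h⟫ t := by
      intro t
      have hg : HasFDerivAt φ (fderiv ℝ φ (x + t • h)) (x + t • h) :=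
        ((hφ.differentiable (by simp)) _).hasFDerivAt
      have hl : HasDerivAt (fun t : ℝ => x + t • h) h t := by
        simpa using ((hasDerivAt_id t).smul_const h).const_add x
      have := hg.comp_hasDerivAt t hl
      rwa [← inner_gradient_left] at this
    have := intervalIntegral.integral_eq_sub_of_hasDerivAt (a := 0) (b := 1) (fun t _ => hd t)
      (hc.intervalIntegrable _ _)
    rw [integral_Icc_eq_integral_Ioc, ← intervalIntegral.integral_of_le zero_le_one, this]
    simp
  have h2 := sq_integral_le (μ := volume.restrict (Icc (0 : ℝ) 1))
    (f := fun t => ⟪gradient φ (x + t • h), h⟫)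
    (hc.continuousOn.integrableOn_compact isCompact_Icc)
    ((hc.pow 2).continuousOn.integrableOn_compact isCompact_Icc)
  rw [← h1] at h2
  simp only [measureReal_restrict_apply_univ, Real.volume_real_Icc, sub_zero, zero_le_one,
    sup_of_le_left, one_mul] at h2
  refine h2.trans (setIntegral_mono_on
    ((hc.pow 2).continuousOn.integrableOn_compact isCompact_Icc)
    (Continuous.integrableOn_Icc ?_) measurableSet_Icc fun t _ => ?_)
  · exact continuous_const.mul (((continuous_gradient hφ).comp (by fun_prop)).norm.pow 2)
  · have := abs_real_inner_le_norm (gradient φ (x + t • h)) h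
    rw [← mul_pow, ← sq_abs, mul_comm ‖h‖]
    exact pow_le_pow_left₀ (abs_nonneg _) this 2

/-- The translation estimate. -/
theorem lintegral_sq_translate_le (hφ : ContDiff ℝ (⊤ : ℕ∞) φ) (h : E d) :
    ∫⁻ x, ENNReal.ofReal ((φ (x + h) - φ x) ^ 2) ≤
      ENNReal.ofReal (‖h‖ ^ 2) * ∫⁻ x, ENNReal.ofReal (‖gradient φ x‖ ^ 2) := by
  have hc : Continuous fun p : E d × ℝ => ‖gradient φ (p.1 + p.2 • h)‖ ^ 2 :=
    ((continuous_gradient hφ).comp (by fun_prop)).norm.pow 2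
  calc ∫⁻ x, ENNReal.ofReal ((φ (x + h) - φ x) ^ 2)
      ≤ ∫⁻ x, ∫⁻ t in Icc (0 : ℝ) 1,
          ENNReal.ofReal (‖h‖ ^ 2) * ENNReal.ofReal (‖gradient φ (x + t • h)‖ ^ 2) := by
        refine lintegral_mono fun x => ?_
        refine (ENNReal.ofReal_le_ofReal (sq_sub_le_integral_gradient hφ x h)).trans ?_
        rw [ofReal_integral_eq_lintegral_ofReal]
        · simp_rw [ENNReal.ofReal_mul (sq_nonneg ‖h‖)]
          exact le_rfl
        · refine Continuous.integrableOn_Icc (continuous_const.mul ?_)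
          exact ((continuous_gradient hφ).comp
            (by fun_prop : Continuous fun t : ℝ => x + t • h)).norm.pow 2
        · exact ae_of_all _ fun t => by positivity
    _ = ∫⁻ t in Icc (0 : ℝ) 1, ∫⁻ x,
          ENNReal.ofReal (‖h‖ ^ 2) * ENNReal.ofReal (‖gradient φ (x + t • h)‖ ^ 2) := by
        rw [lintegral_lintegral_swap]
        have hm : Measurable fun p : E d × ℝ =>
            ENNReal.ofReal (‖gradient φ (p.1 + p.2 • h)‖ ^ 2) := hc.measurable.ennreal_ofReal
        exact (hm.const_mul (ENNReal.ofReal (‖h‖ ^ 2))).aemeasurable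
    _ = ∫⁻ _ in Icc (0 : ℝ) 1,
          ENNReal.ofReal (‖h‖ ^ 2) * ∫⁻ x, ENNReal.ofReal (‖gradient φ x‖ ^ 2) := by
        refine lintegral_congr fun t => ?_
        rw [lintegral_const_mul' _ _ ENNReal.ofReal_ne_top,
          lintegral_add_right_eq_self (fun x => ENNReal.ofReal (‖gradient φ x‖ ^ 2)) (t • h)]
    _ = _ := by simp

end TestFunction

/-! ### Cells -/

theorem mem_cell_iff {ε : ℝ} (hε : 0 < ε) {n : Fin d → ℤ} {x : E d} :
    x ∈ cell ε n ↔ n = fun k => ⌊x k / ε⌋ := by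
  simp only [cell, mem_ofPred_eq, funext_iff]
  refine forall_congr' fun k => ?_
  rw [eq_comm, Int.floor_eq_iff, le_div_iff₀ hε, div_lt_iff₀ hε, mul_comm ε, mul_comm ε]

theorem cell_eq_preimage (ε : ℝ) (n : Fin d → ℤ) :
    cell ε n = (MeasurableEquiv.toLp 2 (Fin d → ℝ)).symm ⁻¹'
      (Set.pi univ fun k => Ico (ε * n k) (ε * (n k + 1))) := by
  ext x
  simp [cell]

theorem measurableSet_cell (ε : ℝ) (n : Fin d → ℤ) : MeasurableSet (cell ε n) := by
  rw [cell_eq_preimage]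
  exact (MeasurableSet.univ_pi fun k => measurableSet_Ico).preimage (MeasurableEquiv.measurable _)

theorem volume_cell {ε : ℝ} (hε : 0 < ε) (n : Fin d → ℤ) :
    volume (cell ε n) = ENNReal.ofReal (ε ^ d) := by
  rw [cell_eq_preimage,
    (EuclideanSpace.volume_preserving_symm_measurableEquiv_toLp (Fin d)).measure_preimage_equiv,
    Real.volume_pi_Ico]
  have : ∀ k, ε * ((n k : ℝ) + 1) - ε * n k = ε := fun k => by ring
  simp [this, ENNReal.ofReal_pow hε.le]

theorem volume_real_cell {ε : ℝ} (hε : 0 < ε) (n : Fin d → ℤ) :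
    volume.real (cell ε n) = ε ^ d := by
  rw [Measure.real, volume_cell hε, ENNReal.toReal_ofReal (by positivity)]

theorem volume_cell_ne_top {ε : ℝ} (hε : 0 < ε) (n : Fin d → ℤ) : volume (cell ε n) ≠ ∞ := by
  rw [volume_cell hε]; exact ENNReal.ofReal_ne_top

theorem disjoint_cell {ε : ℝ} (hε : 0 < ε) {m n : Fin d → ℤ} (h : m ≠ n) :
    Disjoint (cell ε m) (cell ε n) := by
  rw [Set.disjoint_left]
  intro x hm hn
  exact h (((mem_cell_iff hε).mp hm).trans ((mem_cell_iff hε).mp hn).symm)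

theorem norm_sub_le_of_mem_cell {ε : ℝ} (hε : 0 < ε) {n : Fin d → ℤ} {x y : E d}
    (hx : x ∈ cell ε n) (hy : y ∈ cell ε n) : ‖x - y‖ ≤ √d * ε := by
  rw [EuclideanSpace.norm_eq]
  have : ∑ i, ‖(x - y) i‖ ^ 2 ≤ d * ε ^ 2 := by
    calc ∑ i, ‖(x - y) i‖ ^ 2 ≤ ∑ _i : Fin d, ε ^ 2 := by
          refine Finset.sum_le_sum fun i _ => ?_
          have h1 := hx i
          have h2 := hy i
          refine pow_le_pow_left₀ (norm_nonneg _) ?_ 2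
          rw [PiLp.sub_apply, Real.norm_eq_abs, abs_le]
          constructor <;> linarith
      _ = d * ε ^ 2 := by simp
  calc √(∑ i, ‖(x - y) i‖ ^ 2) ≤ √(d * ε ^ 2) := Real.sqrt_le_sqrt this
    _ = √d * ε := by rw [Real.sqrt_mul (Nat.cast_nonneg d), Real.sqrt_sq hε.le]

/-- The constant in the Poincaré inequality on cells. -/
def cellConst (d : ℕ) : ℝ := √d ^ d * √d ^ 2 * volume.real (Metric.closedBall (0 : E d) 1) / 2

theorem cellConst_nonneg (d : ℕ) : 0 ≤ cellConst d := by unfold cellConst; positivity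

theorem exists_cover_cell {U : Set (E d)} (hU : Bornology.IsBounded U) {ε : ℝ} (hε : 0 < ε) :
    ∃ F : Finset (Fin d → ℤ), U ⊆ ⋃ n ∈ F, cell ε n := by
  obtain ⟨R, hR⟩ := hU.exists_norm_le
  refine ⟨Fintype.piFinset fun _ => Finset.Icc ⌊-R / ε⌋ ⌊R / ε⌋, fun x hx => ?_⟩
  simp only [mem_iUnion, Fintype.mem_piFinset, Finset.mem_Icc]
  refine ⟨fun k => ⌊x k / ε⌋, fun k => ?_, (mem_cell_iff hε).mpr rfl⟩
  have h1 : |x k| ≤ R := (PiLp.norm_apply_le x k).trans (hR x hx)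
  rw [abs_le] at h1
  exact ⟨Int.floor_le_floor (by gcongr; exact h1.1), Int.floor_le_floor (by gcongr; exact h1.2)⟩

theorem hasCompactSupport_gradient {φ : E d → ℝ} (hs : HasCompactSupport φ) :
    HasCompactSupport (gradient φ) :=
  (hs.fderiv (𝕜 := ℝ)).comp_left (g := (InnerProductSpace.toDual ℝ (E d)).symm) (map_zero _)

theorem integrable_sq_testFunction {φ : E d → ℝ} (hφ : Continuous φ)
    (hs : HasCompactSupport φ) : Integrable (fun x => φ x ^ 2) := by
  have h1 : Continuous fun x => φ x ^ 2 := by fun_prop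
  exact h1.integrable_of_hasCompactSupport (hs.mono fun x hx => by simpa using hx)

theorem integrable_sq_gradient {φ : E d → ℝ} (hφ : ContDiff ℝ (⊤ : ℕ∞) φ)
    (hs : HasCompactSupport φ) : Integrable (fun x => ‖gradient φ x‖ ^ 2) := by
  have h0 := continuous_gradient hφ
  have h1 : Continuous fun x => ‖gradient φ x‖ ^ 2 := by fun_prop
  exact h1.integrable_of_hasCompactSupport
    ((hasCompactSupport_gradient hs).mono fun x hx => by simpa using hx)

/-- Two points of one cell differ by a vector `h` with `‖h‖ ≤ √d ε`, the diameter. Substituting `y =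
x + h` and enlarging the range of `h` to the whole ball makes it independent of `x`. -/
theorem cell_variance_le {φ : E d → ℝ} (hφ : Continuous φ)
    (hs : HasCompactSupport φ) {ε : ℝ} (hε : 0 < ε) (n : Fin d → ℤ) :
    ENNReal.ofReal ((∫ x in cell ε n, φ x ^ 2) - (ε ^ d)⁻¹ * (∫ x in cell ε n, φ x) ^ 2) ≤
      ENNReal.ofReal ((2 * ε ^ d)⁻¹) * ∫⁻ x in cell ε n, ∫⁻ h in Metric.closedBall (0 : E d) (√d * ε),
        ENNReal.ofReal ((φ (x + h) - φ x) ^ 2) := by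
  have hi : Integrable φ := hφ.integrable_of_hasCompactSupport hs
  have hi2 := integrable_sq_testFunction hφ hs
  have hfin : IsFiniteMeasure (volume.restrict (cell ε n)) :=
    ⟨by rw [Measure.restrict_apply_univ]; exact (volume_cell_ne_top hε n).lt_top⟩
  have h1 := integral_integral_sq_sub (μ := volume.restrict (cell ε n)) hi.restrict hi2.restrict
  rw [measureReal_restrict_apply_univ, volume_real_cell hε] at h1
  have hεd : 0 < ε ^ d := by positivity
  have h2 : (∫ x in cell ε n, φ x ^ 2) - (ε ^ d)⁻¹ * (∫ x in cell ε n, φ x) ^ 2 =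
      (2 * ε ^ d)⁻¹ * ∫ x in cell ε n, ∫ y in cell ε n, (φ x - φ y) ^ 2 := by
    rw [h1]; field_simp
  rw [h2, ENNReal.ofReal_mul (by positivity)]
  gcongr
  obtain ⟨M, hM⟩ := hφ.bounded_above_of_compact_support hs
  have hb : ∀ x y, (φ x - φ y) ^ 2 ≤ (2 * M) ^ 2 := by
    intro x y
    have h3 := hM x
    have h4 := hM y
    rw [Real.norm_eq_abs, abs_le] at h3 h4
    refine sq_le_sq' ?_ ?_ <;> linarith
  have hyi : ∀ x, Integrable (fun y => (φ x - φ y) ^ 2) (volume.restrict (cell ε n)) := by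
    intro x
    refine Integrable.of_bound (C := (2 * M) ^ 2) (by fun_prop) (ae_of_all _ fun y => ?_)
    rw [Real.norm_of_nonneg (sq_nonneg _)]; exact hb x y
  rw [ofReal_integral_eq_lintegral_ofReal]
  · refine setLIntegral_mono' (measurableSet_cell ε n) fun x hx => ?_
    rw [ofReal_integral_eq_lintegral_ofReal (hyi x) (ae_of_all _ fun y => sq_nonneg _),
      ← lintegral_indicator (measurableSet_cell ε n),
      ← lintegral_indicator Metric.isClosed_closedBall.measurableSet]
    rw [← lintegral_add_left_eq_self _ x]
    refine lintegral_mono fun h => ?_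
    by_cases hh : x + h ∈ cell ε n
    · have : h ∈ Metric.closedBall (0 : E d) (√d * ε) := by
        rw [mem_closedBall_zero_iff]
        have := norm_sub_le_of_mem_cell hε hh hx
        simpa using this
      rw [indicator_of_mem hh, indicator_of_mem this]
      refine ENNReal.ofReal_le_ofReal (le_of_eq (by ring))
    · rw [indicator_of_notMem hh]; exact zero_le
  · refine Integrable.of_bound (C := (2 * M) ^ 2 * ε ^ d) ?_ (ae_of_all _ fun x => ?_)
    · have hcp : StronglyMeasurable (fun p : E d × E d => (φ p.1 - φ p.2) ^ 2) :=
        (by fun_prop : Continuous fun p : E d × E d => (φ p.1 - φ p.2) ^ 2).stronglyMeasurable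
      exact hcp.integral_prod_right.aestronglyMeasurable
    · refine (norm_integral_le_of_norm_le_const (C := (2 * M) ^ 2)
        (ae_of_all _ fun y => ?_)).trans (le_of_eq ?_)
      · rw [Real.norm_of_nonneg (sq_nonneg _)]; exact hb x y
      · rw [measureReal_restrict_apply_univ, volume_real_cell hε]
  · exact ae_of_all _ fun x => integral_nonneg fun y => sq_nonneg _

/-- The disjoint cells add up to an integral over the whole space, where the translation estimate
applies for each `h`. The gradient is therefore needed globally only, and cells crossing the
boundary of the support need no special care. -/
theorem sum_cell_poincare_testFunction {φ : E d → ℝ} (hφ : ContDiff ℝ (⊤ : ℕ∞) φ)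
    (hs : HasCompactSupport φ) {ε : ℝ} (hε : 0 < ε) (F : Finset (Fin d → ℤ)) :
    ∑ n ∈ F, ((∫ x in cell ε n, φ x ^ 2) - (ε ^ d)⁻¹ * (∫ x in cell ε n, φ x) ^ 2) ≤
      cellConst d * ε ^ 2 * ∫ x, ‖gradient φ x‖ ^ 2 := by
  have hg2 := integrable_sq_gradient hφ hs
  set R := √d * ε with hR
  have hR0 : 0 ≤ R := by positivity
  set B := Metric.closedBall (0 : E d) R with hB
  have hcell := cell_variance_le hφ.continuous hs hε
  have hdisj : Set.PairwiseDisjoint (↑F) (cell ε (d := d)) := fun m _ n _ hmn => disjoint_cell hε hmn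
  have hsum : ENNReal.ofReal
      (∑ n ∈ F, ((∫ x in cell ε n, φ x ^ 2) - (ε ^ d)⁻¹ * (∫ x in cell ε n, φ x) ^ 2)) ≤
      ENNReal.ofReal (cellConst d * ε ^ 2 * ∫ x, ‖gradient φ x‖ ^ 2) := by
    calc _ ≤ ∑ n ∈ F, ENNReal.ofReal
          ((∫ x in cell ε n, φ x ^ 2) - (ε ^ d)⁻¹ * (∫ x in cell ε n, φ x) ^ 2) :=
          Finset.le_sum_of_subadditive _ ENNReal.ofReal_zero.le
            (fun _ _ => ENNReal.ofReal_add_le) _ _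
      _ ≤ ∑ n ∈ F, ENNReal.ofReal ((2 * ε ^ d)⁻¹) * ∫⁻ x in cell ε n, ∫⁻ h in B,
          ENNReal.ofReal ((φ (x + h) - φ x) ^ 2) := Finset.sum_le_sum fun n _ => hcell n
      _ = ENNReal.ofReal ((2 * ε ^ d)⁻¹) * ∫⁻ x in ⋃ n ∈ F, cell ε n, ∫⁻ h in B,
          ENNReal.ofReal ((φ (x + h) - φ x) ^ 2) := by
          rw [← Finset.mul_sum, lintegral_biUnion_finset hdisj
            (fun n _ => measurableSet_cell ε n)]
      _ ≤ ENNReal.ofReal ((2 * ε ^ d)⁻¹) * ∫⁻ x, ∫⁻ h in B,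
          ENNReal.ofReal ((φ (x + h) - φ x) ^ 2) := by
          gcongr; exact Measure.restrict_le_self
      _ = ENNReal.ofReal ((2 * ε ^ d)⁻¹) * ∫⁻ h in B, ∫⁻ x,
          ENNReal.ofReal ((φ (x + h) - φ x) ^ 2) := by
          rw [lintegral_lintegral_swap]
          have hφc := hφ.continuous
          have hc : Continuous fun p : E d × E d => (φ (p.1 + p.2) - φ p.1) ^ 2 := by fun_prop
          exact hc.measurable.ennreal_ofReal.aemeasurable
      _ ≤ ENNReal.ofReal ((2 * ε ^ d)⁻¹) * ∫⁻ _ in B,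
          ENNReal.ofReal (R ^ 2) * ∫⁻ x, ENNReal.ofReal (‖gradient φ x‖ ^ 2) := by
          refine mul_le_mul' le_rfl ?_
          refine setLIntegral_mono' measurableSet_closedBall fun h hh => ?_
          refine (lintegral_sq_translate_le hφ h).trans ?_
          gcongr
          simpa [hB] using hh
      -- The ball has volume `(√d ε)^d` times that of the unit ball. Multiplied by `R² = (√d ε)²`
      -- and by `1 / (2 ε^d)`, this is `cellConst d * ε ^ 2`.
      _ = ENNReal.ofReal (cellConst d * ε ^ 2 * ∫ x, ‖gradient φ x‖ ^ 2) := by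
          rw [setLIntegral_const, ← ofReal_integral_eq_lintegral_ofReal hg2
            (ae_of_all _ fun x => by positivity), hB, Measure.addHaar_closedBall' _ _ hR0,
            finrank_euclideanSpace_fin, ← ofReal_measureReal (μ := volume)
            (s := Metric.closedBall (0 : E d) 1) (measure_closedBall_lt_top.ne),
            ← ENNReal.ofReal_mul (by positivity), ← ENNReal.ofReal_mul (by positivity),
            ← ENNReal.ofReal_mul (by positivity), ← ENNReal.ofReal_mul (by positivity)]
          congr 1
          rw [cellConst, hR]
          field_simp
          rw [mul_pow]
          ring
  exact (ENNReal.ofReal_le_ofReal_iff (mul_nonneg (mul_nonneg (cellConst_nonneg d) (sq_nonneg ε))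
    (integral_nonneg fun x => by positivity))).mp hsum

/-- Friedrichs' inequality for test functions, on a set disjoint from its translate by `h`. -/
theorem friedrichs_testFunction {φ : E d → ℝ} (hφ : ContDiff ℝ (⊤ : ℕ∞) φ)
    (hs : HasCompactSupport φ) {U : Set (E d)} (hU : tsupport φ ⊆ U) {h : E d}
    (hh : ∀ x ∈ U, x + h ∉ U) :
    ∫ x, φ x ^ 2 ≤ ‖h‖ ^ 2 * ∫ x, ‖gradient φ x‖ ^ 2 := by
  have hi2 := integrable_sq_testFunction hφ.continuous hs
  have hg2 := integrable_sq_gradient hφ hs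
  have hz : ∀ x, x ∉ U → φ x = 0 := fun x hx =>
    image_eq_zero_of_notMem_tsupport fun h => hx (hU h)
  rw [← ENNReal.ofReal_le_ofReal_iff (mul_nonneg (sq_nonneg _)
    (integral_nonneg fun x => by positivity)), ENNReal.ofReal_mul (sq_nonneg _),
    ofReal_integral_eq_lintegral_ofReal hi2 (ae_of_all _ fun x => sq_nonneg _),
    ofReal_integral_eq_lintegral_ofReal hg2 (ae_of_all _ fun x => by positivity)]
  refine le_trans (lintegral_mono fun x => ENNReal.ofReal_le_ofReal ?_)
    (lintegral_sq_translate_le hφ h)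
  by_cases hx : x ∈ U
  · rw [hz _ (hh x hx)]; simp
  · rw [hz x hx]; simpa using sq_nonneg _

/-! ### Energy spaces -/

/-- A copy of a vector space, to be equipped with the inner product given by a coercive form. -/
def EnergyCopy (V : Type) : Type := V

instance (V : Type) [AddCommGroup V] : AddCommGroup (EnergyCopy V) := inferInstanceAs (AddCommGroup V)

instance (V : Type) [AddCommGroup V] [Module ℝ V] : Module ℝ (EnergyCopy V) :=
  inferInstanceAs (Module ℝ V)

/-- A coercive symmetric bounded form turns a Banach space into a Hilbert space. -/
theorem exists_hilbert_of_coercive {V : Type} [NormedAddCommGroup V] [NormedSpace ℝ V]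
    [CompleteSpace V] (a : V →L[ℝ] V →L[ℝ] ℝ) (hsymm : ∀ u v, a u v = a v u) {c : ℝ} (hc : 0 < c)
    (hcoer : ∀ u, c * ‖u‖ ^ 2 ≤ a u u) :
    ∃ (H : Type) (_ : NormedAddCommGroup H) (_ : InnerProductSpace ℝ H) (_ : CompleteSpace H)
      (Φ : H ≃L[ℝ] V), ∀ u v : H, ⟪u, v⟫ = a (Φ u) (Φ v) := by
  let Ψ : EnergyCopy V ≃ₗ[ℝ] V := LinearEquiv.refl ℝ V
  let core : InnerProductSpace.Core ℝ (EnergyCopy V) :=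
    { inner := fun u v => a (Ψ u) (Ψ v)
      conj_inner_symm := fun u v => by simpa using hsymm (Ψ v) (Ψ u)
      re_inner_nonneg := fun u => by
        have := hcoer (Ψ u)
        simp only [RCLike.re_to_real]
        exact le_trans (by positivity) this
      add_left := fun u v w => by simp
      smul_left := fun u v r => by simp
      definite := fun u hu => by
        have h1 := hcoer (Ψ u)
        have h2 : a (Ψ u) (Ψ u) = 0 := hu
        have h3 : ‖Ψ u‖ ^ 2 ≤ 0 := by
          by_contra! h
          have := mul_pos hc h
          linarith
        have h4 : ‖Ψ u‖ = 0 := by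
          have := le_antisymm h3 (sq_nonneg _)
          simpa using this
        have h5 : Ψ u = 0 := norm_eq_zero.mp h4
        exact (LinearEquiv.map_eq_zero_iff Ψ).mp h5 }
  let i1 : NormedAddCommGroup (EnergyCopy V) := core.toNormedAddCommGroup
  let i2 : InnerProductSpace ℝ (EnergyCopy V) := InnerProductSpace.ofCore core.toCore
  have hinner : ∀ u v : EnergyCopy V, ⟪u, v⟫ = a (Ψ u) (Ψ v) := fun u v => rfl
  have hnorm : ∀ u : EnergyCopy V, ‖u‖ ^ 2 = a (Ψ u) (Ψ u) := fun u => by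
    rw [← real_inner_self_eq_norm_sq, hinner]
  have hb1 : ∀ u : EnergyCopy V, ‖Ψ u‖ ≤ (√c)⁻¹ * ‖u‖ := by
    intro u
    rw [← div_eq_inv_mul, le_div_iff₀ (Real.sqrt_pos.mpr hc)]
    refine le_of_sq_le_sq ?_ (norm_nonneg _)
    rw [mul_pow, Real.sq_sqrt hc.le, hnorm, mul_comm]
    exact hcoer _
  have hb2 : ∀ u : V, ‖Ψ.symm u‖ ≤ √‖a‖ * ‖u‖ := by
    intro u
    refine le_of_sq_le_sq ?_ (by positivity)
    rw [mul_pow, Real.sq_sqrt (norm_nonneg a), hnorm, LinearEquiv.apply_symm_apply]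
    calc a u u ≤ ‖a u u‖ := le_abs_self _
      _ ≤ ‖a‖ * ‖u‖ * ‖u‖ := a.le_opNorm₂ u u
      _ = ‖a‖ * ‖u‖ ^ 2 := by ring
  let Φ : EnergyCopy V ≃L[ℝ] V := Ψ.toContinuousLinearEquivOfBounds _ _ hb1 hb2
  have i3 : CompleteSpace (EnergyCopy V) :=
    (completeSpace_congr (e := Φ.toEquiv) Φ.isUniformEmbedding).mpr inferInstance
  exact ⟨EnergyCopy V, i1, i2, i3, Φ, hinner⟩

/-- A bounded measurable symmetric coefficient field with ellipticity constant `c`. -/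
structure IsElliptic (c M : ℝ) (a : E d → Matrix (Fin d) (Fin d) ℝ) : Prop where
  measurable : ∀ i k, Measurable fun x => a x i k
  bounded : ∀ x i k, |a x i k| ≤ M
  symmetric : ∀ x i k, a x i k = a x k i
  lower : ∀ x (ξ : E d), c * ‖ξ‖ ^ 2 ≤ ∑ i, ∑ k, a x i k * ξ i * ξ k

/-! ### Elliptic matrix fields acting on L² vector fields -/

section MatMul

variable {c M : ℝ} {a : E d → Matrix (Fin d) (Fin d) ℝ}

/-- The pointwise product of a matrix field and a vector field. -/
def matVec (a : E d → Matrix (Fin d) (Fin d) ℝ) (f : E d → E d) (x : E d) : E d :=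
  WithLp.toLp 2 fun i => ∑ k, a x i k * f x k

theorem norm_matVec_le (ha : IsElliptic c M a) (f : E d → E d) (x : E d) :
    ‖matVec a f x‖ ≤ √d * (d * |M|) * ‖f x‖ := by
  have h1 : ∀ i, ‖matVec a f x i‖ ≤ d * |M| * ‖f x‖ := by
    intro i
    calc ‖matVec a f x i‖ = ‖∑ k, a x i k * f x k‖ := rfl
      _ ≤ ∑ k, ‖a x i k * f x k‖ := norm_sum_le _ _
      _ ≤ ∑ _k : Fin d, |M| * ‖f x‖ := by
          refine Finset.sum_le_sum fun k _ => ?_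
          rw [norm_mul]
          exact mul_le_mul ((ha.bounded x i k).trans (le_abs_self M)) (PiLp.norm_apply_le _ k)
            (norm_nonneg _) (abs_nonneg _)
      _ = d * |M| * ‖f x‖ := by simp [mul_assoc]
  rw [EuclideanSpace.norm_eq]
  calc √(∑ i, ‖matVec a f x i‖ ^ 2) ≤ √(∑ _i : Fin d, (d * |M| * ‖f x‖) ^ 2) := by
        refine Real.sqrt_le_sqrt (Finset.sum_le_sum fun i _ => ?_)
        exact pow_le_pow_left₀ (norm_nonneg _) (h1 i) 2
    _ = √(d * (d * |M| * ‖f x‖) ^ 2) := by simp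
    _ = √d * (d * |M|) * ‖f x‖ := by
        rw [Real.sqrt_mul (Nat.cast_nonneg d), Real.sqrt_sq (by positivity)]; ring

theorem memLp_matVec (ha : IsElliptic c M a) (f : Lp (E d) 2 (volume : Measure (E d))) :
    MemLp (matVec a f) 2 volume := by
  refine (Lp.memLp f).of_le_mul (c := √d * (d * |M|)) ?_ (ae_of_all _ (norm_matVec_le ha f))
  have h1 : Measurable f := (Lp.stronglyMeasurable f).measurable
  have h2 : ∀ k, Measurable fun x => f x k := fun k => by fun_prop
  have h3 : Measurable fun x => fun i => ∑ k, a x i k * f x k :=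
    measurable_pi_lambda _ fun i => Finset.measurable_sum _ fun k _ => (ha.measurable i k).mul (h2 k)
  exact ((WithLp.measurable_toLp 2 _).comp h3).aestronglyMeasurable

/-- Multiplication by a bounded matrix field on `L²`. -/
def matMul (ha : IsElliptic c M a) :
    Lp (E d) 2 (volume : Measure (E d)) →L[ℝ] Lp (E d) 2 (volume : Measure (E d)) :=
  LinearMap.mkContinuous
    { toFun := fun f => (memLp_matVec ha f).toLp
      map_add' := fun f g => by
        rw [← MemLp.toLp_add, MemLp.toLp_eq_toLp_iff]
        filter_upwards [Lp.coeFn_add f g] with x hx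
        ext i
        simp only [matVec, hx, Pi.add_apply, PiLp.add_apply, mul_add, Finset.sum_add_distrib]
      map_smul' := fun r f => by
        rw [RingHom.id_apply, ← MemLp.toLp_const_smul, MemLp.toLp_eq_toLp_iff]
        filter_upwards [Lp.coeFn_smul r f] with x hx
        ext i
        simp only [matVec, hx, Pi.smul_apply, PiLp.smul_apply, smul_eq_mul, Finset.mul_sum,
          mul_left_comm r] }
    (√d * (d * |M|)) fun f => by
      refine Lp.norm_le_mul_norm_of_ae_le_mul ?_
      filter_upwards [(memLp_matVec ha f).coeFn_toLp] with x hx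
      exact hx ▸ norm_matVec_le ha f x

theorem inner_matMul (ha : IsElliptic c M a) (f g : Lp (E d) 2 (volume : Measure (E d))) :
    ⟪f, matMul ha g⟫ = ∫ x, ∑ i, ∑ k, a x i k * g x k * f x i := by
  rw [L2.inner_def]
  refine integral_congr_ae ?_
  filter_upwards [(memLp_matVec ha g).coeFn_toLp] with x hx
  have : (matMul ha g) x = matVec a g x := hx
  rw [this, PiLp.inner_apply]
  refine Finset.sum_congr rfl fun i _ => ?_
  simp [matVec, Finset.sum_mul]

theorem inner_matMul_comm (ha : IsElliptic c M a) (f g : Lp (E d) 2 (volume : Measure (E d))) :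
    ⟪f, matMul ha g⟫ = ⟪g, matMul ha f⟫ := by
  rw [inner_matMul, inner_matMul]
  congr 1 with x
  rw [Finset.sum_comm]
  refine Finset.sum_congr rfl fun k _ => Finset.sum_congr rfl fun i _ => ?_
  rw [ha.symmetric x i k]; ring

theorem le_inner_matMul (ha : IsElliptic c M a) (f : Lp (E d) 2 (volume : Measure (E d))) :
    c * ‖f‖ ^ 2 ≤ ⟪f, matMul ha f⟫ := by
  rw [← real_inner_self_eq_norm_sq, L2.inner_def, L2.inner_def, ← integral_const_mul]
  refine integral_mono_ae ((L2.integrable_inner f f).const_mul c) (L2.integrable_inner _ _) ?_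
  filter_upwards [(memLp_matVec ha f).coeFn_toLp] with x hx
  have : (matMul ha f) x = matVec a f x := hx
  rw [this, real_inner_self_eq_norm_sq, PiLp.inner_apply]
  refine (ha.lower x (f x)).trans (le_of_eq ?_)
  refine Finset.sum_congr rfl fun i _ => ?_
  simp only [matVec, RCLike.inner_apply, conj_trivial, Finset.sum_mul]
  exact Finset.sum_congr rfl fun k _ => by ring

end MatMul

/-! ### The Sobolev space `H₀¹` -/

/-- Pairs `(φ, ∇φ)` with `φ` a test function on `U`. -/
def testPairs (U : Set (E d)) : Submodule ℝ
    (Lp ℝ 2 (volume : Measure (E d)) × Lp (E d) 2 (volume : Measure (E d))) where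
  carrier := {p | ∃ φ : E d → ℝ, ContDiff ℝ (⊤ : ℕ∞) φ ∧ HasCompactSupport φ ∧ tsupport φ ⊆ U ∧
    (p.1 : E d → ℝ) =ᵐ[volume] φ ∧ (p.2 : E d → E d) =ᵐ[volume] gradient φ}
  zero_mem' := by
    refine ⟨0, contDiff_const, HasCompactSupport.zero, by simp [tsupport], Lp.coeFn_zero _ _ _, ?_⟩
    filter_upwards [Lp.coeFn_zero (E d) 2 (volume : Measure (E d))] with x hx
    rw [Prod.snd_zero, hx]
    simp [gradient]
  add_mem' := by
    rintro p q ⟨φ, h1, h2, h3, h4, h5⟩ ⟨ψ, k1, k2, k3, k4, k5⟩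
    refine ⟨φ + ψ, h1.add k1, h2.add k2, (tsupport_add φ ψ).trans (union_subset h3 k3), ?_, ?_⟩
    · filter_upwards [Lp.coeFn_add p.1 q.1, h4, k4] with x hx h k
      rw [Prod.fst_add, hx, Pi.add_apply, h, k, Pi.add_apply]
    · filter_upwards [Lp.coeFn_add p.2 q.2, h5, k5] with x hx h k
      rw [Prod.snd_add, hx, Pi.add_apply, h, k]
      have e := fderiv_add (h1.differentiable (by simp) x) (k1.differentiable (by simp) x)
      simp only [gradient]
      rw [e, map_add]
  smul_mem' := by
    rintro r p ⟨φ, h1, h2, h3, h4, h5⟩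
    refine ⟨r • φ, contDiff_const.smul h1, h2.smul_left (f := fun _ => r), ?_, ?_, ?_⟩
    · exact (closure_mono (Function.support_const_smul_subset r φ)).trans h3
    · filter_upwards [Lp.coeFn_smul r p.1, h4] with x hx h
      rw [Prod.smul_fst, hx, Pi.smul_apply, h, Pi.smul_apply]
    · filter_upwards [Lp.coeFn_smul r p.2, h5] with x hx h
      rw [Prod.smul_snd, hx, Pi.smul_apply, h]
      have e := fderiv_const_smul (h1.differentiable (by simp) x) r
      simp only [gradient]
      rw [e, map_smul]

/-- `H₀¹(U)` as a closed subspace. -/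
def H10Sub (U : Set (E d)) : Submodule ℝ
    (Lp ℝ 2 (volume : Measure (E d)) × Lp (E d) 2 (volume : Measure (E d))) :=
  (testPairs U).topologicalClosure

instance (U : Set (E d)) : CompleteSpace (H10Sub U) :=
  (Submodule.isClosed_topologicalClosure _).completeSpace_coe

/-- A closed condition holding for test functions holds on `H₀¹(U)`. -/
theorem H10_induction {U : Set (E d)}
    {P : Set (Lp ℝ 2 (volume : Measure (E d)) × Lp (E d) 2 (volume : Measure (E d)))}
    (hP : IsClosed P)
    (h : ∀ p : Lp ℝ 2 (volume : Measure (E d)) × Lp (E d) 2 (volume : Measure (E d)),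
      ∀ φ : E d → ℝ, ContDiff ℝ (⊤ : ℕ∞) φ → HasCompactSupport φ → tsupport φ ⊆ U →
      (p.1 : E d → ℝ) =ᵐ[volume] φ → (p.2 : E d → E d) =ᵐ[volume] gradient φ → p ∈ P)
    {p : Lp ℝ 2 (volume : Measure (E d)) × Lp (E d) 2 (volume : Measure (E d))}
    (hp : p ∈ H10 U) : p ∈ P :=
  closure_minimal (by rintro p ⟨φ, h1, h2, h3, h4, h5⟩; exact h p φ h1 h2 h3 h4 h5) hP hp

/-- Restriction of `L²` functions to `U`. -/
abbrev restr (F : Type) [NormedAddCommGroup F] [NormedSpace ℝ F] (U : Set (E d)) :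
    Lp F 2 (volume : Measure (E d)) →L[ℝ] Lp F 2 (volume.restrict U) :=
  LpToLpRestrictCLM (E d) F ℝ volume 2 U

theorem restr_eq_zero_iff {F : Type} [NormedAddCommGroup F] [NormedSpace ℝ F] {U : Set (E d)}
    {f : Lp F 2 (volume : Measure (E d))} :
    restr F U f = 0 ↔ ∀ᵐ x ∂(volume.restrict U), f x = 0 := by
  rw [Lp.eq_zero_iff_ae_eq_zero]
  have h := LpToLpRestrictCLM_coeFn (p := 2) ℝ U f
  constructor <;> intro h' <;> filter_upwards [h, h'] with x h1 h2
  · rw [← h1, h2]; rfl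
  · rw [h1, h2]; rfl

theorem norm_sq_eq_integral {α F : Type} [MeasurableSpace α] {μ : Measure α}
    [NormedAddCommGroup F] [InnerProductSpace ℝ F] (f : Lp F 2 μ) :
    ‖f‖ ^ 2 = ∫ x, ‖f x‖ ^ 2 ∂μ := by
  rw [← real_inner_self_eq_norm_sq, L2.inner_def]
  simp_rw [real_inner_self_eq_norm_sq]

theorem H10_ae_eq_zero {U : Set (E d)} (hU : MeasurableSet U)
    {p : Lp ℝ 2 (volume : Measure (E d)) × Lp (E d) 2 (volume : Measure (E d))}
    (hp : p ∈ H10 U) :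
    (∀ᵐ x ∂(volume.restrict Uᶜ), p.1 x = 0) ∧ ∀ᵐ x ∂(volume.restrict Uᶜ), p.2 x = 0 := by
  rw [← restr_eq_zero_iff, ← restr_eq_zero_iff]
  have hcl : IsClosed {p : Lp ℝ 2 (volume : Measure (E d)) × Lp (E d) 2 (volume : Measure (E d)) |
      restr ℝ Uᶜ p.1 = 0 ∧ restr (E d) Uᶜ p.2 = 0} :=
    (isClosed_eq (by fun_prop) continuous_const).inter (isClosed_eq (by fun_prop) continuous_const)
  refine H10_induction hcl ?_ hp
  intro p φ h1 h2 h3 h4 h5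
  rw [mem_ofPred_eq, restr_eq_zero_iff, restr_eq_zero_iff]
  constructor
  · filter_upwards [ae_restrict_of_ae h4, ae_restrict_mem hU.compl] with x hx hxU
    rw [hx]
    exact image_eq_zero_of_notMem_tsupport fun h => hxU (h3 h)
  · filter_upwards [ae_restrict_of_ae h5, ae_restrict_mem hU.compl] with x hx hxU
    rw [hx, gradient]
    have : x ∉ tsupport (fderiv ℝ φ) := fun h => hxU (h3 (tsupport_fderiv_subset ℝ h))
    rw [image_eq_zero_of_notMem_tsupport this, map_zero]

theorem exists_translate_disjoint (hd : 0 < d) {U : Set (E d)} (hU : Bornology.IsBounded U) :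
    ∃ h : E d, ∀ x ∈ U, x + h ∉ U := by
  obtain ⟨R, hR⟩ := hU.exists_norm_le
  refine ⟨EuclideanSpace.single ⟨0, hd⟩ (2 * |R| + 1), fun x hx hxU => ?_⟩
  have h1 := hR x hx
  have h2 := hR _ hxU
  have h3 : ‖EuclideanSpace.single (⟨0, hd⟩ : Fin d) (2 * |R| + 1)‖ ≤ 2 * R := by
    calc ‖EuclideanSpace.single (⟨0, hd⟩ : Fin d) (2 * |R| + 1)‖
        = ‖(x + EuclideanSpace.single ⟨0, hd⟩ (2 * |R| + 1)) - x‖ := by rw [add_sub_cancel_left]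
      _ ≤ 2 * R := (norm_sub_le _ _).trans (by linarith)
  rw [PiLp.norm_single, Real.norm_of_nonneg (by positivity)] at h3
  linarith [le_abs_self R]

/-- Friedrichs' inequality on `H₀¹(U)`. -/
theorem exists_friedrichs (hd : 0 < d) {U : Set (E d)} (hU : Bornology.IsBounded U) :
    ∃ C : ℝ, 0 ≤ C ∧ ∀ p ∈ H10 U, ‖p.1‖ ≤ C * ‖p.2‖ := by
  obtain ⟨h, hh⟩ := exists_translate_disjoint hd hU
  refine ⟨‖h‖, norm_nonneg _, fun p hp => ?_⟩
  have hcl : IsClosed {p : Lp ℝ 2 (volume : Measure (E d)) × Lp (E d) 2 (volume : Measure (E d)) |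
      ‖p.1‖ ≤ ‖h‖ * ‖p.2‖} := isClosed_le (by fun_prop) (by fun_prop)
  refine H10_induction hcl ?_ hp
  intro p φ h1 h2 h3 h4 h5
  change ‖p.1‖ ≤ ‖h‖ * ‖p.2‖
  refine le_of_sq_le_sq ?_ (by positivity)
  rw [mul_pow, norm_sq_eq_integral, norm_sq_eq_integral]
  have e1 : ∫ x, ‖p.1 x‖ ^ 2 = ∫ x, φ x ^ 2 := by
    refine integral_congr_ae ?_
    filter_upwards [h4] with x hx
    rw [hx, Real.norm_eq_abs, sq_abs]
  have e2 : ∫ x, ‖p.2 x‖ ^ 2 = ∫ x, ‖gradient φ x‖ ^ 2 := by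
    refine integral_congr_ae ?_
    filter_upwards [h5] with x hx
    rw [hx]
  rw [e1, e2]
  exact friedrichs_testFunction h1 h2 h3 hh

/-- The Poincaré inequality on cells for `H₀¹(U)`. -/
theorem H10_cell_poincare {U : Set (E d)} {ε : ℝ} (hε : 0 < ε)
    {F : Finset (Fin d → ℤ)} (hF : U ⊆ ⋃ n ∈ F, cell ε n)
    {p : Lp ℝ 2 (volume : Measure (E d)) × Lp (E d) 2 (volume : Measure (E d))}
    (hp : p ∈ H10 U) :
    ‖p.1‖ ^ 2 - ∑ n ∈ F, (ε ^ d)⁻¹ * (∫ x in cell ε n, p.1 x) ^ 2 ≤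
      cellConst d * ε ^ 2 * ‖p.2‖ ^ 2 := by
  have hint : ∀ (n : Fin d → ℤ) (u : Lp ℝ 2 (volume : Measure (E d))), ∫ x in cell ε n, u x =
      ⟪indicatorConstLp 2 (measurableSet_cell ε n) (volume_cell_ne_top hε n) (1 : ℝ), u⟫ :=
    fun n u => (L2.inner_indicatorConstLp_one _ _ u).symm
  have hcl : IsClosed {p : Lp ℝ 2 (volume : Measure (E d)) × Lp (E d) 2 (volume : Measure (E d)) |
      ‖p.1‖ ^ 2 - ∑ n ∈ F, (ε ^ d)⁻¹ * (∫ x in cell ε n, p.1 x) ^ 2 ≤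
      cellConst d * ε ^ 2 * ‖p.2‖ ^ 2} := by
    simp_rw [hint]
    exact isClosed_le (by fun_prop) (by fun_prop)
  refine H10_induction hcl ?_ hp
  intro p φ h1 h2 h3 h4 h5
  have hi2 := integrable_sq_testFunction h1.continuous h2
  have e1 : ‖p.1‖ ^ 2 = ∑ n ∈ F, ∫ x in cell ε n, φ x ^ 2 := by
    rw [norm_sq_eq_integral, ← integral_biUnion_finset F (fun n _ => measurableSet_cell ε n)
      (fun m _ n _ hmn => disjoint_cell hε hmn) (fun n _ => hi2.integrableOn),
      setIntegral_eq_integral_of_forall_compl_eq_zero]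
    · refine integral_congr_ae ?_
      filter_upwards [h4] with x hx
      rw [hx, Real.norm_eq_abs, sq_abs]
    · intro x hx
      rw [image_eq_zero_of_notMem_tsupport fun h => hx (hF (h3 h))]
      simp
  have e2 : ‖p.2‖ ^ 2 = ∫ x, ‖gradient φ x‖ ^ 2 := by
    rw [norm_sq_eq_integral]
    refine integral_congr_ae ?_
    filter_upwards [h5] with x hx
    rw [hx]
  have e3 : ∀ n, ∫ x in cell ε n, p.1 x = ∫ x in cell ε n, φ x := fun n =>
    integral_congr_ae (ae_restrict_of_ae h4)
  simp_rw [mem_ofPred_eq, e1, e2, e3, ← Finset.sum_sub_distrib]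
  exact sum_cell_poincare_testFunction h1 h2 hε F

theorem infinite_coe_of_isOpen (hd : 0 < d) {U : Set (E d)} (hU : IsOpen U) (hne : U.Nonempty) :
    Infinite U := by
  have : Nonempty (Fin d) := ⟨⟨0, hd⟩⟩
  obtain ⟨x, hx⟩ := hne
  exact (infinite_of_mem_nhds x (hU.mem_nhds hx)).to_subtype

/-- There are infinitely many independent test functions on a nonempty open set. -/
theorem exists_linearIndependent_H10 (hd : 0 < d) {U : Set (E d)} (hU : IsOpen U)
    (hne : U.Nonempty) :
    ∃ p : ℕ → H10Sub U, LinearIndependent ℝ fun n => restr ℝ U (p n).1.1 := by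
  have := infinite_coe_of_isOpen hd hU hne
  -- Bump functions in pairwise disjoint open subsets of `U` are orthogonal, hence independent.
  obtain ⟨V, hVi, hVo, hVd⟩ := exists_seq_infinite_isOpen_pairwise_disjoint U
  have hex : ∀ n, ∃ p : H10Sub U, ∃ φ : E d → ℝ, Continuous φ ∧
      tsupport φ ⊆ Subtype.val '' V n ∧ (∃ x ∈ U, φ x ≠ 0) ∧
      (p.1.1 : E d → ℝ) =ᵐ[volume] φ := by
    intro n
    obtain ⟨x, hx⟩ := (hVi n).nonempty
    have hVn : IsOpen (Subtype.val '' V n) := hU.isOpenMap_subtype_val _ (hVo n)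
    obtain ⟨φ, h1, h2, h3, -, h5⟩ := exists_contDiff_tsupport_subset (n := ⊤)
      (hVn.mem_nhds (mem_image_of_mem _ hx))
    have i1 : MemLp φ 2 volume := h3.continuous.memLp_of_hasCompactSupport h2
    have i2 : MemLp (gradient φ) 2 volume :=
      (continuous_gradient h3).memLp_of_hasCompactSupport (hasCompactSupport_gradient h2)
    have hsub : tsupport φ ⊆ U := h1.trans (by rintro _ ⟨y, -, rfl⟩; exact y.2)
    refine ⟨⟨(i1.toLp, i2.toLp), subset_closure ⟨φ, h3, h2, hsub, i1.coeFn_toLp, i2.coeFn_toLp⟩⟩,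
      φ, h3.continuous, h1, ⟨x, x.2, by rw [h5]; exact one_ne_zero⟩, i1.coeFn_toLp⟩
  choose p φ hφc hφs hφ0 hpφ using hex
  have hr : ∀ n, (restr ℝ U (p n).1.1 : E d → ℝ) =ᵐ[volume.restrict U] φ n := fun n =>
    (LpToLpRestrictCLM_coeFn (p := 2) ℝ U _).trans (ae_restrict_of_ae (hpφ n))
  refine ⟨p, linearIndependent_of_ne_zero_of_inner_eq_zero (fun n h0 => ?_) fun m n hmn => ?_⟩
  · obtain ⟨x, hx, hx0⟩ := hφ0 n
    have h1 : φ n =ᵐ[volume.restrict U] 0 := by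
      have := (restr_eq_zero_iff.mp h0)
      filter_upwards [ae_restrict_of_ae (hpφ n), this] with y h1 h2
      rw [← h1, h2]; rfl
    exact hx0 (Measure.eqOn_open_of_ae_eq h1 hU (hφc n).continuousOn continuousOn_const hx)
  · beta_reduce
    rw [L2.inner_def, integral_eq_zero_of_ae]
    filter_upwards [hr m, hr n] with x h1 h2
    rw [h1, h2]
    by_cases hx : φ m x = 0
    · simp [hx]
    · obtain ⟨y, hy, rfl⟩ := hφs m (subset_tsupport _ hx)
      have : φ n y = 0 := by
        refine image_eq_zero_of_notMem_tsupport fun h => ?_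
        obtain ⟨z, hz, hzy⟩ := hφs n h
        rw [Subtype.ext hzy] at hz
        exact Set.disjoint_left.mp (hVd hmn) hy hz
      simp [this]

/-! ### Dirichlet problems on the energy space -/

/-- The energy space of a coercive form on a closed space of pairs `(u, ∇u)`. -/
theorem exists_hilbert_of_pairs {X Y Z : Type} [NormedAddCommGroup X] [InnerProductSpace ℝ X]
    [CompleteSpace X] [NormedAddCommGroup Y] [InnerProductSpace ℝ Y] [NormedAddCommGroup Z]
    [InnerProductSpace ℝ Z] [CompleteSpace Z] (S : Submodule ℝ (X × Y)) [CompleteSpace S]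
    (A : Y →L[ℝ] Y) (hA : ∀ y z, ⟪y, A z⟫ = ⟪z, A y⟫) {c C : ℝ} (hc : 0 < c)
    (hcA : ∀ y, c * ‖y‖ ^ 2 ≤ ⟪y, A y⟫) (hC0 : 0 ≤ C) (hC : ∀ p ∈ S, ‖p.1‖ ≤ C * ‖p.2‖)
    (R : X →L[ℝ] Z) :
    ∃ (H : Type) (_ : NormedAddCommGroup H) (_ : InnerProductSpace ℝ H) (_ : CompleteSpace H)
      (ι : H →L[ℝ] X), (∀ h, ∃ y, (ι h, y) ∈ S ∧ c * ‖y‖ ^ 2 ≤ ‖h‖ ^ 2) ∧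
      (∀ p ∈ S, ∃ h, ι h = p.1) ∧
      ∀ f u, (∃ y, (u, y) ∈ S ∧ ∀ p ∈ S, ⟪p.2, A y⟫ = ⟪f, R p.1⟫) ↔
        ι ((R ∘L ι).adjoint f) = u := by
  let D : S →L[ℝ] Y := ContinuousLinearMap.snd ℝ X Y ∘L S.subtypeL
  let D₀ : S →L[ℝ] X := ContinuousLinearMap.fst ℝ X Y ∘L S.subtypeL
  let b : S →L[ℝ] S →L[ℝ] ℝ := ContinuousLinearMap.bilinearComp (innerSL ℝ) D (A ∘L D)
  have hb : ∀ p q, b p q = ⟪p.1.2, A q.1.2⟫ := fun p q => rfl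
  have hcoer : ∀ p, c / (C + 1) ^ 2 * ‖p‖ ^ 2 ≤ b p p := by
    intro p
    have h1 : ‖p‖ ≤ (C + 1) * ‖p.1.2‖ := by
      have h2 : ‖p‖ = max ‖p.1.1‖ ‖p.1.2‖ := rfl
      have h3 := hC p.1 p.2
      rw [h2, max_le_iff]
      constructor <;> nlinarith [norm_nonneg p.1.2]
    have h2 : ‖p‖ ^ 2 ≤ (C + 1) ^ 2 * ‖p.1.2‖ ^ 2 := by
      rw [← mul_pow]; exact pow_le_pow_left₀ (norm_nonneg _) h1 2
    calc c / (C + 1) ^ 2 * ‖p‖ ^ 2 ≤ c / (C + 1) ^ 2 * ((C + 1) ^ 2 * ‖p.1.2‖ ^ 2) := by gcongr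
      _ = c * ‖p.1.2‖ ^ 2 := by field_simp
      _ ≤ b p p := hcA _
  obtain ⟨H, i1, i2, i3, Φ, hΦ⟩ := exists_hilbert_of_coercive b (fun p q => hA _ _)
    (by positivity) hcoer
  let ι : H →L[ℝ] X := D₀ ∘L (Φ : H →L[ℝ] S)
  have hι : ∀ h, ι h = (Φ h).1.1 := fun h => rfl
  refine ⟨H, i1, i2, i3, ι, fun h => ⟨(Φ h).1.2, (Φ h).2, ?_⟩, fun p hp => ⟨Φ.symm ⟨p, hp⟩, ?_⟩,
    fun f u => ?_⟩
  · rw [← real_inner_self_eq_norm_sq h, hΦ, hb]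
    exact hcA _
  · rw [hι, ContinuousLinearEquiv.apply_symm_apply]
  -- In the energy inner product the weak equation says that the solution represents the functional
  -- `h ↦ ⟪f, R (ι h)⟫`. By Riesz the representative is the adjoint applied to `f`, so the solution
  -- operator is `ι` after this adjoint.
  · have hadj : ∀ h, ⟪(R ∘L ι).adjoint f, h⟫ = ⟪f, R (Φ h).1.1⟫ := fun h => by
      rw [ContinuousLinearMap.adjoint_inner_left, ContinuousLinearMap.comp_apply, hι]
    constructor
    · rintro ⟨y, hy, hsol⟩
      have : Φ.symm ⟨(u, y), hy⟩ = (R ∘L ι).adjoint f := by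
        refine ext_inner_right ℝ fun h => ?_
        rw [hadj, hΦ, ContinuousLinearEquiv.apply_symm_apply, hb, hA]
        exact hsol _ (Φ h).2
      rw [← this, hι, ContinuousLinearEquiv.apply_symm_apply]
    · rintro rfl
      refine ⟨(Φ ((R ∘L ι).adjoint f)).1.2, (Φ _).2, fun p hp => ?_⟩
      have h3 := hadj (Φ.symm ⟨p, hp⟩)
      rw [hΦ, ContinuousLinearEquiv.apply_symm_apply, hb, hA] at h3
      exact h3

theorem isDirichletSolution_iff {U : Set (E d)} (hU : MeasurableSet U) {c M : ℝ}
    {a : E d → Matrix (Fin d) (Fin d) ℝ} (ha : IsElliptic c M a) {f : Lp ℝ 2 (volume.restrict U)}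
    {g : E d → ℝ} (hfg : g =ᵐ[volume.restrict U] f) {u : Lp ℝ 2 (volume : Measure (E d))} :
    IsDirichletSolution U a g u ↔ ∃ Du, (u, Du) ∈ H10Sub U ∧
      ∀ p ∈ H10Sub U, ⟪p.2, matMul ha Du⟫ = ⟪f, restr ℝ U p.1⟫ := by
  have hform : ∀ p ∈ H10Sub U, ∀ Du : Lp (E d) 2 (volume : Measure (E d)),
      ∫ x in U, ∑ i, ∑ k, a x i k * Du x k * p.2 x i = ⟪p.2, matMul ha Du⟫ := by
    intro p hp Du
    rw [inner_matMul]
    refine setIntegral_eq_integral_of_ae_compl_eq_zero ?_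
    have := (H10_ae_eq_zero hU hp).2
    rw [ae_restrict_iff' hU.compl] at this
    filter_upwards [this] with x hx hxU
    have : p.2 x = 0 := hx hxU
    simp [this]
  have hrhs : ∀ v : Lp ℝ 2 (volume : Measure (E d)),
      ∫ x in U, g x * v x = ⟪f, restr ℝ U v⟫ := by
    intro v
    rw [L2.inner_def]
    refine integral_congr_ae ?_
    filter_upwards [hfg, LpToLpRestrictCLM_coeFn (p := 2) ℝ U v] with x h1 h2
    rw [h1, h2, RCLike.inner_apply, conj_trivial, mul_comm]
  refine exists_congr fun Du => and_congr Iff.rfl (forall₂_congr fun p hp => ?_)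
  rw [hform p hp, hrhs]

/-- The energy space of a Dirichlet problem on a bounded open set. -/
theorem exists_energySpace (hd : 0 < d) {U : Set (E d)} (hUo : IsOpen U)
    (hUb : Bornology.IsBounded U) (hUn : U.Nonempty) {c M : ℝ} (hc : 0 < c)
    {a : E d → Matrix (Fin d) (Fin d) ℝ} (ha : IsElliptic c M a) :
    ∃ (H : Type) (_ : NormedAddCommGroup H) (_ : InnerProductSpace ℝ H) (_ : CompleteSpace H)
      (ι : H →L[ℝ] Lp ℝ 2 (volume : Measure (E d))),
      (∀ h, ∀ᵐ x ∂(volume.restrict Uᶜ), ι h x = 0) ∧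
      (∀ (f : Lp ℝ 2 (volume.restrict U)) (g : E d → ℝ), g =ᵐ[volume.restrict U] f →
        ∀ u, IsDirichletSolution U a g u ↔ ι ((restr ℝ U ∘L ι).adjoint f) = u) ∧
      (∀ ε : ℝ, 0 < ε → ∀ F : Finset (Fin d → ℤ), U ⊆ ⋃ n ∈ F, cell ε n → ∀ h,
        ‖ι h‖ ^ 2 - ∑ n ∈ F, (ε ^ d)⁻¹ * (∫ x in cell ε n, ι h x) ^ 2 ≤
          cellConst d * ε ^ 2 / c * ‖h‖ ^ 2) ∧
      ¬ FiniteDimensional ℝ (LinearMap.range (restr ℝ U ∘L ι).toLinearMap) := by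
  have hUm := hUo.measurableSet
  obtain ⟨C, hC0, hC⟩ := exists_friedrichs hd hUb
  obtain ⟨H, i1, i2, i3, ι, h1, h2, h3⟩ := exists_hilbert_of_pairs (H10Sub U) (matMul ha)
    (inner_matMul_comm ha) hc (le_inner_matMul ha) hC0 hC (restr ℝ U)
  refine ⟨H, i1, i2, i3, ι, fun h => ?_, fun f g hfg u => ?_, fun ε hε F hF h => ?_, fun hfin => ?_⟩
  · obtain ⟨y, hy, -⟩ := h1 h
    exact (H10_ae_eq_zero hUm hy).1
  · rw [isDirichletSolution_iff hUm ha hfg]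
    exact h3 f u
  · obtain ⟨y, hy, hyc⟩ := h1 h
    refine (H10_cell_poincare hε hF hy).trans ?_
    have h4 : ‖y‖ ^ 2 ≤ ‖h‖ ^ 2 / c := by rw [le_div_iff₀ hc, mul_comm]; exact hyc
    calc cellConst d * ε ^ 2 * ‖y‖ ^ 2 ≤ cellConst d * ε ^ 2 * (‖h‖ ^ 2 / c) :=
          mul_le_mul_of_nonneg_left h4 (mul_nonneg (cellConst_nonneg d) (sq_nonneg _))
      _ = _ := by ring
  · obtain ⟨p, hp⟩ := exists_linearIndependent_H10 hd hUo hUn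
    have hr : ∀ n, restr ℝ U (p n).1.1 ∈ LinearMap.range (restr ℝ U ∘L ι).toLinearMap := by
      intro n
      obtain ⟨h, hh⟩ := h2 (p n).1 (p n).2
      exact ⟨h, congrArg (restr ℝ U) hh⟩
    have hv : LinearIndependent ℝ fun n =>
        (⟨restr ℝ U (p n).1.1, hr n⟩ : LinearMap.range (restr ℝ U ∘L ι).toLinearMap) :=
      LinearIndependent.of_comp (Submodule.subtype _) hp
    have := hv.finite_of_isNoetherian
    exact not_finite ℕ

/-! ### Cell averages as finite rank operators -/

section FiniteRank

variable {L : Type*} [NormedAddCommGroup L] [InnerProductSpace ℝ L] {ι : Type*}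

/-- The operator `f ↦ ∑ w ⟪eₙ, f⟫ eₙ`. -/
def rankSum (w : ℝ) (e : ι → L) (F : Finset ι) : L →L[ℝ] L :=
  ∑ n ∈ F, w • (innerSL ℝ (e n)).smulRight (e n)

theorem rankSum_apply (w : ℝ) (e : ι → L) (F : Finset ι) (f : L) :
    rankSum w e F f = ∑ n ∈ F, (w * ⟪e n, f⟫) • e n := by
  simp [rankSum, smul_smul]

theorem inner_rankSum (w : ℝ) (e : ι → L) (F : Finset ι) (f g : L) :
    ⟪rankSum w e F f, g⟫ = ∑ n ∈ F, w * (⟪e n, f⟫ * ⟪e n, g⟫) := by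
  rw [rankSum_apply, sum_inner]
  exact Finset.sum_congr rfl fun n _ => by rw [real_inner_smul_left, mul_assoc]

theorem inner_rankSum_self (w : ℝ) (e : ι → L) (F : Finset ι) (f : L) :
    ⟪rankSum w e F f, f⟫ = ∑ n ∈ F, w * ⟪e n, f⟫ ^ 2 := by
  rw [inner_rankSum]
  exact Finset.sum_congr rfl fun n _ => by rw [sq]

theorem isSymmetric_rankSum (w : ℝ) (e : ι → L) (F : Finset ι) :
    (rankSum w e F : L →ₗ[ℝ] L).IsSymmetric := fun f g => by
  rw [ContinuousLinearMap.coe_coe, inner_rankSum, real_inner_comm, inner_rankSum]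
  exact Finset.sum_congr rfl fun n _ => by ring

theorem finiteDimensional_range_rankSum (w : ℝ) (e : ι → L) (F : Finset ι) :
    FiniteDimensional ℝ (LinearMap.range (rankSum w e F).toLinearMap) := by
  have hle : LinearMap.range (rankSum w e F).toLinearMap ≤ Submodule.span ℝ (e '' F) := by
    rintro _ ⟨f, rfl⟩
    rw [ContinuousLinearMap.coe_coe, rankSum_apply]
    exact Submodule.sum_mem _ fun n hn =>
      Submodule.smul_mem _ _ (Submodule.subset_span (mem_image_of_mem e hn))
  have : FiniteDimensional ℝ (Submodule.span ℝ (e '' F)) :=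
    FiniteDimensional.span_of_finite ℝ (F.finite_toSet.image e)
  exact Submodule.finiteDimensional_of_le hle

variable {w : ℝ} {e : ι → L} {F : Finset ι}

theorem inner_rankSum_nonneg (hw : 0 ≤ w) (f : L) : 0 ≤ ⟪rankSum w e F f, f⟫ := by
  rw [inner_rankSum_self]
  exact Finset.sum_nonneg fun n _ => by positivity

/-- The vectors are orthogonal but possibly shorter than normalized, since a cell may meet `U` only
in part. So the operator need not be a projection, and `Q² ≤ Q` takes the place of `Q² = Q`. -/
theorem norm_sq_rankSum_le (hw : 0 ≤ w) (he : ∀ m n, m ≠ n → ⟪e m, e n⟫ = 0)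
    (hn : ∀ n, w * ‖e n‖ ^ 2 ≤ 1) (f : L) : ‖rankSum w e F f‖ ^ 2 ≤ ⟪rankSum w e F f, f⟫ := by
  rw [inner_rankSum_self, ← real_inner_self_eq_norm_sq, inner_rankSum]
  refine Finset.sum_le_sum fun n hnF => ?_
  have h1 : ⟪e n, rankSum w e F f⟫ = w * ⟪e n, f⟫ * ‖e n‖ ^ 2 := by
    rw [rankSum_apply, inner_sum, Finset.sum_eq_single n]
    · rw [real_inner_smul_right, real_inner_self_eq_norm_sq]
    · intro m _ hm
      rw [real_inner_smul_right, he n m hm.symm, mul_zero]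
    · exact fun h => absurd hnF h
  rw [h1]
  refine mul_le_mul_of_nonneg_left ?_ hw
  calc ⟪e n, f⟫ * (w * ⟪e n, f⟫ * ‖e n‖ ^ 2) = (w * ‖e n‖ ^ 2) * ⟪e n, f⟫ ^ 2 := by ring
    _ ≤ 1 * ⟪e n, f⟫ ^ 2 := mul_le_mul_of_nonneg_right (hn n) (sq_nonneg _)
    _ = ⟪e n, f⟫ ^ 2 := one_mul _

theorem inner_rankSum_le (hw : 0 ≤ w) (he : ∀ m n, m ≠ n → ⟪e m, e n⟫ = 0)
    (hn : ∀ n, w * ‖e n‖ ^ 2 ≤ 1) (f : L) : ⟪rankSum w e F f, f⟫ ≤ ‖f‖ ^ 2 := by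
  have h1 := norm_sq_rankSum_le (F := F) hw he hn f
  have h2 := real_inner_le_norm (rankSum w e F f) f
  nlinarith [sq_nonneg (‖rankSum w e F f‖ - ‖f‖)]

end FiniteRank

theorem isCompactOperator_of_finiteDimensional_range {X Y : Type*} [NormedAddCommGroup X]
    [NormedSpace ℝ X] [NormedAddCommGroup Y] [NormedSpace ℝ Y] (T : X →L[ℝ] Y)
    (hT : FiniteDimensional ℝ (LinearMap.range T.toLinearMap)) : IsCompactOperator T := by
  let S : X →L[ℝ] LinearMap.range T.toLinearMap :=
    T.codRestrict _ fun x => LinearMap.mem_range_self T.toLinearMap x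
  have : ProperSpace (LinearMap.range T.toLinearMap) := FiniteDimensional.proper ℝ _
  have h := isCompactOperator_of_locallyCompactSpace_dom S
  exact h.clm_comp (Submodule.subtypeL _)

theorem volume_restrict_cell_ne_top (U : Set (E d)) {ε : ℝ} (hε : 0 < ε) (n : Fin d → ℤ) :
    (volume.restrict U) (cell ε n) ≠ ∞ :=
  ((Measure.restrict_apply_le U _).trans_lt (volume_cell_ne_top hε n).lt_top).ne

/-- The indicator of a cell, in `L²(U)`. -/
def cellVec (U : Set (E d)) {ε : ℝ} (hε : 0 < ε) (n : Fin d → ℤ) : Lp ℝ 2 (volume.restrict U) :=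
  indicatorConstLp 2 (measurableSet_cell ε n)
    (volume_restrict_cell_ne_top U hε n) (1 : ℝ)

theorem inner_cellVec (U : Set (E d)) {ε : ℝ} (hε : 0 < ε) (n : Fin d → ℤ)
    (f : Lp ℝ 2 (volume.restrict U)) :
    ⟪cellVec U hε n, f⟫ = ∫ x in cell ε n, f x ∂(volume.restrict U) :=
  L2.inner_indicatorConstLp_one _ _ f

theorem inner_cellVec_of_ne (U : Set (E d)) {ε : ℝ} (hε : 0 < ε) (m n : Fin d → ℤ) (hmn : m ≠ n) :
    ⟪cellVec U hε m, cellVec U hε n⟫ = 0 := by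
  rw [cellVec, cellVec, L2.real_inner_indicatorConstLp_one_indicatorConstLp_one _ _
      (volume_restrict_cell_ne_top U hε m) (volume_restrict_cell_ne_top U hε n),
    (disjoint_cell hε hmn).inter_eq]
  simp

theorem norm_cellVec_le (U : Set (E d)) {ε : ℝ} (hε : 0 < ε) (n : Fin d → ℤ) :
    (ε ^ d)⁻¹ * ‖cellVec U hε n‖ ^ 2 ≤ 1 := by
  rw [inv_mul_le_iff₀ (by positivity), mul_one, ← real_inner_self_eq_norm_sq, cellVec,
    L2.real_inner_indicatorConstLp_one_indicatorConstLp_one _ _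
      (volume_restrict_cell_ne_top U hε n) (volume_restrict_cell_ne_top U hε n), inter_self, ← volume_real_cell hε n]
  exact ENNReal.toReal_mono (volume_cell_ne_top hε n) (Measure.restrict_apply_le U _)

/-- Cell averaging on `L²(U)`. -/
def cellProj (U : Set (E d)) {ε : ℝ} (hε : 0 < ε) (F : Finset (Fin d → ℤ)) :
    Lp ℝ 2 (volume.restrict U) →L[ℝ] Lp ℝ 2 (volume.restrict U) :=
  rankSum (ε ^ d)⁻¹ (cellVec U hε) F

/-! ### Energy embeddings and Rellich's theorem -/

/-- What the proof uses of the energy space `H` of a Dirichlet problem on `U`: `ι u` is `u` as an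
`L²` function on the whole space. -/
structure IsEnergyEmbedding (U : Set (E d)) (a : E d → Matrix (Fin d) (Fin d) ℝ) (c : ℝ)
    {H : Type} [NormedAddCommGroup H] [InnerProductSpace ℝ H] [CompleteSpace H]
    (ι : H →L[ℝ] Lp ℝ 2 (volume : Measure (E d))) : Prop where
  ae_eq_zero : ∀ h, ∀ᵐ x ∂(volume.restrict Uᶜ), ι h x = 0
  solution_iff : ∀ (f : Lp ℝ 2 (volume.restrict U)) (g : E d → ℝ), g =ᵐ[volume.restrict U] f →
    ∀ u, IsDirichletSolution U a g u ↔ ι ((restr ℝ U ∘L ι).adjoint f) = u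
  poincare : ∀ ε : ℝ, 0 < ε → ∀ F : Finset (Fin d → ℤ), U ⊆ ⋃ n ∈ F, cell ε n → ∀ h,
    ‖ι h‖ ^ 2 - ∑ n ∈ F, (ε ^ d)⁻¹ * (∫ x in cell ε n, ι h x) ^ 2 ≤
      cellConst d * ε ^ 2 / c * ‖h‖ ^ 2
  infinite_range : ¬ FiniteDimensional ℝ (LinearMap.range (restr ℝ U ∘L ι).toLinearMap)

theorem exists_energyEmbedding (hd : 0 < d) {U : Set (E d)} (hUo : IsOpen U)
    (hUb : Bornology.IsBounded U) (hUn : U.Nonempty) {c M : ℝ} (hc : 0 < c)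
    {a : E d → Matrix (Fin d) (Fin d) ℝ} (ha : IsElliptic c M a) :
    ∃ (H : Type) (_ : NormedAddCommGroup H) (_ : InnerProductSpace ℝ H) (_ : CompleteSpace H)
      (ι : H →L[ℝ] Lp ℝ 2 (volume : Measure (E d))), IsEnergyEmbedding U a c ι := by
  obtain ⟨H, i1, i2, i3, ι, h1, h2, h3, h4⟩ := exists_energySpace hd hUo hUb hUn hc ha
  exact ⟨H, i1, i2, i3, ι, h1, h2, h3, h4⟩

namespace IsEnergyEmbedding

variable {U : Set (E d)} {a : E d → Matrix (Fin d) (Fin d) ℝ} {c : ℝ}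
    {H : Type} [NormedAddCommGroup H] [InnerProductSpace ℝ H] [CompleteSpace H]
    {ι : H →L[ℝ] Lp ℝ 2 (volume : Measure (E d))}

theorem norm_restr (hι : IsEnergyEmbedding U a c ι) (hU : MeasurableSet U) (h : H) :
    ‖(restr ℝ U ∘L ι) h‖ = ‖ι h‖ := by
  have : ‖(restr ℝ U ∘L ι) h‖ ^ 2 = ‖ι h‖ ^ 2 := by
    rw [norm_sq_eq_integral, norm_sq_eq_integral]
    have h1 : ∫ x in U, ‖(restr ℝ U ∘L ι) h x‖ ^ 2 = ∫ x in U, ‖ι h x‖ ^ 2 := by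
      refine integral_congr_ae ?_
      filter_upwards [LpToLpRestrictCLM_coeFn (p := 2) ℝ U (ι h)] with x hx
      rw [ContinuousLinearMap.comp_apply, hx]
    rw [h1]
    refine setIntegral_eq_integral_of_ae_compl_eq_zero ?_
    have := hι.ae_eq_zero h
    rw [ae_restrict_iff' hU.compl] at this
    filter_upwards [this] with x hx hxU
    simp [hx hxU]
  exact (pow_left_inj₀ (norm_nonneg _) (norm_nonneg _) two_ne_zero).mp this

theorem inner_cellVec_restr (hι : IsEnergyEmbedding U a c ι) (hU : MeasurableSet U) {ε : ℝ}
    (hε : 0 < ε) (n : Fin d → ℤ) (h : H) :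
    ⟪cellVec U hε n, (restr ℝ U ∘L ι) h⟫ = ∫ x in cell ε n, ι h x := by
  rw [inner_cellVec, Measure.restrict_restrict (measurableSet_cell ε n)]
  have h1 : ∫ x in cell ε n ∩ U, (restr ℝ U ∘L ι) h x = ∫ x in cell ε n ∩ U, ι h x := by
    refine integral_congr_ae ?_
    exact ae_restrict_of_ae_restrict_of_subset inter_subset_right
      (LpToLpRestrictCLM_coeFn (p := 2) ℝ U (ι h))
  rw [h1]
  symm
  refine setIntegral_eq_of_subset_of_ae_sdiff_eq_zero (measurableSet_cell ε n).nullMeasurableSet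
    inter_subset_left ?_
  have := hι.ae_eq_zero h
  rw [ae_restrict_iff' hU.compl] at this
  filter_upwards [this] with x hx hxU
  exact hx fun h => hxU.2 ⟨hxU.1, h⟩

/-- Poincaré's inequality on cells, transferred to `U`: functions of the energy space vanish outside
`U`, so restriction changes neither norms nor cell integrals. -/
theorem sub_inner_cellProj_le (hι : IsEnergyEmbedding U a c ι) (hU : MeasurableSet U) {ε : ℝ}
    (hε : 0 < ε) {F : Finset (Fin d → ℤ)} (hF : U ⊆ ⋃ n ∈ F, cell ε n) (h : H) :
    ‖(restr ℝ U ∘L ι) h‖ ^ 2 -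
      ⟪cellProj U hε F ((restr ℝ U ∘L ι) h), (restr ℝ U ∘L ι) h⟫ ≤
      cellConst d * ε ^ 2 / c * ‖h‖ ^ 2 := by
  rw [cellProj, inner_rankSum_self, hι.norm_restr hU]
  simp_rw [hι.inner_cellVec_restr hU hε]
  exact hι.poincare ε hε F hF h

/-- Rellich's theorem. -/
theorem isCompactOperator (hι : IsEnergyEmbedding U a c ι) (hU : MeasurableSet U) (hc : 0 < c)
    (hUb : Bornology.IsBounded U) : IsCompactOperator (restr ℝ U ∘L ι) := by
  set J := restr ℝ U ∘L ι with hJ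
  have hpos : ∀ n : ℕ, (0 : ℝ) < 1 / ((n : ℝ) + 1) := fun n => by positivity
  choose F hF using fun n : ℕ => exists_cover_cell hUb (hpos n)
  set T : ℕ → H →L[ℝ] Lp ℝ 2 (volume.restrict U) := fun n => cellProj U (hpos n) (F n) ∘L J with hT
  have hTc : ∀ n, IsCompactOperator (T n) := fun n =>
    (isCompactOperator_of_finiteDimensional_range _
      (finiteDimensional_range_rankSum _ (cellVec U (hpos n)) (F n))).comp_clm J
  -- Expanding the square and using `‖Q f‖² ≤ ⟪Q f, f⟫` gives `‖Q J h - J h‖² ≤ ‖J h‖² - ⟪Q J h, J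
  -- h⟫`, which Poincaré's inequality on cells of side `1 / (n + 1)` controls. So `J` is a norm
  -- limit of finite rank operators.
  have hbound : ∀ n, ‖T n - J‖ ≤ √(cellConst d / c) * (1 / ((n : ℝ) + 1)) := by
    intro n
    refine ContinuousLinearMap.opNorm_le_bound _ (by positivity) fun h => ?_
    refine le_of_sq_le_sq ?_ (by positivity)
    have h1 := hι.sub_inner_cellProj_le hU (hpos n) (hF n) h
    have h2 := norm_sq_rankSum_le (F := F n) (w := ((1 / ((n : ℝ) + 1)) ^ d)⁻¹) (by positivity)
      (inner_cellVec_of_ne U (hpos n)) (norm_cellVec_le U (hpos n)) (J h)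
    rw [sub_apply, mul_pow, mul_pow,
      Real.sq_sqrt (div_nonneg (cellConst_nonneg d) hc.le), @norm_sub_sq_real]
    have h3 : T n h = rankSum ((1 / ((n : ℝ) + 1)) ^ d)⁻¹ (cellVec U (hpos n)) (F n) (J h) := rfl
    rw [← hJ, cellProj] at h1
    rw [h3]
    have h4 : cellConst d * (1 / ((n : ℝ) + 1)) ^ 2 / c * ‖h‖ ^ 2 =
      cellConst d / c * (1 / ((n : ℝ) + 1)) ^ 2 * ‖h‖ ^ 2 := by ring
    linarith
  refine isCompactOperator_of_tendsto (l := atTop) (F := T) ?_ (Eventually.of_forall hTc)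
  rw [tendsto_iff_norm_sub_tendsto_zero]
  refine squeeze_zero (fun n => norm_nonneg _) hbound ?_
  simpa using tendsto_one_div_add_atTop_nhds_zero_nat.const_mul (√(cellConst d / c))

theorem cellProj_apply (hι : IsEnergyEmbedding U a c ι) (hU : MeasurableSet U) {ε : ℝ}
    (hε : 0 < ε) {F : Finset (Fin d → ℤ)} (hF : U ⊆ ⋃ n ∈ F, cell ε n) (h : H) :
    ∀ᵐ x ∂(volume.restrict U),
      cellProj U hε F ((restr ℝ U ∘L ι) h) x = cellAverage ε (ι h) x := by
  have h1 : ∀ᵐ x ∂(volume.restrict U), ∀ n ∈ F,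
      cellVec U hε n x = (cell ε n).indicator (fun _ => (1 : ℝ)) x :=
    (ae_ball_iff F.countable_toSet).mpr fun n _ => indicatorConstLp_coeFn
  have h2 : ∀ G : Finset (Fin d → ℤ), ∀ w : (Fin d → ℤ) → ℝ, ∀ᵐ x ∂(volume.restrict U),
      (∑ n ∈ G, w n • cellVec U hε n : Lp ℝ 2 (volume.restrict U)) x =
        ∑ n ∈ G, w n * cellVec U hε n x := by
    intro G w
    filter_upwards [Lp.coeFn_finsetSum G fun n => w n • cellVec U hε n,
      (ae_ball_iff G.countable_toSet).mpr fun n _ => Lp.coeFn_smul (w n) (cellVec U hε n)]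
      with x hx1 hx2
    rw [hx1, Finset.sum_apply]
    exact Finset.sum_congr rfl fun n hn => by rw [hx2 n hn]; rfl
  filter_upwards [h1, h2 F fun n => (ε ^ d)⁻¹ * ⟪cellVec U hε n, (restr ℝ U ∘L ι) h⟫,
    ae_restrict_mem hU] with x hx1 hx2 hxU
  obtain ⟨n, hn⟩ := mem_iUnion.mp (hF hxU)
  obtain ⟨hnF, hxn⟩ := mem_iUnion.mp hn
  rw [cellProj, rankSum_apply, hx2, Finset.sum_eq_single n]
  · rw [hx1 n hnF, indicator_of_mem hxn, mul_one, hι.inner_cellVec_restr hU hε, cellAverage,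
      ← (mem_cell_iff hε).mp hxn]
  · intro m hm hmn
    rw [hx1 m hm, indicator_of_notMem, mul_zero]
    exact fun h => Set.disjoint_left.mp (disjoint_cell hε hmn) h hxn
  · exact fun h => absurd hnF h

end IsEnergyEmbedding

/-! ### Ellipticity of the homogenized matrix -/

theorem IsCoefficient.isElliptic {ν : ℝ} {A : E d → Matrix (Fin d) (Fin d) ℝ}
    (hA : IsCoefficient ν A) (hν : 0 < ν) : IsElliptic ν (2 * ν⁻¹) A where
  measurable i k := by
    obtain ⟨τ, s, hτ, hs, -, h⟩ := hA.holder
    refine Continuous.measurable ?_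
    rw [continuous_iff_continuousAt]
    intro y
    rw [ContinuousAt, tendsto_iff_dist_tendsto_zero]
    refine squeeze_zero (fun _ => dist_nonneg) (g := fun w => τ * ‖w - y‖ ^ s)
      (fun w => by rw [Real.dist_eq]; exact h w y i k) ?_
    have hc : Continuous fun w : E d => τ * ‖w - y‖ ^ s :=
      continuous_const.mul ((by fun_prop : Continuous fun w : E d => ‖w - y‖).rpow_const
        fun _ => Or.inr hs.le)
    have := hc.tendsto y
    simpa [Real.zero_rpow hs.ne'] using this
  bounded x i k := by
    set q : E d → ℝ := fun ξ => ∑ i, ∑ k, A x i k * ξ i * ξ k with hq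
    have h0 : ∀ ξ, 0 ≤ q ξ := fun ξ => le_trans (by positivity) (hA.elliptic_lower x ξ)
    have h1 : ∀ ξ, q ξ ≤ ν⁻¹ * ‖ξ‖ ^ 2 := hA.elliptic_upper x
    set ei : E d := EuclideanSpace.single i 1
    set ek : E d := EuclideanSpace.single k 1
    -- Polarization: the three values of the form lie between 0 and `4 ν⁻¹`, `ν⁻¹`, `ν⁻¹`, whence
    -- the entry bound `2 ν⁻¹`.
    have hpol : q (ei + ek) - q ei - q ek = 2 * A x i k := by
      have e1 : q (ei + ek) - q ei - q ek =
          ∑ m, ∑ n, (A x m n * ei m * ek n + A x m n * ek m * ei n) := by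
        simp only [hq, ← Finset.sum_sub_distrib, PiLp.add_apply]
        exact Finset.sum_congr rfl fun m _ => Finset.sum_congr rfl fun n _ => by ring
      rw [e1]
      simp only [Finset.sum_add_distrib]
      have e2 : ∀ i k : Fin d, ∑ m, ∑ n, A x m n * (EuclideanSpace.single i (1 : ℝ) : E d) m *
          (EuclideanSpace.single k (1 : ℝ) : E d) n = A x i k := by
        intro i k
        simp [Finset.sum_ite_eq']
      rw [e2 i k, e2 k i, hA.symmetric x k i]
      ring
    have n1 : ‖ei‖ = 1 := by simp [ei]
    have n2 : ‖ek‖ = 1 := by simp [ek]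
    have n3 : ‖ei + ek‖ ^ 2 ≤ 4 := by
      have := norm_add_le ei ek
      rw [n1, n2] at this
      nlinarith [norm_nonneg (ei + ek)]
    have a1 := h1 ei
    have a2 := h1 ek
    have a3 := h1 (ei + ek)
    rw [n1] at a1
    rw [n2] at a2
    have a4 : ν⁻¹ * ‖ei + ek‖ ^ 2 ≤ ν⁻¹ * 4 := by gcongr
    have b1 := h0 ei
    have b2 := h0 ek
    have b3 := h0 (ei + ek)
    rw [abs_le]
    constructor <;> linarith
  symmetric := hA.symmetric
  lower := hA.elliptic_lower

theorem unitCell_eq_cell (d : ℕ) : unitCell d = cell 1 0 := by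
  ext x; simp [unitCell, cell]

theorem measurableSet_unitCell (d : ℕ) : MeasurableSet (unitCell d) := by
  rw [unitCell_eq_cell]; exact measurableSet_cell _ _

theorem volume_unitCell (d : ℕ) : volume (unitCell d) = 1 := by
  rw [unitCell_eq_cell, volume_cell one_pos]; simp

instance (d : ℕ) : IsFiniteMeasure (volume.restrict (unitCell d)) :=
  ⟨by rw [Measure.restrict_apply_univ, volume_unitCell]; exact ENNReal.one_lt_top⟩

/-- The `k`-th basis vector. -/
abbrev basisVec (k : Fin d) : E d := EuclideanSpace.single k 1

theorem basisVec_eq_latticeVec (k : Fin d) :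
    (basisVec k : E d) = latticeVec (Pi.single k 1) := by
  ext m
  by_cases h : m = k
  · subst h; simp [latticeVec]
  · simp [latticeVec, h]

theorem add_smul_basisVec_same (x : E d) (t : ℝ) (k : Fin d) : (x + t • basisVec k) k = x k + t := by
  simp

theorem add_smul_basisVec_ne (x : E d) (t : ℝ) {k m : Fin d} (h : m ≠ k) :
    (x + t • basisVec k) m = x m := by
  simp [h]

/-- Points of the cell close to a face are not in the inclusion. -/
theorem IsModelInclusion.exists_slab {ω : Set (E d)} (hω : IsModelInclusion ω) :
    ∃ r : ℝ, 0 < r ∧ r ≤ 1 ∧ ∀ x ∈ unitCell d, ∀ l, x l < r → x ∉ ω := by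
  obtain ⟨r, hr, h⟩ := hω.dist_pos
  refine ⟨min r 1, lt_min hr one_pos, min_le_right _ _, fun x hx l hxl hxω => ?_⟩
  -- The projection of `x` to the face `y l = 0`; it lies in the frontier at distance `x l` from
  -- `x`.
  set y : E d := x + (-x l) • basisVec l with hy
  have hyl : y l = 0 := by rw [hy, add_smul_basisVec_same]; ring
  have hyY : y ∈ unitCell d := by
    intro m
    by_cases hm : m = l
    · subst hm; rw [hyl]; exact ⟨le_rfl, one_pos⟩
    · rw [hy, add_smul_basisVec_ne _ _ hm]; exact hx m
  have hyf : y ∈ frontier (unitCell d) := by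
    refine ⟨subset_closure hyY, fun hint => ?_⟩
    have hc : Continuous fun t : ℝ => y + t • basisVec l := by fun_prop
    have h0 : ∀ᶠ t in 𝓝 (0 : ℝ), y + t • basisVec l ∈ interior (unitCell d) :=
      hc.continuousAt.eventually_mem (by simpa using isOpen_interior.mem_nhds hint)
    obtain ⟨t, ht, ht0⟩ := ((h0.filter_mono nhdsWithin_le_nhds).and
      (self_mem_nhdsWithin : Iio (0 : ℝ) ∈ 𝓝[<] 0)).exists
    have := (interior_subset ht l).1
    rw [add_smul_basisVec_same, hyl, zero_add] at this
    exact absurd this (not_le.mpr ht0)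
  have h1 := h x hxω y hyf
  have h2 : dist x y = |x l| := by
    rw [dist_eq_norm, hy]
    simp [norm_smul]
  rw [h2, abs_of_nonneg (hx l).1] at h1
  exact absurd (h1.trans_lt hxl) (not_lt.mpr (min_le_left _ _))

/-! ### Line averages of periodic gradients -/

/-- Integration over two adjacent cells. -/
theorem integral_two_cells {V : Type*} [NormedAddCommGroup V] [NormedSpace ℝ V] (k : Fin d)
    {f : E d → V} (hf : ∀ x, x ∉ unitCell d → x - basisVec k ∉ unitCell d → f x = 0)
    (h1 : IntegrableOn f (unitCell d))
    (h2 : IntegrableOn (fun x => f (x + basisVec k)) (unitCell d)) :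
    Integrable f ∧ ∫ x, f x = ∫ x in unitCell d, f x + f (x + basisVec k) := by
  have hY := measurableSet_unitCell d
  have hdec : f = fun x => (unitCell d).indicator f x +
      (unitCell d).indicator (fun x => f (x + basisVec k)) (x - basisVec k) := by
    funext x
    by_cases hx : x ∈ unitCell d
    · have : x - basisVec k ∉ unitCell d := fun h => by
        have e1 := (h k).1
        have e2 := (hx k).2
        simp at e1
        linarith
      rw [indicator_of_mem hx, indicator_of_notMem this, add_zero]
    · by_cases hx' : x - basisVec k ∈ unitCell d
      · rw [indicator_of_notMem hx, indicator_of_mem hx', sub_add_cancel, zero_add]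
      · rw [indicator_of_notMem hx, indicator_of_notMem hx', hf x hx hx', add_zero]
  have i1 : Integrable ((unitCell d).indicator f) := h1.integrable_indicator hY
  have i2' : Integrable ((unitCell d).indicator fun x => f (x + basisVec k)) :=
    h2.integrable_indicator hY
  have i2 : Integrable fun x =>
      (unitCell d).indicator (fun x => f (x + basisVec k)) (x - basisVec k) :=
    i2'.comp_sub_right _
  constructor
  · rw [hdec]; exact i1.add i2
  · conv_lhs => rw [hdec]
    rw [integral_add i1 i2, integral_sub_right_eq_self
      (fun x => (unitCell d).indicator (fun x => f (x + basisVec k)) x), integral_indicator hY,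
      integral_indicator hY, integral_add h1 h2]

theorem deriv_smoothTransition_of_nonpos {t : ℝ} (ht : t ≤ 0) : deriv Real.smoothTransition t = 0 := by
  refine IsLocalMin.deriv_eq_zero (Eventually.of_forall fun s => ?_)
  rw [Real.smoothTransition.zero_of_nonpos ht]
  exact Real.smoothTransition.nonneg s

theorem deriv_smoothTransition_of_one_le {t : ℝ} (ht : 1 ≤ t) :
    deriv Real.smoothTransition t = 0 := by
  refine IsLocalMax.deriv_eq_zero (Eventually.of_forall fun s => ?_)
  rw [Real.smoothTransition.one_of_one_le ht]
  exact Real.smoothTransition.le_one s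

theorem gradient_apply (φ : E d → ℝ) (x : E d) (k : Fin d) :
    gradient φ x k = fderiv ℝ φ x (basisVec k) := by
  have h : ⟪gradient φ x, basisVec k⟫ = fderiv ℝ φ x (basisVec k) :=
    InnerProductSpace.toDual_symm_apply
  rw [← h, EuclideanSpace.inner_single_right]; simp

/-- The derivative `∂ₖ` of a periodic function integrates to zero against functions on the cell
which do not depend on `xₖ`. -/
theorem IsPeriodicH1.integral_mul_grad_eq_zero {χ : E d → ℝ} {G : E d → E d}
    (h : IsPeriodicH1 χ G) (k : Fin d) {η : E d → ℝ} (hη : ContDiff ℝ (⊤ : ℕ∞) η)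
    (hinv : ∀ (x : E d) (t : ℝ), η (x + t • basisVec k) = η x) (hη0 : ∀ x, 0 ≤ η x)
    (hsupp : ∀ x, η x ≠ 0 → ∀ m, m ≠ k → 0 < x m ∧ x m < 1) :
    ∫ x in unitCell d, η x * G x k = 0 := by
  -- A bump supported in `[0, 2]` with `g t + g (t + 1) = 1` on `[0, 1]`. The compactly supported `Φ
  -- = g(x_k) η` lives on two adjacent cells and its two translates add up to `η` on the cell. This
  -- makes `weak_grad`, which tests on the whole space, usable on the torus.
  set g : ℝ → ℝ := fun t => Real.smoothTransition t - Real.smoothTransition (t - 1) with hg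
  set Φ : E d → ℝ := fun x => g (x k) * η x with hΦ
  have hgs : ContDiff ℝ (⊤ : ℕ∞) g := by
    refine Real.smoothTransition.contDiff.sub (Real.smoothTransition.contDiff.comp ?_)
    fun_prop
  have hpk : ContDiff ℝ (⊤ : ℕ∞) (fun x : E d => x k) := by fun_prop
  have hΦs : ContDiff ℝ (⊤ : ℕ∞) Φ := (hgs.comp hpk).mul hη
  have hg0 : ∀ t, 0 ≤ g t := fun t => sub_nonneg.mpr (Real.smoothTransition.monotone (by linarith))
  have hg1 : ∀ t, g t ≠ 0 → 0 < t ∧ t < 2 := by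
    intro t ht
    by_contra hcon
    apply ht
    rw [not_and_or, not_lt, not_lt] at hcon
    rcases hcon with h' | h'
    · simp only [hg]
      rw [Real.smoothTransition.zero_of_nonpos h', Real.smoothTransition.zero_of_nonpos (by linarith),
        sub_zero]
    · simp only [hg]
      rw [Real.smoothTransition.one_of_one_le (by linarith),
        Real.smoothTransition.one_of_one_le (by linarith), sub_self]
  have hΦ0 : ∀ x, 0 ≤ Φ x := fun x => mul_nonneg (hg0 _) (hη0 _)
  have hΦne : ∀ x, Φ x ≠ 0 → (0 < x k ∧ x k < 2) ∧ ∀ m, m ≠ k → 0 < x m ∧ x m < 1 := fun x hx =>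
    ⟨hg1 _ (left_ne_zero_of_mul hx), hsupp x (right_ne_zero_of_mul hx)⟩
  have hΦcell : ∀ x, x ∉ unitCell d → x - basisVec k ∉ unitCell d → Φ x = 0 := by
    intro x h1 h2
    by_contra hx
    obtain ⟨⟨a, b⟩, c⟩ := hΦne x hx
    by_cases hk : x k < 1
    · refine h1 fun m => ?_
      by_cases hm : m = k
      · subst hm; exact ⟨a.le, hk⟩
      · exact ⟨(c m hm).1.le, (c m hm).2⟩
    · refine h2 fun m => ?_
      by_cases hm : m = k
      · subst hm; simp; constructor <;> linarith
      · simp [hm]; exact ⟨(c m hm).1.le, (c m hm).2⟩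
  have hΦc : HasCompactSupport Φ := by
    refine HasCompactSupport.intro (isCompact_closedBall (0 : E d) (2 * d + 1)) fun x hx => ?_
    by_contra hne
    obtain ⟨⟨a, b⟩, c⟩ := hΦne x hne
    apply hx
    rw [mem_closedBall_zero_iff]
    refine abs_le_of_sq_le_sq' ?_ (by positivity) |>.2
    rw [EuclideanSpace.norm_sq_eq]
    have : ∑ m, ‖x m‖ ^ 2 ≤ ∑ m : Fin d, (4 : ℝ) := by
      refine Finset.sum_le_sum fun m _ => ?_
      rw [Real.norm_eq_abs, sq_abs]
      by_cases hm : m = k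
      · subst hm; nlinarith
      · have := c m hm; nlinarith
    refine this.trans ?_
    simp
    nlinarith [(Nat.cast_nonneg d : (0 : ℝ) ≤ d)]
  have hgrad0 : ∀ x, Φ x = 0 → gradient Φ x = 0 := by
    intro x hx
    have : fderiv ℝ Φ x = 0 := IsLocalMin.fderiv_eq_zero
      (Eventually.of_forall fun y => by rw [hx]; exact hΦ0 y)
    simp [gradient, this]
  have hgc : Continuous (gradient Φ) := continuous_gradient (hΦs.of_le (by simp))
  obtain ⟨M, hM⟩ := (hasCompactSupport_gradient hΦc).exists_bound_of_continuous hgc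
  obtain ⟨M', hM'⟩ := hΦc.exists_bound_of_continuous hΦs.continuous
  have hχi : Integrable χ (volume.restrict (unitCell d)) := h.memLp.integrable (by simp)
  have hGi : Integrable G (volume.restrict (unitCell d)) := h.memLp_grad.integrable (by simp)
  have hpχ : ∀ x, χ (x + basisVec k) = χ x := fun x => by
    rw [basisVec_eq_latticeVec]; exact h.periodic _ _
  have hpG : ∀ x, G (x + basisVec k) = G x := fun x => by
    rw [basisVec_eq_latticeVec]; exact h.periodic_grad _ _
  have hpη : ∀ x, η (x + basisVec k) = η x := fun x => by
    have := hinv x 1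
    rwa [one_smul] at this
  have hgck : Continuous fun x => gradient Φ (x + basisVec k) :=
    hgc.comp (by fun_prop)
  have hΦck : Continuous fun x => Φ (x + basisVec k) :=
    hΦs.continuous.comp (by fun_prop)
  obtain ⟨I1, E1⟩ := integral_two_cells k (f := fun x => χ x • gradient Φ x)
    (fun x h1 h2 => by rw [hgrad0 x (hΦcell x h1 h2), smul_zero])
    (hχi.smul_bdd M hgc.aestronglyMeasurable (Eventually.of_forall hM))
    (by
      simp only [hpχ]
      exact hχi.smul_bdd M hgck.aestronglyMeasurable (Eventually.of_forall fun x => hM _))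
  obtain ⟨I2, E2⟩ := integral_two_cells k (f := fun x => Φ x • G x)
    (fun x h1 h2 => by rw [hΦcell x h1 h2, zero_smul])
    (hGi.bdd_smul M' hΦs.continuous.aestronglyMeasurable (Eventually.of_forall hM'))
    (by
      simp only [hpG]
      exact hGi.bdd_smul M' hΦck.aestronglyMeasurable (Eventually.of_forall fun x => hM' _))
  have key := h.weak_grad Φ hΦs hΦc
  rw [E1, E2] at key
  have hsum : ∀ (x : E d) (t : ℝ), Φ (x + t • basisVec k) + Φ (x + basisVec k + t • basisVec k) =
      (Real.smoothTransition (x k + t + 1) - Real.smoothTransition (x k + t - 1)) * η x := by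
    intro x t
    simp only [hΦ, hg, add_smul_basisVec_same, hinv, hpη]
    simp only [PiLp.add_apply, PiLp.single_apply, if_true]
    rw [show x k + 1 + t - 1 = x k + t by ring, show x k + 1 + t = x k + t + 1 by ring]
    ring
  -- On the cell the folded sum of `Φ` is `η`, which is constant along `e_k`. So the term with `χ`
  -- drops out and only `∫ η G_k` remains. At the cell boundary this uses that the transition
  -- function has zero derivative outside `(0, 1)`.
  have hd1 : ∀ x ∈ unitCell d, gradient Φ x k + gradient Φ (x + basisVec k) k = 0 := by
    intro x hx
    have hline : ∀ x, HasDerivAt (fun t : ℝ => Φ (x + t • basisVec k)) (gradient Φ x k) 0 := by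
      intro x
      rw [gradient_apply]
      exact (hΦs.differentiable (by simp) x).hasFDerivAt.hasLineDerivAt _
    have h1 := (hline x).add (hline (x + basisVec k))
    have hs : Differentiable ℝ Real.smoothTransition :=
      (Real.smoothTransition.contDiff (n := 1)).differentiable (by simp)
    have h2 : ∀ b a : ℝ, deriv Real.smoothTransition (b + a) = 0 →
        HasDerivAt (fun t : ℝ => Real.smoothTransition (b + t + a)) 0 0 := by
      intro b a ha
      have e1 : HasDerivAt Real.smoothTransition 0 (b + 0 + a) := by
        have := (hs (b + a)).hasDerivAt
        rw [ha] at this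
        simpa using this
      have e2 : HasDerivAt (fun t : ℝ => b + t + a) 1 0 :=
        ((hasDerivAt_id (0 : ℝ)).const_add b).add_const a
      have e3 := e1.comp (0 : ℝ) e2
      rw [zero_mul] at e3
      exact e3
    have h3 := ((h2 (x k) 1 (deriv_smoothTransition_of_one_le (by linarith [(hx k).1]))).sub
      (h2 (x k) (-1) (deriv_smoothTransition_of_nonpos (by linarith [(hx k).2])))).mul_const (η x)
    have h4 : HasDerivAt (fun t : ℝ => Φ (x + t • basisVec k) + Φ (x + basisVec k + t • basisVec k))
        0 0 := by
      have e : (fun t : ℝ => Φ (x + t • basisVec k) + Φ (x + basisVec k + t • basisVec k)) =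
          fun t => (Real.smoothTransition (x k + t + 1) -
            Real.smoothTransition (x k + t + -1)) * η x := funext fun t => hsum x t
      rw [e]
      simpa using h3
    exact h1.unique h4
  have hd2 : ∀ x ∈ unitCell d, Φ x + Φ (x + basisVec k) = η x := by
    intro x hx
    have := hsum x 0
    simp only [zero_smul, add_zero] at this
    rw [this, Real.smoothTransition.one_of_one_le (by linarith [(hx k).1]),
      Real.smoothTransition.zero_of_nonpos (by linarith [(hx k).2])]
    ring
  have hY := measurableSet_unitCell d
  have J1 : Integrable (fun x => χ x • gradient Φ x + χ (x + basisVec k) •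
      gradient Φ (x + basisVec k)) (volume.restrict (unitCell d)) := by
    simp only [hpχ]
    exact (hχi.smul_bdd M hgc.aestronglyMeasurable (Eventually.of_forall hM)).add
      (hχi.smul_bdd M hgck.aestronglyMeasurable (Eventually.of_forall fun x => hM _))
  have J2 : Integrable (fun x => Φ x • G x + Φ (x + basisVec k) • G (x + basisVec k))
      (volume.restrict (unitCell d)) := by
    simp only [hpG]
    exact (hGi.bdd_smul M' hΦs.continuous.aestronglyMeasurable (Eventually.of_forall hM')).add
      (hGi.bdd_smul M' hΦck.aestronglyMeasurable (Eventually.of_forall fun x => hM' _))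
  have key2 := congrArg (EuclideanSpace.proj k : E d →L[ℝ] ℝ) key
  rw [map_neg, ← ContinuousLinearMap.integral_comp_comm _ J1,
    ← ContinuousLinearMap.integral_comp_comm _ J2] at key2
  have L0 : ∫ x in unitCell d, (EuclideanSpace.proj k : E d →L[ℝ] ℝ)
      (χ x • gradient Φ x + χ (x + basisVec k) • gradient Φ (x + basisVec k)) = 0 := by
    refine setIntegral_eq_zero_of_forall_eq_zero fun x hx => ?_
    have := hd1 x hx
    simp only [hpχ, ← smul_add, map_smul, PiLp.proj_apply, PiLp.add_apply, this, smul_zero]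
  have R0 : ∫ x in unitCell d, (EuclideanSpace.proj k : E d →L[ℝ] ℝ)
      (Φ x • G x + Φ (x + basisVec k) • G (x + basisVec k)) =
      ∫ x in unitCell d, η x * G x k := by
    refine setIntegral_congr_fun hY fun x hx => ?_
    simp only [hpG, ← add_smul, hd2 x hx, map_smul, PiLp.proj_apply, smul_eq_mul]
  rw [L0, R0] at key2
  linarith

theorem IsModelInclusion.nonempty {ω : Set (E d)} (hω : IsModelInclusion ω) : ω.Nonempty := by
  have := hω.simplyConnected
  have : Nonempty ω := inferInstance
  exact nonempty_coe_sort.mp this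

theorem isBounded_unitCell (d : ℕ) : Bornology.IsBounded (unitCell d) := by
  refine (Metric.isBounded_closedBall (x := (0 : E d)) (r := d + 1)).subset fun x hx => ?_
  rw [mem_closedBall_zero_iff]
  refine abs_le_of_sq_le_sq' ?_ (by positivity) |>.2
  rw [EuclideanSpace.norm_sq_eq]
  have : ∑ m, ‖x m‖ ^ 2 ≤ ∑ m : Fin d, (1 : ℝ) := by
    refine Finset.sum_le_sum fun m _ => ?_
    rw [Real.norm_eq_abs, sq_abs]
    have := hx m
    nlinarith
  refine this.trans ?_
  simp
  nlinarith [(Nat.cast_nonneg d : (0 : ℝ) ≤ d)]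

theorem IsModelInclusion.isBounded {ω : Set (E d)} (hω : IsModelInclusion ω) :
    Bornology.IsBounded ω := (isBounded_unitCell d).subset hω.subset_cell

/-- A connected boundary rules out dimensions zero and one. -/
theorem IsModelInclusion.two_le {ω : Set (E d)} (hω : IsModelInclusion ω) : 2 ≤ d := by
  obtain ⟨p, hp⟩ := hω.nonempty
  by_contra hd
  have hd' : d = 0 ∨ d = 1 := by omega
  rcases hd' with rfl | rfl
  · obtain ⟨x, hx⟩ := hω.connected_boundary.nonempty
    have : x = p := Subsingleton.elim _ _
    rw [this, hω.isOpen.frontier_eq] at hx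
    exact hx.2 hp
  · set L : E 1 → ℝ := fun x => x 0
    have hL : Continuous L := by fun_prop
    have hLe : ∀ x y, L x = L y → x = y := by
      intro x y h
      ext i
      rw [Subsingleton.elim i 0]
      exact h
    have hK : IsCompact (closure ω) := hω.isBounded.isCompact_closure
    obtain ⟨a, ha, hamin⟩ := hK.exists_isMinOn ⟨p, subset_closure hp⟩ hL.continuousOn
    obtain ⟨b, hb, hbmax⟩ := hK.exists_isMaxOn ⟨p, subset_closure hp⟩ hL.continuousOn
    have hlt : ∀ x ∈ ω, L a < L x ∧ L x < L b := by
      intro x hx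
      have hc : Continuous fun t : ℝ => x + t • basisVec (0 : Fin 1) := by fun_prop
      have h0 : ∀ᶠ t in 𝓝 (0 : ℝ), x + t • basisVec (0 : Fin 1) ∈ ω :=
        hc.continuousAt.eventually_mem (by simpa using hω.isOpen.mem_nhds hx)
      have hv : ∀ t : ℝ, L (x + t • basisVec (0 : Fin 1)) = L x + t := fun t =>
        add_smul_basisVec_same x t 0
      constructor
      · obtain ⟨t, ht, ht0⟩ := ((h0.filter_mono nhdsWithin_le_nhds).and
          (self_mem_nhdsWithin : Iio (0 : ℝ) ∈ 𝓝[<] 0)).exists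
        have := hamin (subset_closure ht)
        simp only [mem_ofPred_eq, hv] at this
        have ht0' : t < 0 := ht0
        linarith
      · obtain ⟨t, ht, ht0⟩ := ((h0.filter_mono nhdsWithin_le_nhds).and
          (self_mem_nhdsWithin : Ioi (0 : ℝ) ∈ 𝓝[>] 0)).exists
        have := hbmax (subset_closure ht)
        simp only [mem_ofPred_eq, hv] at this
        have ht0' : 0 < t := ht0
        linarith
    have hfa : a ∈ frontier ω := by
      rw [hω.isOpen.frontier_eq]
      exact ⟨ha, fun h => lt_irrefl _ (hlt a h).1⟩
    have hfb : b ∈ frontier ω := by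
      rw [hω.isOpen.frontier_eq]
      exact ⟨hb, fun h => lt_irrefl _ (hlt b h).2⟩
    -- On the line the two extreme points of the closure belong to the boundary. If the boundary is
    -- connected it contains every point between them, in particular the interior point `p`.
    have hpre := hω.connected_boundary.isPreconnected.image L hL.continuousOn
    obtain ⟨x, hx, hxp⟩ := hpre.ordConnected.out (mem_image_of_mem _ hfa) (mem_image_of_mem _ hfb)
      ⟨(hlt p hp).1.le, (hlt p hp).2.le⟩
    rw [hLe x p hxp, hω.isOpen.frontier_eq] at hx
    exact hx.2 hp

/-- A smooth weight on the cell, supported off the inclusion and independent of `xₖ`. -/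
theorem IsModelInclusion.exists_weight {ω : Set (E d)} (hω : IsModelInclusion ω) (k : Fin d) :
    ∃ η : E d → ℝ, ContDiff ℝ (⊤ : ℕ∞) η ∧ (∀ (x : E d) (t : ℝ), η (x + t • basisVec k) = η x) ∧
      (∀ x, 0 ≤ η x) ∧ (∀ x, η x ≤ 1) ∧ (∀ x, η x ≠ 0 → ∀ m, m ≠ k → 0 < x m ∧ x m < 1) ∧
      (∀ x ∈ unitCell d, x ∈ ω → η x = 0) ∧ 0 < ∫ x in unitCell d, η x := by
  obtain ⟨r, hr, hr1, h⟩ := hω.exists_slab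
  have hd := hω.two_le
  have : Nontrivial (Fin d) := Fin.nontrivial_iff_two_le.mpr hd
  obtain ⟨l, hl⟩ := exists_ne k
  -- The coordinate `l` of the centre sits in the middle of the layer `x l < r` free of `ω`, and the
  -- bump has outer radius `r / 4`, so it stays inside. Replacing `x k` by `1 / 2` in `P` removes
  -- the dependence on `x k`; this needs a direction `l ≠ k`, hence `d ≥ 2`.
  set p : E d := WithLp.toLp 2 (fun m => if m = l then r / 2 else 1 / 2) with hp
  have hpl : p l = r / 2 := by simp [hp]
  have hpm : ∀ m, m ≠ l → p m = 1 / 2 := fun m hm => by simp [hp, hm]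
  let B : ContDiffBump p := ⟨r / 8, r / 4, by positivity, by linarith⟩
  set P : E d → E d := fun x => x + (1 / 2 - x k) • basisVec k with hP
  have hPs : ContDiff ℝ (⊤ : ℕ∞) P := by
    rw [hP]
    fun_prop
  have hne : ∀ x, B (P x) ≠ 0 → ∀ m, m ≠ k → |x m - p m| < r / 4 := by
    intro x hx m hm
    have h1 : P x ∈ Metric.ball p (r / 4) := by
      have : P x ∈ Function.support B := hx
      rwa [B.support_eq] at this
    rw [Metric.mem_ball, dist_eq_norm] at h1
    have h2 := PiLp.norm_apply_le (P x - p) m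
    rw [PiLp.sub_apply, hP, add_smul_basisVec_ne _ _ hm, Real.norm_eq_abs] at h2
    exact h2.trans_lt h1
  have hcoord : ∀ x, B (P x) ≠ 0 → ∀ m, m ≠ k → 0 < x m ∧ x m < 1 := by
    intro x hx m hm
    have h1 := abs_lt.mp (hne x hx m hm)
    by_cases hml : m = l
    · subst hml; rw [hpl] at h1; constructor <;> linarith
    · rw [hpm m hml] at h1; constructor <;> linarith
  have hc : Continuous fun x => B (P x) := B.continuous.comp hPs.continuous
  refine ⟨fun x => B (P x), B.contDiff.comp hPs, fun x t => ?_, fun x => B.nonneg,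
    fun x => B.le_one, hcoord, fun x hxY hxω => ?_, ?_⟩
  · simp only [hP]
    rw [add_smul_basisVec_same]
    congr 1
    module
  · by_contra hx
    have h1 := abs_lt.mp (hne x hx l hl)
    rw [hpl] at h1
    exact h x hxY l (by linarith) hxω
  · have hY := measurableSet_unitCell d
    have hint : IntegrableOn (fun x => B (P x)) (unitCell d) :=
      Integrable.of_bound hc.aestronglyMeasurable 1 (Eventually.of_forall fun x => by
        rw [Real.norm_eq_abs, abs_of_nonneg B.nonneg]; exact B.le_one)
    rw [setIntegral_pos_iff_support_of_nonneg_ae (Eventually.of_forall fun x => B.nonneg) hint]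
    have hU : IsOpen ({x | B (P x) ≠ 0} ∩ ⋂ m : Fin d, {x : E d | 0 < x m ∧ x m < 1}) := by
      refine (isOpen_ne_fun hc continuous_const).inter (isOpen_iInter_of_finite fun m => ?_)
      have hm : Continuous fun x : E d => x m := by fun_prop
      exact (isOpen_lt continuous_const hm).inter (isOpen_lt hm continuous_const)
    have hpos := hU.measure_pos volume ⟨p, by
      have : P p = p := by simp [hP, hpm k hl.symm]
      simp only [mem_ofPred_eq, this]
      rw [B.one_of_mem_closedBall (Metric.mem_closedBall_self B.rIn_pos.le)]
      exact one_ne_zero, by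
      refine mem_iInter.mpr fun m => ?_
      by_cases hm : m = l
      · subst hm; simp only [mem_ofPred_eq, hpl]; constructor <;> linarith
      · simp only [mem_ofPred_eq, hpm m hm]; norm_num⟩
    refine hpos.trans_le (measure_mono ?_)
    rintro x ⟨h1, h2⟩
    exact ⟨h1, fun m => ⟨(mem_iInter.mp h2 m).1.le, (mem_iInter.mp h2 m).2⟩⟩

theorem memLp_coord {μ : Measure (E d)} {F : E d → E d} (hF : MemLp F 2 μ) (k : Fin d) :
    MemLp (fun x => F x k) 2 μ := by
  refine hF.mono ((EuclideanSpace.proj k : E d →L[ℝ] ℝ).continuous.comp_aestronglyMeasurable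
    hF.aestronglyMeasurable) (Eventually.of_forall fun x => PiLp.norm_apply_le _ k)

/-- A periodic gradient field shifted by a constant vector has nontrivial energy off the
inclusion. -/
theorem IsModelInclusion.exists_energy_lower_bound {ω : Set (E d)} (hω : IsModelInclusion ω) :
    ∃ c : ℝ, 0 < c ∧ ∀ (χ : Fin d → E d → ℝ) (G : Fin d → E d → E d),
      (∀ j, IsPeriodicH1 (χ j) (G j)) → ∀ ξ : E d,
        c * ‖ξ‖ ^ 2 ≤ ∫ y in unitCell d \ ω, ‖∑ j, ξ j • (G j y + basisVec j)‖ ^ 2 := by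
  choose η hs hinv h0 h1 hsupp hω0 hpos using hω.exists_weight
  have hd := hω.two_le
  have : Nonempty (Fin d) := ⟨⟨0, by omega⟩⟩
  -- The constant is the square of the smallest weight mass, so it depends on `ω` only.
  obtain ⟨k0, hk0⟩ := Finite.exists_min fun k => ∫ x in unitCell d, η k x
  refine ⟨(∫ x in unitCell d, η k0 x) ^ 2, pow_pos (hpos k0) 2, fun χ G hG ξ => ?_⟩
  set V : E d → E d := fun y => ∑ j, ξ j • (G j y + basisVec j) with hV
  set μ : Measure (E d) := volume.restrict (unitCell d) with hμ
  set μ' : Measure (E d) := volume.restrict (unitCell d \ ω) with hμ'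
  have hY := measurableSet_unitCell d
  have hYω : MeasurableSet (unitCell d \ ω) := hY.diff hω.isOpen.measurableSet
  have hVL : MemLp V 2 μ := memLp_finsetSum _ fun j _ =>
    ((hG j).memLp_grad.add (memLp_const _)).const_smul (ξ j)
  have hVL' : MemLp V 2 μ' := hVL.mono_measure (Measure.restrict_mono sdiff_subset le_rfl)
  have hfin : IsFiniteMeasure μ' := isFiniteMeasure_of_le μ (Measure.restrict_mono sdiff_subset le_rfl)
  have hηi : ∀ k, Integrable (η k) μ := fun k =>
    Integrable.of_bound (hs k).continuous.aestronglyMeasurable 1 (Eventually.of_forall fun x => by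
      rw [Real.norm_eq_abs, abs_of_nonneg (h0 k x)]; exact h1 k x)
  have hηb : ∀ k, ∀ x, ‖η k x‖ ≤ 1 := fun k x => by
      rw [Real.norm_eq_abs, abs_of_nonneg (h0 k x)]; exact h1 k x
  have hk : ∀ k, (ξ k * ∫ x in unitCell d, η k x) ^ 2 ≤ ∫ y in unitCell d \ ω, V y k ^ 2 := by
    intro k
    have hGi : ∀ j, Integrable (fun x => G j x k) μ := fun j =>
      (memLp_coord (hG j).memLp_grad k).integrable (by simp)
    have hprod : ∀ j, Integrable (fun x => η k x * G j x k) μ := fun j =>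
      (hGi j).bdd_mul (hs k).continuous.aestronglyMeasurable (Eventually.of_forall (hηb k))
    -- Against the weight `η k` the gradient part of `V` in direction `k` integrates to zero, so
    -- only the constant vector `ξ` survives. As `η k` vanishes on `ω`, Cauchy–Schwarz then bounds
    -- `ξ k` by the energy in the matrix phase.
    have e1 : ξ k * ∫ x in unitCell d, η k x = ∫ x in unitCell d, η k x * V x k := by
      have : ∀ x, η k x * V x k = ∑ j, ξ j * (η k x * G j x k) + ξ k * η k x := by
        intro x
        have : V x k = ∑ j, ξ j * G j x k + ξ k := by
          simp only [hV, WithLp.ofLp_sum, WithLp.ofLp_smul, WithLp.ofLp_add, Finset.sum_apply,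
            Pi.smul_apply, Pi.add_apply, smul_eq_mul, mul_add, Finset.sum_add_distrib]
          congr 1
          rw [Finset.sum_eq_single k (fun j _ hj => by simp [hj.symm]) (by simp)]
          simp
        rw [this, mul_add, Finset.mul_sum]
        congr 1
        · exact Finset.sum_congr rfl fun j _ => by ring
        · ring
      simp only [this]
      rw [integral_add (integrable_finsetSum _ fun j _ => (hprod j).const_mul _)
        ((hηi k).const_mul _), integral_finsetSum _ fun j _ => (hprod j).const_mul _]
      simp only [integral_const_mul]
      rw [Finset.sum_eq_zero fun j _ => by
        rw [(hG j).integral_mul_grad_eq_zero k (hs k) (hinv k) (h0 k) (hsupp k), mul_zero], zero_add]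
    have e2 : ∫ x in unitCell d, η k x * V x k = ∫ x in unitCell d \ ω, η k x * V x k := by
      refine (setIntegral_eq_of_subset_of_forall_sdiff_eq_zero hY sdiff_subset fun x hx => ?_)
      have : x ∈ ω := by
        by_contra h
        exact hx.2 ⟨hx.1, h⟩
      rw [hω0 k x hx.1 this, zero_mul]
    have hVk : MemLp (fun x => V x k) 2 μ' := memLp_coord hVL' k
    have hηV : MemLp (fun x => η k x * V x k) 2 μ' := by
      refine hVk.mono ((hs k).continuous.aestronglyMeasurable.mul hVk.aestronglyMeasurable)
        (Eventually.of_forall fun x => ?_)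
      rw [norm_mul]
      exact mul_le_of_le_one_left (norm_nonneg _) (hηb k x)
    rw [e1, e2]
    refine (sq_integral_le (hηV.integrable (by simp)) hηV.integrable_sq).trans ?_
    have hm : μ'.real univ ≤ 1 := by
      rw [measureReal_def, hμ', Measure.restrict_apply_univ]
      refine ENNReal.toReal_le_of_le_ofReal zero_le_one ?_
      rw [ENNReal.ofReal_one, ← volume_unitCell d]
      exact measure_mono sdiff_subset
    have hle : ∫ x, (η k x * V x k) ^ 2 ∂μ' ≤ ∫ x, V x k ^ 2 ∂μ' := by
      refine integral_mono hηV.integrable_sq hVk.integrable_sq fun x => ?_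
      simp only [mul_pow]
      exact mul_le_of_le_one_left (sq_nonneg _) (pow_le_one₀ (h0 k x) (h1 k x))
    calc _ ≤ 1 * ∫ x, (η k x * V x k) ^ 2 ∂μ' :=
          mul_le_mul_of_nonneg_right hm (integral_nonneg fun x => sq_nonneg _)
      _ ≤ _ := by rw [one_mul]; exact hle
  have e3 : ∫ y in unitCell d \ ω, ‖V y‖ ^ 2 = ∑ k, ∫ y in unitCell d \ ω, V y k ^ 2 := by
    rw [← integral_finsetSum _ fun k _ => (memLp_coord hVL' k).integrable_sq]
    refine integral_congr_ae (Eventually.of_forall fun y => ?_)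
    simp only [EuclideanSpace.norm_sq_eq, Real.norm_eq_abs, sq_abs]
  rw [e3, EuclideanSpace.norm_sq_eq, Finset.mul_sum]
  refine Finset.sum_le_sum fun k _ => le_trans ?_ (hk k)
  rw [mul_pow, mul_comm, Real.norm_eq_abs, sq_abs]
  exact mul_le_mul_of_nonneg_left (pow_le_pow_left₀ (hpos k0).le (hk0 k) 2) (sq_nonneg _)

/-! ### The homogenized matrix as an energy -/

/-- The Dirichlet form of the periodic medium. -/
def cellForm (ω : Set (E d)) (A : E d → Matrix (Fin d) (Fin d) ℝ) (δ : ℝ) (F H : E d → E d) : ℝ :=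
  ∫ y in unitCell d, contrast ω δ y * ∑ i, ∑ k, A y i k * F y k * H y i

theorem integrable_cellForm {ω : Set (E d)} (hω : MeasurableSet ω)
    {A : E d → Matrix (Fin d) (Fin d) ℝ} {c M : ℝ} (hA : IsElliptic c M A) (δ : ℝ)
    {F H : E d → E d} (hF : MemLp F 2 (volume.restrict (unitCell d)))
    (hH : MemLp H 2 (volume.restrict (unitCell d))) :
    Integrable (fun y => contrast ω δ y * ∑ i, ∑ k, A y i k * F y k * H y i)
      (volume.restrict (unitCell d)) := by
  have hcm : Measurable (contrast ω δ) := by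
    unfold contrast
    exact Measurable.ite hω measurable_const measurable_const
  have hcb : ∀ y, ‖contrast ω δ y‖ ≤ max |δ| 1 := by
    intro y
    unfold contrast
    split_ifs
    · exact le_max_left _ _
    · simp
  refine Integrable.bdd_mul ?_ hcm.aestronglyMeasurable (Eventually.of_forall hcb)
  refine integrable_finsetSum _ fun i _ => integrable_finsetSum _ fun k _ => ?_
  have : Integrable (fun y => F y k * H y i) (volume.restrict (unitCell d)) :=
    (memLp_coord hF k).integrable_mul (memLp_coord hH i)
  simp only [mul_assoc]
  exact this.bdd_mul (hA.measurable i k).aestronglyMeasurable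
    (Eventually.of_forall fun y => hA.bounded y i k)

theorem cellForm_comm (ω : Set (E d)) {A : E d → Matrix (Fin d) (Fin d) ℝ} {c M : ℝ}
    (hA : IsElliptic c M A) (δ : ℝ) (F H : E d → E d) :
    cellForm ω A δ F H = cellForm ω A δ H F := by
  unfold cellForm
  congr 1
  funext y
  congr 1
  rw [Finset.sum_comm]
  refine Finset.sum_congr rfl fun i _ => Finset.sum_congr rfl fun k _ => ?_
  rw [hA.symmetric y k i]
  ring

theorem cellForm_sum {ω : Set (E d)} (hω : MeasurableSet ω)
    {A : E d → Matrix (Fin d) (Fin d) ℝ} {c M : ℝ} (hA : IsElliptic c M A) (δ : ℝ)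
    {V : Fin d → E d → E d} (hV : ∀ j, MemLp (V j) 2 (volume.restrict (unitCell d))) (ξ : E d) :
    cellForm ω A δ (fun y => ∑ j, ξ j • V j y) (fun y => ∑ j, ξ j • V j y) =
      ∑ m, ∑ j, cellForm ω A δ (V j) (V m) * ξ m * ξ j := by
  have hi := fun m j => integrable_cellForm hω hA δ (hV j) (hV m)
  unfold cellForm
  have : ∀ m j, (∫ y in unitCell d, contrast ω δ y * ∑ i, ∑ k, A y i k * V j y k * V m y i) *
      ξ m * ξ j = ∫ y in unitCell d, (contrast ω δ y * ∑ i, ∑ k, A y i k * V j y k * V m y i) *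
      (ξ m * ξ j) := fun m j => by rw [integral_mul_const, mul_assoc]
  simp only [this]
  have hs : ∀ m, ∑ j, ∫ y in unitCell d,
      (contrast ω δ y * ∑ i, ∑ k, A y i k * V j y k * V m y i) * (ξ m * ξ j) =
      ∫ y in unitCell d, ∑ j,
        (contrast ω δ y * ∑ i, ∑ k, A y i k * V j y k * V m y i) * (ξ m * ξ j) := fun m =>
    (integral_finsetSum _ fun j _ => (hi m j).mul_const _).symm
  simp only [hs]
  rw [← integral_finsetSum _ fun m _ => integrable_finsetSum _ fun j _ => (hi m j).mul_const _]
  congr 1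
  funext y
  simp only [WithLp.ofLp_sum, WithLp.ofLp_smul, Finset.sum_apply, Pi.smul_apply, smul_eq_mul,
    Finset.mul_sum, Finset.sum_mul]
  set t : Fin d → Fin d → Fin d → Fin d → ℝ := fun i k m j =>
    contrast ω δ y * (A y i k * V j y k * V m y i) * (ξ m * ξ j) with ht
  calc _ = ∑ i, ∑ k, ∑ m, ∑ j, t i k m j := by
        refine Finset.sum_congr rfl fun i _ => Finset.sum_congr rfl fun k _ =>
          Finset.sum_congr rfl fun m _ => Finset.sum_congr rfl fun j _ => ?_
        simp only [ht]; ring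
    _ = ∑ m, ∑ i, ∑ k, ∑ j, t i k m j := by
        exact (Finset.sum_congr rfl fun i _ => Finset.sum_comm).trans Finset.sum_comm
    _ = ∑ m, ∑ j, ∑ i, ∑ k, t i k m j := by
        refine Finset.sum_congr rfl fun m _ => ?_
        exact (Finset.sum_congr rfl fun i _ => Finset.sum_comm).trans Finset.sum_comm

/-- The homogenized matrix is the matrix of the Dirichlet form on corrected coordinates. -/
theorem homogenizedMatrix_eq_cellForm {ω : Set (E d)} (hω : MeasurableSet ω)
    {A : E d → Matrix (Fin d) (Fin d) ℝ} {c M : ℝ} (hA : IsElliptic c M A) {δ : ℝ}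
    {χ : Fin d → E d → ℝ} {G : Fin d → E d → E d}
    (hG : ∀ k, IsCorrector ω A δ k (χ k) (G k)) (m j : Fin d) :
    homogenizedMatrix ω A δ G m j =
      cellForm ω A δ (fun y => G j y + basisVec j) (fun y => G m y + basisVec m) := by
  have hL : ∀ j, MemLp (G j) 2 (volume.restrict (unitCell d)) := fun j => (hG j).memH1.memLp_grad
  have hV : MemLp (fun y => G j y + basisVec j) 2 (volume.restrict (unitCell d)) :=
    (hL j).add (memLp_const _)
  have i1 := integrable_cellForm hω hA δ hV (hL m)
  have i2 := integrable_cellForm hω hA δ hV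
    (memLp_const (basisVec m) : MemLp (fun _ : E d => (basisVec m : E d)) 2 _)
  have hw := (hG j).weak_eq (χ m) (G m) (hG m).memH1
  have hb : ∀ k, (basisVec j : E d) k = if k = j then 1 else 0 := fun k => by
    simp [basisVec]
  have e1 : homogenizedMatrix ω A δ G m j =
      cellForm ω A δ (fun y => G j y + basisVec j) (fun _ => basisVec m) := by
    unfold homogenizedMatrix cellForm
    congr 1
    funext y
    congr 1
    symm
    rw [Finset.sum_eq_single m]
    · simp only [PiLp.add_apply, hb, mul_add]
      simp [Finset.sum_add_distrib, add_comm]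
    · intro i _ hi
      simp [hi]
    · simp
  -- The `j`-th cell problem tested with `χ_m`. Adding this zero makes the formula for `â` symmetric
  -- in the two indices.
  have e2 : cellForm ω A δ (fun y => G j y + basisVec j) (G m) = 0 := by
    rw [← hw]
    unfold cellForm
    simp only [PiLp.add_apply, hb]
  rw [e1, ← zero_add (cellForm ω A δ (fun y => G j y + basisVec j) fun _ => basisVec m), ← e2]
  unfold cellForm
  rw [← integral_add i1 i2]
  congr 1
  funext y
  simp only [PiLp.add_apply, mul_add, Finset.sum_add_distrib]

/-- The homogenized matrix is elliptic, uniformly in the contrast. -/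
theorem IsModelInclusion.exists_isElliptic_homogenizedMatrix {ω : Set (E d)}
    (hω : IsModelInclusion ω) {ν : ℝ} (hν : 0 < ν) :
    ∃ c : ℝ, 0 < c ∧ ∀ (A : E d → Matrix (Fin d) (Fin d) ℝ), IsCoefficient ν A →
      ∀ δ : ℝ, 0 < δ → ∀ (χ : Fin d → E d → ℝ) (G : Fin d → E d → E d),
        (∀ k, IsCorrector ω A δ k (χ k) (G k)) →
          ∃ M, IsElliptic c M (fun _ : E d => homogenizedMatrix ω A δ G) := by
  obtain ⟨c, hc, h⟩ := hω.exists_energy_lower_bound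
  refine ⟨ν * c, mul_pos hν hc, fun A hA δ hδ χ G hG => ?_⟩
  have hAe := hA.isElliptic hν
  have hωm := hω.isOpen.measurableSet
  have hL : ∀ j, MemLp (fun y => G j y + basisVec j) 2 (volume.restrict (unitCell d)) := fun j =>
    (hG j).memH1.memLp_grad.add (memLp_const _)
  have hm := homogenizedMatrix_eq_cellForm hωm hAe hG
  refine ⟨∑ i, ∑ k, |homogenizedMatrix ω A δ G i k|, fun i k => measurable_const, fun _ i k => ?_,
    fun _ i k => ?_, fun _ ξ => ?_⟩
  · exact (Finset.single_le_sum (f := fun k => |homogenizedMatrix ω A δ G i k|)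
      (fun _ _ => abs_nonneg _) (Finset.mem_univ k)).trans (Finset.single_le_sum
      (f := fun i => ∑ k, |homogenizedMatrix ω A δ G i k|)
      (fun _ _ => Finset.sum_nonneg fun _ _ => abs_nonneg _) (Finset.mem_univ i))
  · rw [hm, hm, cellForm_comm ω hAe]
  · simp only [hm]
    rw [← cellForm_sum hωm hAe δ hL ξ]
    set V : E d → E d := fun y => ∑ j, ξ j • (G j y + basisVec j) with hV
    have hVL : MemLp V 2 (volume.restrict (unitCell d)) :=
      memLp_finsetSum _ fun j _ => (hL j).const_smul (ξ j)
    have hi := integrable_cellForm hωm hAe δ hVL hVL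
    have hYω : MeasurableSet (unitCell d \ ω) := (measurableSet_unitCell d).diff hωm
    have hV2 : IntegrableOn (fun y => ‖V y‖ ^ 2) (unitCell d \ ω) :=
      (hVL.mono_measure (Measure.restrict_mono sdiff_subset le_rfl)).integrable_norm_pow (by simp)
    have hcpos : ∀ y, 0 ≤ contrast ω δ y := fun y => by
      unfold contrast
      split_ifs
      exacts [hδ.le, zero_le_one]
    calc _ = ν * (c * ‖ξ‖ ^ 2) := by ring
      _ ≤ ν * ∫ y in unitCell d \ ω, ‖V y‖ ^ 2 :=
        mul_le_mul_of_nonneg_left (h χ G (fun j => (hG j).memH1) ξ) hν.le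
      _ = ∫ y in unitCell d \ ω, ν * ‖V y‖ ^ 2 := by rw [integral_const_mul]
      _ ≤ ∫ y in unitCell d \ ω, contrast ω δ y * ∑ i, ∑ k, A y i k * V y k * V y i := by
        refine setIntegral_mono_on (hV2.const_mul ν) (hi.mono_measure
          (Measure.restrict_mono sdiff_subset le_rfl)) hYω fun y hy => ?_
        have : contrast ω δ y = 1 := by
          unfold contrast
          rw [if_neg hy.2]
        rw [this, one_mul]
        refine (hA.elliptic_lower y (V y)).trans_eq (Finset.sum_congr rfl fun i _ =>
          Finset.sum_congr rfl fun k _ => by ring)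
      _ ≤ cellForm ω A δ V V := by
        refine setIntegral_mono_set hi (Eventually.of_forall fun y => ?_)
          (Eventually.of_forall fun y hy => hy.1)
        refine mul_nonneg (hcpos y) (le_trans (by positivity) ((hA.elliptic_lower y (V y)).trans_eq
          (Finset.sum_congr rfl fun i _ => Finset.sum_congr rfl fun k _ => by ring)))

/-- The complement of the inclusion in the cell has positive volume. -/
theorem IsModelInclusion.volume_real_pos {ω : Set (E d)} (hω : IsModelInclusion ω) :
    0 < volume.real (unitCell d \ ω) := by
  have hd := hω.two_le
  obtain ⟨η, hs, -, -, -, -, h0, hpos⟩ := hω.exists_weight ⟨0, by omega⟩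
  by_contra hcon
  have hz : volume.real (unitCell d \ ω) = 0 := le_antisymm (not_lt.mp hcon) measureReal_nonneg
  have hz' : volume (unitCell d \ ω) = 0 := by
    refine (measureReal_eq_zero_iff ?_).mp hz
    exact ne_top_of_le_ne_top (by rw [volume_unitCell]; simp) (measure_mono sdiff_subset)
  rw [setIntegral_eq_of_subset_of_forall_sdiff_eq_zero (measurableSet_unitCell d)
    (sdiff_subset : unitCell d \ ω ⊆ unitCell d) (fun x hx => h0 x hx.1 (by
      by_contra h
      exact hx.2 ⟨hx.1, h⟩)), Measure.restrict_eq_zero.mpr hz', integral_zero_measure] at hpos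
  exact lt_irrefl _ hpos

/-! ### Zhikov's function of the inclusion -/

section Inclusion

/-- The constant function one in `L²`. -/
def oneLp {α : Type} [MeasurableSpace α] (μ : Measure α) [IsFiniteMeasure μ] : Lp ℝ 2 μ :=
  (memLp_const (1 : ℝ)).toLp (fun _ => (1 : ℝ))

theorem coeFn_oneLp {α : Type} [MeasurableSpace α] (μ : Measure α) [IsFiniteMeasure μ] :
    oneLp μ =ᵐ[μ] fun _ => (1 : ℝ) := MemLp.coeFn_toLp _

theorem inner_oneLp {α : Type} [MeasurableSpace α] (μ : Measure α) [IsFiniteMeasure μ]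
    (f : Lp ℝ 2 μ) : ⟪oneLp μ, f⟫ = ∫ x, f x ∂μ := by
  rw [L2.inner_def]
  refine integral_congr_ae ?_
  filter_upwards [coeFn_oneLp μ] with x hx
  rw [hx]
  simp

variable {U : Set (E d)} {a : E d → Matrix (Fin d) (Fin d) ℝ} {c : ℝ}
    {H : Type} [NormedAddCommGroup H] [InnerProductSpace ℝ H] [CompleteSpace H]
    {ι : H →L[ℝ] Lp ℝ 2 (volume : Measure (E d))}

/-- The Green operator in terms of an energy embedding. -/
def greenOp (U : Set (E d)) (ι : H →L[ℝ] Lp ℝ 2 (volume : Measure (E d))) :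
    Lp ℝ 2 (volume.restrict U) →L[ℝ] Lp ℝ 2 (volume.restrict U) :=
  (restr ℝ U ∘L ι) ∘L (restr ℝ U ∘L ι).adjoint

theorem inner_comp_adjoint {X Y : Type*} [NormedAddCommGroup X] [InnerProductSpace ℝ X]
    [CompleteSpace X] [NormedAddCommGroup Y] [InnerProductSpace ℝ Y] [CompleteSpace Y]
    (J : X →L[ℝ] Y) (f g : Y) : ⟪(J ∘L J.adjoint) f, g⟫ = ⟪J.adjoint f, J.adjoint g⟫ :=
  (J.adjoint_inner_right (J.adjoint f) g).symm

theorem inner_greenOp (f g : Lp ℝ 2 (volume.restrict U)) :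
    ⟪greenOp U ι f, g⟫ = ⟪(restr ℝ U ∘L ι).adjoint f, (restr ℝ U ∘L ι).adjoint g⟫ :=
  inner_comp_adjoint (restr ℝ U ∘L ι) f g

theorem isSymmetric_greenOp :
    (greenOp U ι : Lp ℝ 2 (volume.restrict U) →ₗ[ℝ] Lp ℝ 2 (volume.restrict U)).IsSymmetric := by
  intro f g
  have h1 := inner_greenOp (ι := ι) f g
  have h2 := inner_greenOp (ι := ι) g f
  rw [ContinuousLinearMap.coe_coe, h1, real_inner_comm, ← h2, real_inner_comm]

theorem coeFn_greenOp (f : Lp ℝ 2 (volume.restrict U)) :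
    greenOp U ι f =ᵐ[volume.restrict U] ι ((restr ℝ U ∘L ι).adjoint f) :=
  LpToLpRestrictCLM_coeFn (p := 2) ℝ U _

theorem IsEnergyEmbedding.mem_meanEigenvalues [IsFiniteMeasure (volume.restrict U)]
    (hι : IsEnergyEmbedding U a c ι) (b : ℝ) :
    b ∈ meanEigenvalues U a ↔
      ∃ ψ, greenOp U ι ψ = b • ψ ∧ ⟪oneLp (volume.restrict U), ψ⟫ ≠ 0 := by
  have key : ∀ ψ : Lp ℝ 2 (volume.restrict U), greenOp U ι ψ = b • ψ ↔
      ∀ᵐ y ∂(volume.restrict U), ι ((restr ℝ U ∘L ι).adjoint ψ) y = b * ψ y := by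
    intro ψ
    rw [Lp.ext_iff]
    have h1 := coeFn_greenOp (ι := ι) ψ
    have h2 := Lp.coeFn_smul b ψ
    constructor <;> intro h <;> filter_upwards [h1, h2, h] with y e1 e2 e3
    · rw [← e1, e3, e2]; rfl
    · rw [e1, e3, e2]; rfl
  constructor
  · rintro ⟨ψ, w, hw, hb, hm⟩
    rw [hι.solution_iff ψ ψ EventuallyEq.rfl] at hw
    refine ⟨ψ, (key ψ).mpr (by rw [hw]; exact hb), ?_⟩
    rw [inner_oneLp]
    exact hm
  · rintro ⟨ψ, hb, hm⟩
    rw [inner_oneLp] at hm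
    exact ⟨ψ, _, (hι.solution_iff ψ ψ EventuallyEq.rfl _).mpr rfl, (key ψ).mp hb, hm⟩

theorem nonneg_of_greenOp_eq_smul {ψ : Lp ℝ 2 (volume.restrict U)} {b : ℝ}
    (h : greenOp U ι ψ = b • ψ) (h0 : ψ ≠ 0) : 0 ≤ b := by
  have h1 : ⟪greenOp U ι ψ, ψ⟫ = b * ‖ψ‖ ^ 2 := by
    rw [h, real_inner_smul_left, real_inner_self_eq_norm_sq]
  have h2 : 0 ≤ ⟪greenOp U ι ψ, ψ⟫ := by
    rw [inner_greenOp]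
    exact real_inner_self_nonneg
  rw [h1] at h2
  exact nonneg_of_mul_nonneg_left h2 (by positivity)

/-- Any solution of the resolvent equation has the integral predicted by a solution on the
inclusion. -/
theorem IsEnergyEmbedding.integral_of_isResolventOfOne [IsFiniteMeasure (volume.restrict U)]
    (hι : IsEnergyEmbedding U a c ι) (hU : MeasurableSet U) (hUY : U ⊆ unitCell d) {κ l : ℝ}
    (hl : l ≠ 0) {b : Lp ℝ 2 (volume.restrict (unitCell d))} (hb : IsResolventOfOne U a κ l⁻¹ b)
    {x : Lp ℝ 2 (volume.restrict U)}
    (hx : x - l • (κ • greenOp U ι) x = oneLp (volume.restrict U)) :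
    ∫ y in unitCell d, b y = l * volume.real (unitCell d \ U) +
      l * ⟪oneLp (volume.restrict U), x⟫ := by
  obtain ⟨w, hw, hbw⟩ := hb
  have hbU : MemLp b 2 (volume.restrict U) :=
    (Lp.memLp b).mono_measure (Measure.restrict_mono hUY le_rfl)
  set f := hbU.toLp b with hf
  have hfb : f =ᵐ[volume.restrict U] b := hbU.coeFn_toLp
  have hw' : ι ((restr ℝ U ∘L ι).adjoint f) = w :=
    (hι.solution_iff f b hfb.symm w).mp hw
  have hfeq : f - l • (κ • greenOp U ι) f = l • oneLp (volume.restrict U) := by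
    rw [Lp.ext_iff]
    have h1 := coeFn_greenOp (ι := ι) f
    rw [hw'] at h1
    have h2 := ae_restrict_of_ae_restrict_of_subset hUY hbw
    filter_upwards [Lp.coeFn_sub f (l • (κ • greenOp U ι) f),
      Lp.coeFn_smul l ((κ • greenOp U ι) f), Lp.coeFn_smul κ (greenOp U ι f),
      Lp.coeFn_smul l (oneLp (volume.restrict U)), coeFn_oneLp (volume.restrict U), h1, h2, hfb]
      with y e1 e2 e3 e4 e5 e6 e7 e8
    have e3' : ((κ • greenOp U ι) f) y = κ * w y := by
      rw [← e6]; exact e3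
    rw [e1, e4, Pi.sub_apply, e2, Pi.smul_apply, Pi.smul_apply, e5, e3', e8]
    simp only [smul_eq_mul]
    field_simp at e7
    linarith
  -- `f` solves the same equation as `x` with right side `l` times 1. Pairing one with the other by
  -- symmetry fixes the integral of `f` without uniqueness, so the choice made in `gammaK` does not
  -- matter even where mean-zero eigenfunctions exist.
  have hinner : ⟪oneLp (volume.restrict U), f⟫ = l * ⟪oneLp (volume.restrict U), x⟫ := by
    have hs : ⟪greenOp U ι x, f⟫ = ⟪x, greenOp U ι f⟫ := isSymmetric_greenOp x f
    have h1 : ⟪x - l • (κ • greenOp U ι) x, f⟫ = ⟪x, f - l • (κ • greenOp U ι) f⟫ := by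
      simp only [inner_sub_left, inner_sub_right, real_inner_smul_left, real_inner_smul_right,
        smul_apply, hs]
    rw [hx, hfeq, real_inner_smul_right, real_inner_comm (oneLp (volume.restrict U)) x] at h1
    exact h1
  -- Off the inclusion `w = 0`, and the equation reduces to `-l⁻¹ b = -1`.
  have hw0 : ∀ᵐ y ∂(volume.restrict (unitCell d \ U)), b y = l := by
    have h1 := ae_restrict_of_ae_restrict_of_subset (sdiff_subset : unitCell d \ U ⊆ unitCell d) hbw
    have h2 := hι.ae_eq_zero ((restr ℝ U ∘L ι).adjoint f)
    rw [hw'] at h2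
    have h3 := ae_restrict_of_ae_restrict_of_subset (fun y hy => hy.2 : unitCell d \ U ⊆ Uᶜ) h2
    filter_upwards [h1, h3] with y e1 e2
    rw [e2] at e1
    field_simp at e1
    linarith
  have hbi : IntegrableOn b (unitCell d) := (Lp.memLp b).integrable (by simp)
  have hsplit := integral_inter_add_sdiff hU hbi
  rw [inter_eq_self_of_subset_right hUY] at hsplit
  rw [← hsplit, add_comm, integral_congr_ae hw0, ← integral_congr_ae hfb, ← inner_oneLp, hinner]
  simp [mul_comm]

/-- Solving `κ w - l⁻¹ b = -1` for `b` gives `b = l (κ w + 1)` on the whole cell; on the inclusion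
this coincides with `l x`. -/
theorem IsEnergyEmbedding.exists_isResolventOfOne [IsFiniteMeasure (volume.restrict U)]
    (hι : IsEnergyEmbedding U a c ι) {κ l : ℝ}
    (hl : l ≠ 0) {x : Lp ℝ 2 (volume.restrict U)} (hUY : U ⊆ unitCell d)
    (hx : x - l • (κ • greenOp U ι) x = oneLp (volume.restrict U)) :
    ∃ b, IsResolventOfOne U a κ l⁻¹ b := by
  set w := ι ((restr ℝ U ∘L ι).adjoint (l • x)) with hw
  have hm : MemLp (fun y => l * (κ * w y + 1)) 2 (volume.restrict (unitCell d)) :=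
    ((((Lp.memLp w).restrict (unitCell d)).const_mul κ).add (memLp_const 1)).const_mul l
  have hmb := hm.coeFn_toLp
  refine ⟨hm.toLp _, w, ?_, ?_⟩
  · refine (hι.solution_iff (l • x) _ ?_ w).mpr hw.symm
    have h1 := coeFn_greenOp (ι := ι) (l • x)
    rw [map_smul] at h1
    filter_upwards [ae_restrict_of_ae_restrict_of_subset hUY hmb, h1, Lp.ext_iff.mp hx,
      Lp.coeFn_sub x (l • (κ • greenOp U ι) x),
      Lp.coeFn_smul l ((κ • greenOp U ι) x), Lp.coeFn_smul κ (greenOp U ι x),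
      Lp.coeFn_smul l (greenOp U ι x), Lp.coeFn_smul l x,
      coeFn_oneLp (volume.restrict U)] with y e1 e2 e3 e4 e5 e6 e7 e8 e9
    have e6' : ((κ • greenOp U ι) x) y = κ * greenOp U ι x y := e6
    rw [e4, Pi.sub_apply, e5, Pi.smul_apply, e6', e9] at e3
    rw [e7, Pi.smul_apply] at e2
    rw [e1, e8, ← e2, Pi.smul_apply]
    simp only [smul_eq_mul] at *
    linear_combination (-l) * e3
  · filter_upwards [hmb] with y e1
    rw [e1]
    field_simp
    ring

theorem IsEnergyEmbedding.betaK_eq [IsFiniteMeasure (volume.restrict U)]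
    (hι : IsEnergyEmbedding U a c ι) (hU : MeasurableSet U) (hUY : U ⊆ unitCell d) {κ l : ℝ}
    (hl : l ≠ 0) {x : Lp ℝ 2 (volume.restrict U)}
    (hx : x - l • (κ • greenOp U ι) x = oneLp (volume.restrict U)) :
    betaK U a κ l = l * volume.real (unitCell d \ U) +
      l * ⟪oneLp (volume.restrict U), x⟫ := by
  have h := hι.exists_isResolventOfOne hl hUY hx
  rw [betaK, gammaK, dif_pos h]
  exact hι.integral_of_isResolventOfOne hU hUY hl h.choose_spec hx

end Inclusion

/-! ### Monotonicity of β_κ between consecutive poles -/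

section Poles

variable {ω : Set (E d)} {A : E d → Matrix (Fin d) (Fin d) ℝ} {c : ℝ}
    {H : Type} [NormedAddCommGroup H] [InnerProductSpace ℝ H] [CompleteSpace H]
    {ι : H →L[ℝ] Lp ℝ 2 (volume : Measure (E d))} {β : ℕ → ℝ}

/-- The Green operator is nonnegative, so the next term is at least zero, and the sequence decreases
strictly. -/
theorem IsEnergyEmbedding.meanEigenvalue_pos [IsFiniteMeasure (volume.restrict ω)]
    (hι : IsEnergyEmbedding ω A c ι) (hβ : IsMeanEigenvalueSequence ω A β) {n : ℕ} (hn : 1 ≤ n) :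
    0 < β n := by
  have h1 : β (n + 1) ∈ meanEigenvalues ω A := by
    rw [← hβ.2]
    exact mem_image_of_mem β (by simp : n + 1 ∈ Ici 1)
  obtain ⟨ψ, hψ, hm⟩ := (hι.mem_meanEigenvalues _).mp h1
  have h2 : 0 ≤ β (n + 1) := nonneg_of_greenOp_eq_smul hψ fun h => hm (by rw [h, inner_zero_right])
  exact h2.trans_lt (hβ.1 (by simpa using hn) (by simp) (Nat.lt_succ_self n))

theorem pole_nonneg (hβ : ∀ n, 1 ≤ n → 0 < β n) {κ : ℝ} (hκ : 0 < κ) (i : ℕ) :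
    0 ≤ pole κ β i := by
  unfold pole
  split_ifs with h
  · exact le_rfl
  · have := hβ i (Nat.one_le_iff_ne_zero.mpr h)
    positivity

theorem pole_lt_pole (hβ : ∀ n, 1 ≤ n → 0 < β n) (hβ' : StrictAntiOn β (Ici 1)) {κ : ℝ}
    (hκ : 0 < κ) {i j : ℕ} (hij : i < j) : pole κ β i < pole κ β j := by
  have hj : j ≠ 0 := by omega
  have h1 := hβ j (Nat.one_le_iff_ne_zero.mpr hj)
  by_cases hi : i = 0
  · rw [pole, pole, if_pos hi, if_neg hj]
    positivity
  · rw [pole, pole, if_neg hi, if_neg hj]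
    refine inv_strictAnti₀ (by positivity) ?_
    exact mul_lt_mul_of_pos_left (hβ' (Nat.one_le_iff_ne_zero.mpr hi)
      (Nat.one_le_iff_ne_zero.mpr hj) hij) hκ

/-- Between consecutive poles `β_κ` is increasing, with slope at least the volume of the matrix
phase, and takes all positive values. -/
theorem IsEnergyEmbedding.betaK_between_poles (hι : IsEnergyEmbedding ω A c ι)
    (hω : IsModelInclusion ω) (hc : 0 < c) (hβ : IsMeanEigenvalueSequence ω A β) {κ : ℝ}
    (hκ : 0 < κ) (i : ℕ) :
    (∀ l ∈ Ioo (pole κ β i) (pole κ β (i + 1)), ∀ m ∈ Ioo (pole κ β i) (pole κ β (i + 1)), l ≤ m →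
      volume.real (unitCell d \ ω) * (m - l) ≤ betaK ω A κ m - betaK ω A κ l) ∧
    ∀ θ > 0, ∃ l ∈ Ioo (pole κ β i) (pole κ β (i + 1)), betaK ω A κ l = θ := by
  have hfin : IsFiniteMeasure (volume.restrict ω) :=
    isFiniteMeasure_of_le (volume.restrict (unitCell d))
      (Measure.restrict_mono hω.subset_cell le_rfl)
  have hωm := hω.isOpen.measurableSet
  have hpos : ∀ n, 1 ≤ n → 0 < β n := fun n hn => hι.meanEigenvalue_pos hβ hn
  have hpn := pole_nonneg hpos hκ
  have hpl : ∀ {i j : ℕ}, i < j → pole κ β i < pole κ β j := fun h => pole_lt_pole hpos hβ.1 hκ h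
  have heig : ∀ n, n ≠ 0 → ∃ e, (κ • greenOp ω ι) e = (pole κ β n)⁻¹ • e ∧
      ⟪oneLp (volume.restrict ω), e⟫ ≠ 0 := by
    intro n hn
    have h1 : β n ∈ meanEigenvalues ω A := by
      rw [← hβ.2]
      exact mem_image_of_mem β (Nat.one_le_iff_ne_zero.mpr hn)
    obtain ⟨ψ, hψ, hm⟩ := (hι.mem_meanEigenvalues _).mp h1
    refine ⟨ψ, ?_, hm⟩
    rw [pole, if_neg hn, inv_inv, smul_apply, hψ, smul_smul]
  have hcomp : IsCompactOperator (κ • greenOp ω ι) :=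
    ((hι.isCompactOperator hωm hc hω.isBounded).comp_clm _).smul κ
  have hsym : (κ • greenOp ω ι : Lp ℝ 2 (volume.restrict ω) →L[ℝ] Lp ℝ 2 (volume.restrict ω)).toLinearMap.IsSymmetric := by
    intro f g
    have hs : ⟪greenOp ω ι f, g⟫ = ⟪f, greenOp ω ι g⟫ := isSymmetric_greenOp f g
    simp only [ContinuousLinearMap.coe_coe, smul_apply, real_inner_smul_left,
      real_inner_smul_right, hs]
  -- An eigenvalue seen by the constant 1 is the inverse of some `pole κ β n`, and the `n`-th pole
  -- lies either right of the interval or left of it. The two factors are accordingly both positive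
  -- or both negative.
  have hgap : ∀ e b, (κ • greenOp ω ι) e = b • e → ⟪oneLp (volume.restrict ω), e⟫ ≠ 0 →
      ∀ l ∈ Ioo (pole κ β i) (pole κ β (i + 1)), ∀ m ∈ Ioo (pole κ β i) (pole κ β (i + 1)),
        0 < (1 - l * b) * (1 - m * b) := by
    intro e b he hm l hl m hm'
    have hmem : κ⁻¹ * b ∈ meanEigenvalues ω A := by
      refine (hι.mem_meanEigenvalues _).mpr ⟨e, ?_, hm⟩
      rw [mul_smul, ← he, smul_apply, smul_smul, inv_mul_cancel₀ hκ.ne', one_smul]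
    rw [← hβ.2] at hmem
    obtain ⟨n, hn, hnb⟩ := hmem
    have hn' : n ≠ 0 := Nat.one_le_iff_ne_zero.mp hn
    have hbn : b = (pole κ β n)⁻¹ := by
      rw [pole, if_neg hn', inv_inv, hnb, mul_inv_cancel_left₀ hκ.ne']
    have hp0 : 0 < pole κ β n := (hpn 0).trans_lt (hpl (Nat.pos_of_ne_zero hn'))
    rw [hbn, ← div_eq_mul_inv, ← div_eq_mul_inv]
    rcases Nat.lt_or_ge i n with hin | hin
    · have hle : pole κ β (i + 1) ≤ pole κ β n := by
        rcases (Nat.succ_le_of_lt hin).eq_or_lt with h | h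
        · rw [← h]
        · exact (hpl h).le
      exact mul_pos (sub_pos.mpr ((div_lt_one hp0).mpr (hl.2.trans_le hle)))
        (sub_pos.mpr ((div_lt_one hp0).mpr (hm'.2.trans_le hle)))
    · have hle : pole κ β n ≤ pole κ β i := by
        rcases hin.eq_or_lt with h | h
        · rw [h]
        · exact (hpl h).le
      exact mul_pos_of_neg_of_neg (sub_neg.mpr ((one_lt_div hp0).mpr (hle.trans_lt hl.1)))
        (sub_neg.mpr ((one_lt_div hp0).mpr (hle.trans_lt hm'.1)))
  have hp' : pole κ β i = 0 ∨ ∃ e, (κ • greenOp ω ι) e = (pole κ β i)⁻¹ • e ∧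
      ⟪oneLp (volume.restrict ω), e⟫ ≠ 0 := by
    by_cases hi : i = 0
    · left
      rw [pole, if_pos hi]
    · exact Or.inr (heig i hi)
  obtain ⟨x, h1, h2, h3⟩ := exists_zhikov hcomp hsym (oneLp (volume.restrict ω)) (hpn i)
    (hpl (Nat.lt_succ_self i)) hω.volume_real_pos hgap (heig (i + 1) (by omega)) hp'
  have hb : ∀ l ∈ Ioo (pole κ β i) (pole κ β (i + 1)), betaK ω A κ l =
      l * volume.real (unitCell d \ ω) + l * ⟪oneLp (volume.restrict ω), x l⟫ := fun l hl =>
    hι.betaK_eq hωm hω.subset_cell ((hpn i).trans_lt hl.1).ne' (h1 l hl)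
  constructor
  · intro l hl m hm hlm
    rw [hb l hl, hb m hm]
    exact h2 l hl m hm hlm
  · intro θ hθ
    obtain ⟨l, hl, hlθ⟩ := h3 θ hθ
    exact ⟨l, hl, (hb l hl).trans hlθ⟩

end Poles

/-! ### Comparison of the homogenized and the perturbed operator -/

section Comparison

variable {H L : Type} [NormedAddCommGroup H] [InnerProductSpace ℝ H]
  [NormedAddCommGroup L] [InnerProductSpace ℝ L]

/-- The interpolation `a + (1 - a) Q` between a projection and the identity. -/
def mixOp (Q : L →L[ℝ] L) (a : ℝ) : L →L[ℝ] L := a • (1 : L →L[ℝ] L) + (1 - a) • Q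

theorem mixOp_apply (Q : L →L[ℝ] L) (a : ℝ) (f : L) : mixOp Q a f = a • f + (1 - a) • Q f := rfl

theorem isSymmetric_mixOp {Q : L →L[ℝ] L} (hQ : (Q : L →ₗ[ℝ] L).IsSymmetric) (a : ℝ) :
    (mixOp Q a : L →ₗ[ℝ] L).IsSymmetric := by
  intro f g
  have h : ⟪Q f, g⟫ = ⟪f, Q g⟫ := hQ f g
  simp only [ContinuousLinearMap.coe_coe, mixOp_apply, inner_add_left, inner_add_right,
    real_inner_smul_left, real_inner_smul_right, h]

variable [CompleteSpace H] [CompleteSpace L]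

theorem inner_sandwich_mixOp (J : H →L[ℝ] L) (Q : L →L[ℝ] L) (a : ℝ) (w : H) :
    ⟪sandwich J (mixOp Q a) w, w⟫ = a * ‖J w‖ ^ 2 + (1 - a) * ⟪Q (J w), J w⟫ := by
  rw [inner_sandwich, mixOp_apply, inner_add_left, real_inner_smul_left, real_inner_smul_left,
    real_inner_self_eq_norm_sq]

/-- Multiplied by `t`, the form with `a = l / t` becomes `l (N - q) + t q`, where `N = ‖J w‖²` and
`q = ⟪Q (J w), J w⟫`. Since `0 ≤ q ≤ N` and `N > 0` on the trial space, it grows strictly when `l`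
and `t` both grow. An eigenvalue count reached at `t₁⁻¹` is therefore exceeded strictly above
`t₂⁻¹`. -/
theorem le_rank_eigenSpan_sandwich_mixOp {J : H →L[ℝ] L} (hJ : IsCompactOperator J)
    {Q : L →L[ℝ] L} (hQ : (Q : L →ₗ[ℝ] L).IsSymmetric) (h0 : ∀ f, 0 ≤ ⟪Q f, f⟫)
    (h1 : ∀ f, ⟪Q f, f⟫ ≤ ‖f‖ ^ 2) {l₁ l₂ t₁ t₂ : ℝ} (hl : l₁ < l₂)
    (ht₁ : 0 < t₁) (ht : t₁ < t₂) {j : ℕ}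
    (hj : (j : Cardinal) ≤
      Module.rank ℝ (eigenSpan (sandwich J (mixOp Q (l₁ / t₁)) : H →ₗ[ℝ] H) (Ici t₁⁻¹))) :
    (j : Cardinal) ≤
      Module.rank ℝ (eigenSpan (sandwich J (mixOp Q (l₂ / t₂)) : H →ₗ[ℝ] H) (Ioi t₂⁻¹)) := by
  refine le_rank_eigenSpan_of_forall (isSymmetric_sandwich J (isSymmetric_mixOp hQ _))
    (isCompactOperator_sandwich hJ _) (isSymmetric_sandwich J (isSymmetric_mixOp hQ _)) hj ?_
  intro w hw h
  rw [inner_sandwich_mixOp] at h ⊢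
  have ht₂ : 0 < t₂ := ht₁.trans ht
  have hw' : 0 < ‖w‖ ^ 2 := by positivity
  have q0 := h0 (J w)
  have q1 := h1 (J w)
  set q := ⟪Q (J w), J w⟫
  set N := ‖J w‖ ^ 2
  have e1 : ‖w‖ ^ 2 ≤ l₁ * N + (t₁ - l₁) * q := by
    have := mul_le_mul_of_nonneg_left h ht₁.le
    field_simp at this
    linarith
  have hN : 0 < N := by
    by_contra hN
    have : q = 0 := by linarith
    have : N = 0 := by linarith
    simp_all
  have e2 : l₁ * N + (t₁ - l₁) * q < l₂ * N + (t₂ - l₂) * q := by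
    rcases q0.eq_or_lt with hq | hq
    · rw [← hq]; nlinarith
    · nlinarith
  have e3 : t₂⁻¹ * ‖w‖ ^ 2 < t₂⁻¹ * (l₂ * N + (t₂ - l₂) * q) :=
    mul_lt_mul_of_pos_left (e1.trans_lt e2) (inv_pos.mpr ht₂)
  refine e3.trans_eq ?_
  field_simp

/-- Weyl's inequality: the forms of the two operators differ by `(1 - a) (‖J w‖² - ⟪Q (J w), J w⟫)`,
so their `j`-th eigenvalues differ by at most the supremum of this over unit vectors. -/
theorem abs_inv_sub_inv_le {J : H →L[ℝ] L} (hJ : IsCompactOperator J)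
    {Q : L →L[ℝ] L} (hQ : (Q : L →ₗ[ℝ] L).IsSymmetric)
    (h1 : ∀ f, ⟪Q f, f⟫ ≤ ‖f‖ ^ 2) {D : ℝ} (hD : ∀ w, ‖J w‖ ^ 2 - ⟪Q (J w), J w⟫ ≤ D * ‖w‖ ^ 2)
    {a s t : ℝ} {j : ℕ}
    (hs : Module.rank ℝ (eigenSpan (sandwich J 1 : H →ₗ[ℝ] H) (Ioi s)) < j)
    (hs' : (j : Cardinal) ≤ Module.rank ℝ (eigenSpan (sandwich J 1 : H →ₗ[ℝ] H) (Ici s)))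
    (ht : Module.rank ℝ (eigenSpan (sandwich J (mixOp Q a) : H →ₗ[ℝ] H) (Ioi t)) < j)
    (ht' : (j : Cardinal) ≤
      Module.rank ℝ (eigenSpan (sandwich J (mixOp Q a) : H →ₗ[ℝ] H) (Ici t))) :
    |s - t| ≤ |1 - a| * D := by
  have hS1 := isSymmetric_sandwich J (M := 1) (fun f g => rfl)
  have hS2 := isSymmetric_sandwich J (isSymmetric_mixOp hQ a)
  have hd : ∀ w, |⟪sandwich J 1 w, w⟫ - ⟪sandwich J (mixOp Q a) w, w⟫| ≤
      |1 - a| * D * ‖w‖ ^ 2 := by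
    intro w
    have e : ⟪sandwich J 1 w, w⟫ = ‖J w‖ ^ 2 := by
      rw [inner_sandwich, ← real_inner_self_eq_norm_sq]; rfl
    rw [e, inner_sandwich_mixOp, show ‖J w‖ ^ 2 - (a * ‖J w‖ ^ 2 + (1 - a) * ⟪Q (J w), J w⟫) =
      (1 - a) * (‖J w‖ ^ 2 - ⟪Q (J w), J w⟫) by ring, abs_mul, mul_assoc,
      abs_of_nonneg (sub_nonneg.mpr (h1 (J w)))]
    exact mul_le_mul_of_nonneg_left (hD w) (abs_nonneg _)
  rw [abs_le]
  constructor
  · by_contra! hcon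
    refine absurd (le_rank_eigenSpan_of_forall hS2 (isCompactOperator_sandwich hJ 1) hS1 ht'
      fun w hw h => ?_) (not_le.mpr hs)
    have h2 := (abs_le.mp (hd w)).1
    have hw' : 0 < ‖w‖ ^ 2 := by positivity
    nlinarith
  · by_contra! hcon
    refine absurd (le_rank_eigenSpan_of_forall hS1 (isCompactOperator_sandwich hJ _) hS2 hs'
      fun w hw h => ?_) (not_le.mpr ht)
    have h2 := (abs_le.mp (hd w)).2
    have hw' : 0 < ‖w‖ ^ 2 := by positivity
    nlinarith

end Comparison

theorem comp_smul {X Y Z : Type*} [NormedAddCommGroup X] [NormedSpace ℝ X] [NormedAddCommGroup Y]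
    [NormedSpace ℝ Y] [NormedAddCommGroup Z] [NormedSpace ℝ Z] (C : Y →L[ℝ] Z) (B : X →L[ℝ] Y)
    (s : ℝ) (x : X) : C (B (s • x)) = s • C (B x) := by simp

/-! ### From weak formulations to compact operators -/

section Translation

variable {U ω : Set (E d)} {A : E d → Matrix (Fin d) (Fin d) ℝ} {Ahat : Matrix (Fin d) (Fin d) ℝ}
    {c : ℝ} {H : Type} [NormedAddCommGroup H] [InnerProductSpace ℝ H] [CompleteSpace H]
    {ι : H →L[ℝ] Lp ℝ 2 (volume : Measure (E d))}

theorem IsEnergyEmbedding.mem_homogenizedEigenspace (hι : IsEnergyEmbedding U (fun _ => Ahat) c ι)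
    (s : ℝ) (u : Lp ℝ 2 (volume : Measure (E d))) :
    u ∈ homogenizedEigenspace U Ahat s ↔ s • ι ((restr ℝ U ∘L ι).adjoint (restr ℝ U u)) = u := by
  have h : (fun x => s * u x) =ᵐ[volume.restrict U] (s • restr ℝ U u : Lp ℝ 2 (volume.restrict U)) := by
    filter_upwards [LpToLpRestrictCLM_coeFn (p := 2) ℝ U u, Lp.coeFn_smul s (restr ℝ U u)]
      with x h1 h2
    rw [h2, Pi.smul_apply, h1, smul_eq_mul]
  rw [homogenizedEigenspace, mem_ofPred_eq, hι.solution_iff _ _ h,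
    comp_smul ι (restr ℝ U ∘L ι).adjoint s (restr ℝ U u)]

theorem IsEnergyEmbedding.eq_zero_of_mem_homogenizedEigenspace
    (hι : IsEnergyEmbedding U (fun _ => Ahat) c ι) {s : ℝ} (hs : s ≤ 0)
    {u : Lp ℝ 2 (volume : Measure (E d))} (hu : u ∈ homogenizedEigenspace U Ahat s) : u = 0 := by
  rw [hι.mem_homogenizedEigenspace] at hu
  set f := restr ℝ U u with hf
  have h1 : s • greenOp U ι f = f := by
    have : restr ℝ U (s • ι ((restr ℝ U ∘L ι).adjoint f)) = f := by rw [hu]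
    rw [map_smul] at this
    exact this
  have h2 : ‖f‖ ^ 2 = s * ⟪greenOp U ι f, f⟫ := by
    rw [← real_inner_smul_left, h1, real_inner_self_eq_norm_sq]
  have h3 : 0 ≤ ⟪greenOp U ι f, f⟫ := by
    rw [inner_greenOp]
    exact real_inner_self_nonneg
  have h4 : f = 0 := by
    have : ‖f‖ ^ 2 ≤ 0 := by rw [h2]; exact mul_nonpos_of_nonpos_of_nonneg hs h3
    have := le_antisymm this (sq_nonneg _)
    simpa using this
  rw [← hu, h4, map_zero, map_zero, smul_zero]

/-- Eigenfunctions are functions on the whole space, so the swap of factors is done for `ι` and `J†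
∘ restr` rather than for `J` and `J†`; the other order is again `J† J`. Values `s ≤ 0` contribute
only the zero function, the rest correspond by `s ↦ s⁻¹`. -/
theorem IsEnergyEmbedding.rank_homogenizedEigenspace (hι : IsEnergyEmbedding U (fun _ => Ahat) c ι)
    {S S' : Set ℝ} (h0 : ∀ b ∈ S', 0 < b) (hS : ∀ s, 0 < s → (s ∈ S ↔ s⁻¹ ∈ S')) :
    Module.rank ℝ (Submodule.span ℝ {u | ∃ s, s ∈ S ∧ u ∈ homogenizedEigenspace U Ahat s}) =
      Module.rank ℝ (eigenSpan (sandwich (restr ℝ U ∘L ι) 1 : H →ₗ[ℝ] H) S') := by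
  have hsym : (((restr ℝ U ∘L ι).adjoint ∘L restr ℝ U).toLinearMap ∘ₗ ι.toLinearMap).IsSymmetric :=
    isSymmetric_sandwich (restr ℝ U ∘L ι) (M := 1) (fun f g => rfl)
  have h1 := rank_eigenSpan_comp ι.toLinearMap
    ((restr ℝ U ∘L ι).adjoint ∘L restr ℝ U).toLinearMap hsym (fun b hb => (h0 b hb).ne')
  have h2 : Submodule.span ℝ {u | ∃ s, s ∈ S ∧ u ∈ homogenizedEigenspace U Ahat s} =
      eigenSpan (ι.toLinearMap ∘ₗ ((restr ℝ U ∘L ι).adjoint ∘L restr ℝ U).toLinearMap) S' := by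
    refine le_antisymm (Submodule.span_le.mpr ?_) (Submodule.span_le.mpr ?_)
    · rintro u ⟨s, hs, hu⟩
      rcases le_or_gt s 0 with hs0 | hs0
      · rw [hι.eq_zero_of_mem_homogenizedEigenspace hs0 hu]
        exact Submodule.zero_mem _
      · refine Submodule.subset_span ⟨s⁻¹, (hS s hs0).mp hs, ?_⟩
        rw [hι.mem_homogenizedEigenspace] at hu
        rw [eq_inv_smul_iff₀ hs0.ne']
        exact hu
    · rintro u ⟨b, hb, hu⟩
      have hb0 := h0 b hb
      refine Submodule.subset_span ⟨b⁻¹, (hS _ (inv_pos.mpr hb0)).mpr (by rwa [inv_inv]), ?_⟩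
      rw [hι.mem_homogenizedEigenspace, inv_smul_eq_iff₀ hb0.ne']
      exact hu
  rw [h2, h1]
  rfl

/-- The eigenvalues of the homogenized operator as those of a compact operator. -/
theorem IsEnergyEmbedding.of_isNthSmallestEigenvalue
    (hι : IsEnergyEmbedding U (fun _ => Ahat) c ι) {j : ℕ} (hj : 1 ≤ j) {θ : ℝ}
    (h : IsNthSmallestEigenvalue (homogenizedEigenspace U Ahat) j θ) :
    0 < θ ∧
    Module.rank ℝ (eigenSpan (sandwich (restr ℝ U ∘L ι) 1 : H →ₗ[ℝ] H) (Ioi θ⁻¹)) < j ∧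
    (j : Cardinal) ≤
      Module.rank ℝ (eigenSpan (sandwich (restr ℝ U ∘L ι) 1 : H →ₗ[ℝ] H) (Ici θ⁻¹)) := by
  obtain ⟨h1, h2⟩ := h
  have hθ : 0 < θ := by
    by_contra hθ
    have : Submodule.span ℝ {u | ∃ s, s ≤ θ ∧ u ∈ homogenizedEigenspace U Ahat s} = ⊥ := by
      rw [Submodule.span_eq_bot]
      rintro u ⟨s, hs, hu⟩
      exact hι.eq_zero_of_mem_homogenizedEigenspace (hs.trans (not_lt.mp hθ)) hu
    rw [this, rank_bot] at h2
    have : (1 : Cardinal) ≤ j := by exact_mod_cast hj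
    exact absurd (this.trans h2) (by simp)
  have hθ' := inv_pos.mpr hθ
  refine ⟨hθ, ?_, ?_⟩
  · rw [← hι.rank_homogenizedEigenspace (S := Iio θ) (S' := Ioi θ⁻¹) (fun b hb => hθ'.trans hb) fun s hs => ?_]
    · exact h1
    · rw [mem_Iio, mem_Ioi, inv_lt_inv₀ hθ hs]
  · rw [← hι.rank_homogenizedEigenspace (S := Iic θ) (S' := Ici θ⁻¹) (fun b hb => hθ'.trans_le hb) fun s hs => ?_]
    · exact h2
    · rw [mem_Iic, mem_Ici, inv_le_inv₀ hθ hs]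

theorem smul_add_smul_eq_smul_iff {α : Type*} [MeasurableSpace α] {μ : Measure α} {g p : Lp ℝ 2 μ}
    {v w : α → ℝ} (hg : g =ᵐ[μ] v) (hp : p =ᵐ[μ] w) (a s : ℝ) (f : Lp ℝ 2 μ) :
    a • g + (1 - a) • p = s • f ↔ ∀ᵐ x ∂μ, v x + (1 - a) * (w x - v x) = s * f x := by
  rw [Lp.ext_iff]
  have key : ∀ᵐ x ∂μ, (a • g + (1 - a) • p : Lp ℝ 2 μ) x = v x + (1 - a) * (w x - v x) := by
    filter_upwards [hg, hp, Lp.coeFn_add (a • g) ((1 - a) • p), Lp.coeFn_smul a g,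
      Lp.coeFn_smul (1 - a) p] with x m1 m2 m3 m4 m5
    rw [m3, Pi.add_apply, m4, m5, Pi.smul_apply, Pi.smul_apply, m2, m1, smul_eq_mul, smul_eq_mul]
    ring
  constructor <;> intro h' <;> filter_upwards [key, Lp.coeFn_smul s f, h'] with x m1 m2 m3
  · rw [← m1, m3, m2]; rfl
  · rw [m1, m2, m3]; rfl

/-- With `a = l / β_κ(l)`, which is `r⁻¹ γ_κ(r)⁻¹` at `r = l⁻¹`, one has `v + (1 - a) (Q v - v) = a
v + (1 - a) Q v`. -/
theorem IsEnergyEmbedding.mem_perturbedEigenspace (hι : IsEnergyEmbedding U (fun _ => Ahat) c ι)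
    (hU : MeasurableSet U) {ε : ℝ} (hε : 0 < ε) {F : Finset (Fin d → ℤ)}
    (hF : U ⊆ ⋃ n ∈ F, cell ε n) (κ l s : ℝ) (f : Lp ℝ 2 (volume.restrict U)) :
    f ∈ perturbedEigenspace U ω A Ahat κ ε l⁻¹ s ↔
      (mixOp (cellProj U hε F) (l / betaK ω A κ l) ∘L (restr ℝ U ∘L ι) ∘L
        (restr ℝ U ∘L ι).adjoint) f = s • f := by
  set h := (restr ℝ U ∘L ι).adjoint f with hh
  have e0 : f ∈ perturbedEigenspace U ω A Ahat κ ε l⁻¹ s ↔ ∀ᵐ x ∂(volume.restrict U),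
      ι h x + (1 - l / betaK ω A κ l) * (cellAverage ε (ι h) x - ι h x) = s * f x := by
    have hc : l⁻¹⁻¹ * (gammaK ω A κ l⁻¹)⁻¹ = l / betaK ω A κ l := by
      rw [inv_inv, div_eq_mul_inv, betaK]
    rw [perturbedEigenspace, mem_ofPred_eq, hc]
    constructor
    · rintro ⟨v, hv, hv'⟩
      rw [hι.solution_iff f f EventuallyEq.rfl] at hv
      rw [hh, hv]
      exact hv'
    · intro h'
      exact ⟨_, (hι.solution_iff f f EventuallyEq.rfl _).mpr rfl, h'⟩
  have e1 : (mixOp (cellProj U hε F) (l / betaK ω A κ l) ∘L (restr ℝ U ∘L ι) ∘L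
        (restr ℝ U ∘L ι).adjoint) f = (l / betaK ω A κ l) • (restr ℝ U ∘L ι) h +
        (1 - l / betaK ω A κ l) • cellProj U hε F ((restr ℝ U ∘L ι) h) := rfl
  rw [e0, e1]
  exact (smul_add_smul_eq_smul_iff (LpToLpRestrictCLM_coeFn (p := 2) ℝ U (ι h))
    (hι.cellProj_apply hU hε hF h) (l / betaK ω A κ l) s f).symm

/-- The solutions of the perturbed equation in terms of a compact operator. -/
theorem IsEnergyEmbedding.of_isPerturbedSolution (hι : IsEnergyEmbedding U (fun _ => Ahat) c ι)
    (hU : MeasurableSet U) (hJ : IsCompactOperator (restr ℝ U ∘L ι)) {ε : ℝ} (hε : 0 < ε)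
    {F : Finset (Fin d → ℤ)} (hF : U ⊆ ⋃ n ∈ F, cell ε n) {κ l : ℝ} {β : ℕ → ℝ} {i j : ℕ}
    (hp : 0 ≤ pole κ β i) (h : IsPerturbedSolution U ω A Ahat κ ε β i j l) :
    0 < betaK ω A κ l ∧
    Module.rank ℝ (eigenSpan (sandwich (restr ℝ U ∘L ι)
      (mixOp (cellProj U hε F) (l / betaK ω A κ l)) : H →ₗ[ℝ] H) (Ioi (betaK ω A κ l)⁻¹)) < j ∧
    (j : Cardinal) ≤ Module.rank ℝ (eigenSpan (sandwich (restr ℝ U ∘L ι)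
      (mixOp (cellProj U hε F) (l / betaK ω A κ l)) : H →ₗ[ℝ] H) (Ici (betaK ω A κ l)⁻¹)) := by
  obtain ⟨hl, t, ⟨ht0, h1, h2⟩, rfl⟩ := h
  have hl0 : 0 < l := hp.trans_lt hl.1
  have hset : ∀ S : ℝ → Prop, {u | ∃ s, S s ∧ u ∈ perturbedEigenspace U ω A Ahat κ ε l⁻¹ s} =
      {u | ∃ s, S s ∧ (mixOp (cellProj U hε F) (l / betaK ω A κ l) ∘L (restr ℝ U ∘L ι) ∘L
        (restr ℝ U ∘L ι).adjoint) u = s • u} := fun S => by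
    ext u
    exact exists_congr fun s => and_congr_right fun _ => hι.mem_perturbedEigenspace hU hε hF κ l s u
  rw [hset fun s => (betaK ω A κ l)⁻¹ < s] at h1
  rw [hset fun s => (betaK ω A κ l)⁻¹ ≤ s] at h2
  have hQ : (cellProj U hε F).toLinearMap.IsSymmetric :=
    isSymmetric_rankSum (ε ^ d)⁻¹ (cellVec U hε) F
  have hM := isSymmetric_mixOp hQ (l / betaK ω A κ l)
  -- `betaK` may be negative past the first pole. Then `a < 0` and `mixOp` equals `a` on the kernel
  -- of the finite rank averaging. Infinitely many independent eigenvectors would have eigenvalue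
  -- above `(betaK ω A κ l)⁻¹`, whereas fewer than `j` do.
  have hpos : 0 < betaK ω A κ l := by
    by_contra hneg
    have hneg' : betaK ω A κ l < 0 := lt_of_le_of_ne (not_lt.mp hneg) ht0
    refine not_finiteDimensional_eigenSpan_of_neg hJ hι.infinite_range hM
      (finiteDimensional_range_rankSum (ε ^ d)⁻¹ (cellVec U hε) F)
      (div_neg_of_pos_of_neg hl0 hneg') (fun f hf => ?_) (inv_neg''.mpr hneg') ?_
    · have hf' : cellProj U hε F f = 0 := hf
      rw [mixOp_apply, hf', smul_zero, add_zero]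
    · exact Module.rank_lt_aleph0_iff.mp (lt_of_lt_of_le h1 (Cardinal.natCast_le_aleph0))
  have hpos' := inv_pos.mpr hpos
  refine ⟨hpos, ?_, ?_⟩
  · rw [← rank_eigenSpan_sandwich (restr ℝ U ∘L ι) hM
      (S := Ioi (betaK ω A κ l)⁻¹) fun s hs => (hpos'.trans hs).ne']
    exact h1
  · rw [← rank_eigenSpan_sandwich (restr ℝ U ∘L ι) hM
      (S := Ici (betaK ω A κ l)⁻¹) fun s hs => (hpos'.trans_le hs).ne']
    exact h2

end Translation

/-- From the comparison of inverse eigenvalues to that of eigenvalues. -/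
theorem abs_sub_le_of_abs_inv_sub_inv_le {θ t l D : ℝ} (hθ : 0 < θ) (ht : 0 < t) (hl : 0 < l)
    (hD : 0 ≤ D) (h : |θ⁻¹ - t⁻¹| ≤ |1 - l / t| * D) (hsmall : D * θ ≤ 1 / 2) :
    |θ - t| ≤ 2 * D * θ * (θ + l) := by
  have h1 : |θ - t| ≤ |t - l| * D * θ := by
    have e1 : |θ - t| = |θ⁻¹ - t⁻¹| * (θ * t) := by
      rw [← abs_of_pos (mul_pos hθ ht), ← abs_mul, abs_sub_comm θ t]
      congr 1
      field_simp
    have e2 : |t - l| = |1 - l / t| * t := by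
      rw [← abs_of_pos ht, ← abs_mul, abs_of_pos ht]
      congr 1
      field_simp
    rw [e1, e2]
    calc _ ≤ |1 - l / t| * D * (θ * t) := mul_le_mul_of_nonneg_right h (by positivity)
      _ = _ := by ring
  have h2 : |t - l| ≤ t + l := abs_le.mpr ⟨by linarith, by linarith⟩
  have h3 : |θ - t| ≤ (t + l) * (D * θ) := by
    refine h1.trans ?_
    rw [mul_assoc]
    exact mul_le_mul_of_nonneg_right h2 (by positivity)
  -- A priori bound: `D θ ≤ 1 / 2` allows half of `t` to be absorbed on the left, which removes `t`
  -- from the error.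
  have h4 : t ≤ 2 * θ + l := by
    have e1 := (abs_le.mp h3).1
    have e2 : (t + l) * (D * θ) ≤ (t + l) * (1 / 2) :=
      mul_le_mul_of_nonneg_left hsmall (by positivity)
    linarith
  calc _ ≤ (t + l) * (D * θ) := h3
    _ ≤ (2 * θ + l + l) * (D * θ) := by gcongr
    _ = _ := by ring

/-- Two regimes. If `C₁ ε² θ ≤ 1 / 2`, the eigenvalue estimate and the slope bound apply, with `ε² ≤
ε`. Otherwise `2 C₁ ε θ ≥ 1`, and the claim follows from `|l - lε| ≤ P`, both points lying in `(0,
P)`. -/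
theorem abs_sub_le_of_eigenvalues {v C₁ ε θ t l lε P : ℝ} (hv : 0 < v) (hC₁ : 0 ≤ C₁) (hε : 0 < ε)
    (hε1 : ε < 1) (hθ : 0 < θ) (ht : 0 < t) (hl : 0 < l) (hlP : l < P) (hlε : 0 < lε) (hlεP : lε < P)
    (h : |θ⁻¹ - t⁻¹| ≤ |1 - lε / t| * (C₁ * ε ^ 2)) (hslope : v * |l - lε| ≤ |θ - t|) :
    |l - lε| ≤ (2 * C₁ * (1 + v⁻¹) + 1) * ε * θ * (θ + P) := by
  have hP : 0 < P := hl.trans hlP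
  have hε2 : ε ^ 2 ≤ ε := by nlinarith
  rcases le_or_gt (C₁ * ε ^ 2 * θ) (1 / 2) with hs | hs
  · have h1 := abs_sub_le_of_abs_inv_sub_inv_le hθ ht hlε (by positivity) h hs
    have h2 : 2 * (C₁ * ε ^ 2) * θ * (θ + lε) ≤ 2 * (C₁ * ε) * θ * (θ + P) := by gcongr
    have h3 : |l - lε| ≤ v⁻¹ * (2 * (C₁ * ε) * θ * (θ + P)) := by
      rw [le_inv_mul_iff₀ hv]
      exact hslope.trans (h1.trans h2)
    refine h3.trans ?_
    have : 0 ≤ (2 * C₁ + 1) * ε * θ * (θ + P) := by positivity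
    linarith
  · have h1 : |l - lε| ≤ P := abs_le.mpr ⟨by linarith, by linarith⟩
    have h2 : 1 ≤ 2 * C₁ * ε * θ := by
      have : C₁ * ε ^ 2 * θ ≤ C₁ * ε * θ := by gcongr
      linarith
    have h3 : P ≤ 2 * C₁ * ε * θ * (θ + P) := by
      calc P ≤ 1 * (θ + P) := by linarith
        _ ≤ _ := mul_le_mul_of_nonneg_right h2 (by positivity)
    have : 0 ≤ (2 * C₁ * v⁻¹ + 1) * ε * θ * (θ + P) := by positivity
    linarith

end HighContrast

end

/-! ### Assembly of the theorem -/

open HighContrast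

theorem mainTheorem4 {d : ℕ} (Ω ω : Set (HighContrast.E d))
    (hΩ : HighContrast.IsBoundedLipschitzDomain Ω) (hω : HighContrast.IsModelInclusion ω)
    (ν : ℝ) (hν : 0 < ν) :
    ∃ C : ℝ, 0 < C ∧
      ∀ (A : HighContrast.E d → Matrix (Fin d) (Fin d) ℝ), HighContrast.IsCoefficient ν A →
      ∀ (ε δ κ : ℝ), 0 < ε → ε < 1 → 0 < δ → κ = δ⁻¹ * ε ^ 2 →
      ∀ (χ : Fin d → HighContrast.E d → ℝ) (G : Fin d → HighContrast.E d → HighContrast.E d),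
        (∀ k, HighContrast.IsCorrector ω A δ k (χ k) (G k)) →
      ∀ (Ahat : Matrix (Fin d) (Fin d) ℝ), Ahat = HighContrast.homogenizedMatrix ω A δ G →
      ∀ (β : ℕ → ℝ), HighContrast.IsMeanEigenvalueSequence ω A β →
      ∀ (i j : ℕ), 1 ≤ j →
      ∀ (θ : ℝ), HighContrast.IsNthSmallestEigenvalue
          (HighContrast.homogenizedEigenspace Ω Ahat) j θ →
        (∃! l : ℝ, HighContrast.IsLimitSolution ω A κ β i θ l) ∧
        (∀ l₁ l₂ : ℝ, HighContrast.IsPerturbedSolution Ω ω A Ahat κ ε β i j l₁ →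
          HighContrast.IsPerturbedSolution Ω ω A Ahat κ ε β i j l₂ → l₁ = l₂) ∧
        (ε < C / θ →
          ∀ l lε : ℝ, HighContrast.IsLimitSolution ω A κ β i θ l →
            HighContrast.IsPerturbedSolution Ω ω A Ahat κ ε β i j lε →
            |l - lε| ≤ C * ε * θ * (θ + (κ * β (i + 1))⁻¹)) := by
  have hd : 0 < d := by have := hω.two_le; omega
  obtain ⟨c, hc, hell⟩ := hω.exists_isElliptic_homogenizedMatrix hν
  set v := MeasureTheory.volume.real (unitCell d \ ω) with hv
  have hv0 : 0 < v := hω.volume_real_pos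
  have hC₁ : 0 ≤ cellConst d / c := div_nonneg (cellConst_nonneg d) hc.le
  -- The constant of `abs_sub_le_of_eigenvalues` with `C₁ = cellConst d / c`. Both `c` and `v` are
  -- fixed before the coefficients, `ε` and `δ` are introduced.
  refine ⟨2 * (cellConst d / c) * (1 + v⁻¹) + 1, by positivity, ?_⟩
  rintro A hA ε δ κ hε hε1 hδ hκ χ G hG Ahat rfl β hβ i j hj θ hθ
  have hκ0 : 0 < κ := by rw [hκ]; positivity
  obtain ⟨M, hM⟩ := hell A hA δ hδ χ G hG
  have hΩm := hΩ.isOpen.measurableSet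
  obtain ⟨H, _, _, _, ι, hι⟩ := exists_energyEmbedding hd hΩ.isOpen hΩ.isBounded
    hΩ.isConnected.nonempty hc hM
  obtain ⟨H', _, _, _, ι', hι'⟩ := exists_energyEmbedding hd hω.isOpen hω.isBounded
    hω.nonempty hν (hA.isElliptic hν)
  have hfin : MeasureTheory.IsFiniteMeasure (MeasureTheory.volume.restrict ω) :=
    MeasureTheory.isFiniteMeasure_of_le (MeasureTheory.volume.restrict (unitCell d))
      (MeasureTheory.Measure.restrict_mono hω.subset_cell le_rfl)
  have hJ := hι.isCompactOperator hΩm hc hΩ.isBounded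
  obtain ⟨F, hF⟩ := exists_cover_cell hΩ.isBounded hε
  have hp := pole_nonneg (fun n hn => hι'.meanEigenvalue_pos hβ hn) hκ0 i
  obtain ⟨hmono, hsurj⟩ := hι'.betaK_between_poles hω hν hβ hκ0 i
  obtain ⟨hθ0, hθ1, hθ2⟩ := hι.of_isNthSmallestEigenvalue hj hθ
  have hQ : (cellProj Ω hε F).toLinearMap.IsSymmetric :=
    isSymmetric_rankSum (ε ^ d)⁻¹ (cellVec Ω hε) F
  have hw : 0 ≤ (ε ^ d)⁻¹ := by positivity
  have hQ0 : ∀ f, 0 ≤ inner ℝ (cellProj Ω hε F f) f := fun f => inner_rankSum_nonneg hw f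
  have hQ1 : ∀ f, inner ℝ (cellProj Ω hε F f) f ≤ ‖f‖ ^ 2 := fun f =>
    inner_rankSum_le hw (inner_cellVec_of_ne Ω hε) (norm_cellVec_le Ω hε) f
  have hslope : ∀ l ∈ Set.Ioo (pole κ β i) (pole κ β (i + 1)),
      ∀ m ∈ Set.Ioo (pole κ β i) (pole κ β (i + 1)),
        v * |l - m| ≤ |betaK ω A κ l - betaK ω A κ m| := by
    intro l hl m hm
    rcases le_total l m with h | h
    · rw [abs_sub_comm l m, abs_of_nonneg (sub_nonneg.mpr h), abs_sub_comm]
      exact (hmono l hl m hm h).trans (le_abs_self _)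
    · rw [abs_of_nonneg (sub_nonneg.mpr h)]
      exact (hmono m hm l hl h).trans (le_abs_self _)
  refine ⟨?_, ?_, fun _ l lε hl hlε => ?_⟩
  · obtain ⟨l, hl, hlθ⟩ := hsurj θ hθ0
    refine ⟨l, ⟨hl, hlθ⟩, fun m ⟨hm, hmθ⟩ => ?_⟩
    have h := hslope m hm l hl
    rw [hmθ, hlθ, sub_self, abs_zero] at h
    have : |m - l| ≤ 0 := nonpos_of_mul_nonpos_right h hv0
    exact sub_eq_zero.mp (abs_nonpos_iff.mp this)
  -- If `l₁ < l₂` were both solutions, `betaK` would increase strictly from one to the other. The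
  -- `j` eigenvalues counted at `l₁` would then give `j` of them strictly above the inverse of
  -- `betaK` at `l₂`, where there are fewer than `j`.
  · have key : ∀ l₁ l₂, IsPerturbedSolution Ω ω A (homogenizedMatrix ω A δ G) κ ε β i j l₁ →
        IsPerturbedSolution Ω ω A (homogenizedMatrix ω A δ G) κ ε β i j l₂ → ¬ l₁ < l₂ := by
      intro l₁ l₂ h₁ h₂ hlt
      obtain ⟨p₁, -, q₁⟩ := hι.of_isPerturbedSolution hΩm hJ hε hF hp h₁
      obtain ⟨-, r₂, -⟩ := hι.of_isPerturbedSolution hΩm hJ hε hF hp h₂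
      have ht : betaK ω A κ l₁ < betaK ω A κ l₂ := by
        have h := hmono l₁ h₁.1 l₂ h₂.1 hlt.le
        have : 0 < v * (l₂ - l₁) := mul_pos hv0 (sub_pos.mpr hlt)
        linarith
      exact absurd (le_rank_eigenSpan_sandwich_mixOp hJ hQ hQ0 hQ1 hlt p₁ ht q₁) (not_le.mpr r₂)
    intro l₁ l₂ h₁ h₂
    exact le_antisymm (not_lt.mp (key l₂ l₁ h₂ h₁)) (not_lt.mp (key l₁ l₂ h₁ h₂))
  · obtain ⟨ht, r₁, r₂⟩ := hι.of_isPerturbedSolution hΩm hJ hε hF hp hlε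
    have hD : ∀ w, ‖(restr ℝ Ω ∘L ι) w‖ ^ 2 -
        inner ℝ (cellProj Ω hε F ((restr ℝ Ω ∘L ι) w)) ((restr ℝ Ω ∘L ι) w) ≤
        cellConst d / c * ε ^ 2 * ‖w‖ ^ 2 := fun w => by
      refine (hι.sub_inner_cellProj_le hΩm hε hF w).trans_eq ?_
      ring
    have hinv := abs_inv_sub_inv_le hJ hQ hQ1 hD hθ1 hθ2 r₁ r₂
    have hpole : pole κ β (i + 1) = (κ * β (i + 1))⁻¹ := if_neg (Nat.succ_ne_zero i)
    rw [← hpole]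
    have hs := hslope l hl.1 lε hlε.1
    rw [hl.2] at hs
    exact abs_sub_le_of_eigenvalues hv0 hC₁ hε hε1 hθ0 ht (hp.trans_lt hl.1.1) hl.1.2
      (hp.trans_lt hlε.1.1) hlε.1.2 hinv hs
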